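/- **Conventions.** $\mathcal S(N)$ is the set of symmetric $N\times N$ real matrices with its usual order and with $\|X\|=\max\{|\lambda|:\lambda \text{ an eigenvalue of } X\}$. Let $\Omega\subset\mathbb R^N$ be open such that $\overline\Omega$ is a compact $C^1$ $N$-submanifold of $\mathbb R^N$ with boundary, the manifold boundary being $\partial\Omega$; that is, $\overline\Omega$ is compact and near each point $x\in\partial\Omega$ the set $\Omega$ is $\{\psi<0\}$ for some $C^1$ function $\psi$ with $D\psi(x)\neq0$. Let $n(x)=D\psi(x)/|D\psi(x)|$ be the outward unit normal at $x\in\partial\Omega$. For $u:\overline\Omega\to\mathbb R$ and $x\in\overline\Omega$, let $J^{2,+}_{\overline\Omega}u(x)$ be the set of $(p,X)\in\mathbb R^N\times\mathcal S(N)$ with $$u(y)\le u(x)+\langle p,y-x\rangle+\tfrac12\langle X(y-x),y-x\rangle+o(|y-x|^2)\quad\text{as }\overline\Omega\ni y\to x ,$$ and let $\overline J^{2,+}_{\overline\Omega}u(x)$ be the set of all limits $(p,X)$ of sequences $(p_k,X_k)\in J^{2,+}_{\overline\Omega}u(x_k)$ with $x_k\in\overline\Omega$, $x_k\to x$, $u(x_k)\to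 u(x)$. Put $\overline J^{2,-}_{\overline\Omega}u(x)=-\overline J^{2,+}_{\overline\Omega}(-u)(x)$. For $F:\overline\Omega\times\mathbb R\times\mathbb R^N\times\mathcal S(N)\to\mathbb R$ and $f:\partial\Omega\times\mathbb R\to\mathbb R$ put $B(x,r,p)=\langle n(x),p\rangle+f(x,r)$ and consider $$(\mathrm{BVP})\qquad F(x,u,Du,D^2u)=0\ \text{ in }\Omega,\qquad B(x,u,Du)=0\ \text{ on }\partial\Omega .$$ A *subsolution* of (BVP) is an upper semicontinuous $u:\overline\Omega\to\mathbb R$ such that, for all $(p,X)\in\overline J^{2,+}_{\overline\Omega}u(x)$, one has $F(x,u(x),p,X)\le0$ if $x\in\Omega$ and $\min\{F(x,u(x),p,X),B(x,u(x),p)\}\le0$ if $x\in\partial\Omega$. A *supersolution* is a lower semicontinuous $v:\overline\Omega\to\mathbb R$ such that, for all $(p,X)\in\overline J^{2,-}_{\overline\Omega}v(x)$, one has $F(x,v(x),p,X)\ge0$ if $x\in\Omega$ and $\max\{F(x,v(x),p,X),B(x,v(x),p)\}\ge0$ if $x\in\partial\Omega$. A *solution* is a function that is both (hence is continuous on $\overline\Omega$).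 **Theorem 7.5.** Let $\Omega$ be as above, and assume: 1. (uniform exterior sphere condition) there is $\rho>0$ such that, for every $x\in\partial\Omega$, the closed ball with centre $x+\rho\, n(x)$ and radius $\rho$ does not meet $\Omega$; 2. $F$ is continuous, and proper: $F(x,r,p,X)\le F(x,s,p,Y)$ whenever $r\le s$ and $Y\le X$; 3. there is $\gamma>0$ with $\gamma(r-s)\le F(x,r,p,X)-F(x,s,p,X)$ for all $r\ge s$ and $(x,p,X)\in\overline\Omega\times\mathbb R^N\times\mathcal S(N)$; 4. there are a function $\omega:[0,\infty)\to[0,\infty]$ with $\lim_{t\downarrow0}\omega(t)=0$ and a neighborhood $V$ of $\partial\Omega$ relative to $\overline\Omega$ such that $$|F(x,r,p,X)-F(x,r,q,Y)|\le\omega(|p-q|+\|X-Y\|)$$ for all $x\in V$, $r\in\mathbb R$, $p,q\in\mathbb R^N$, $X,Y\in\mathcal S(N)$; 5. with the same $\omega$, $$F(y,r,p,Y)-F(x,r,p,X)\le\omega\big(\alpha|x-y|^2+|x-y|(|p|+1)\big)$$ whenever $\alpha>0$, $x,y\in\overline\Omega$, $r\in\mathbb R$, $p\in\mathbb R^N$,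 and $X,Y\in\mathcal S(N)$ satisfy $$-3\alpha\begin{pmatrix}I&0\\0&I\end{pmatrix}\le\begin{pmatrix}X&0\\0&-Y\end{pmatrix}\le3\alpha\begin{pmatrix}I&-I\\-I&I\end{pmatrix};$$ 6. $f$ is continuous on $\partial\Omega\times\mathbb R$, and $r\mapsto f(x,r)$ is nondecreasing for each $x\in\partial\Omega$. If $u$ is a subsolution and $v$ a supersolution of (BVP), then $u\le v$ on $\overline\Omega$. Moreover, (BVP) has a unique solution. -/

import Mathlib

open Set Filter Topology
open scoped ENNReal

noncomputable section

namespace Viscosity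

/-- `ℝ^N` with its Euclidean norm and inner product. -/
abbrev E (N : ℕ) : Type := EuclideanSpace ℝ (Fin N)

/-- `S(N)`: the symmetric `N × N` real matrices, regarded as symmetric linear operators on `ℝ^N`.
The inherited operator norm of a symmetric matrix is the largest modulus of its eigenvalues. -/
abbrev Sym (N : ℕ) : Type := selfAdjoint (E N →L[ℝ] E N)

variable {N : ℕ}

/-- The quadratic form `⟨X ξ, ξ⟩` of a symmetric matrix. -/
def quad (X : Sym N) (ξ : E N) : ℝ := inner ℝ ((X : E N →L[ℝ] E N) ξ) ξ

/-- The usual order of symmetric matrices: `X ≤ Y` as quadratic forms. -/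
def SymLE (X Y : Sym N) : Prop := ∀ ξ : E N, quad X ξ ≤ quad Y ξ

/-- The block matrix inequalities
`-3α (I 0; 0 I) ≤ (X 0; 0 -Y) ≤ 3α (I -I; -I I)`, tested on a vector `(ξ, η)` of `ℝ^N × ℝ^N`. -/
def BlockBound (α : ℝ) (X Y : Sym N) : Prop :=
  ∀ ξ η : E N,
    -(3 * α) * (‖ξ‖ ^ 2 + ‖η‖ ^ 2) ≤ quad X ξ - quad Y η ∧
    quad X ξ - quad Y η ≤ 3 * α * ‖ξ - η‖ ^ 2

/-- The second-order superjet `J^{2,+}_O u(x)` relative to the set `O`: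
`u(y) ≤ u(x) + ⟨p, y - x⟩ + ½ ⟨X(y - x), y - x⟩ + o(|y - x|²)` as `O ∋ y → x`. -/
def superjet (O : Set (E N)) (u : E N → ℝ) (x : E N) : Set (E N × Sym N) :=
  {q | ∀ ε : ℝ, 0 < ε → ∀ᶠ y in 𝓝[O] x,
    u y ≤ u x + inner ℝ q.1 (y - x) + (1 / 2) * quad q.2 (y - x) + ε * ‖y - x‖ ^ 2}

/-- The second-order subjet `J^{2,-}_O u(x)` relative to the set `O`. -/
def subjet (O : Set (E N)) (u : E N → ℝ) (x : E N) : Set (E N × Sym N) :=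
  {q | ∀ ε : ℝ, 0 < ε → ∀ᶠ y in 𝓝[O] x,
    u x + inner ℝ q.1 (y - x) + (1 / 2) * quad q.2 (y - x) - ε * ‖y - x‖ ^ 2 ≤ u y}

/-- The closure of a jet-valued mapping `J` over `O`: limits of `(p_n, X_n) ∈ J(x_n)` along
sequences `x_n ∈ O` with `x_n → x` and `u(x_n) → u(x)`. -/
def jetClosure (O : Set (E N)) (u : E N → ℝ) (J : E N → Set (E N × Sym N)) (x : E N) :
    Set (E N × Sym N) :=
  {q | ∃ (z : ℕ → E N) (j : ℕ → E N × Sym N),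
    (∀ k, z k ∈ O ∧ j k ∈ J (z k)) ∧
    Tendsto z atTop (𝓝 x) ∧ Tendsto (fun k => u (z k)) atTop (𝓝 (u x)) ∧
    Tendsto j atTop (𝓝 q)}

/-- The closed superjet. -/
def closedSuperjet (O : Set (E N)) (u : E N → ℝ) (x : E N) : Set (E N × Sym N) :=
  jetClosure O u (superjet O u) x

/-- The closed subjet. -/
def closedSubjet (O : Set (E N)) (u : E N → ℝ) (x : E N) : Set (E N × Sym N) :=
  jetClosure O u (subjet O u) x

/-- `F(x, r, p, X)` is proper for `x ∈ O`: degenerate elliptic in `X` and nondecreasing in `r`. -/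
def IsProper (O : Set (E N)) (F : E N → ℝ → E N → Sym N → ℝ) : Prop :=
  ∀ x ∈ O, ∀ (r s : ℝ) (p : E N) (X Y : Sym N), r ≤ s → SymLE Y X → F x r p X ≤ F x s p Y

/-- Viscosity subsolutions of `F = 0` in `Ω`, `B = 0` on `∂Ω`, the boundary condition being
understood in the generalized sense. Only the values of `u` on the closure of `Ω` matter. -/
def IsSubsolution (Ω : Set (E N)) (F B : E N → ℝ → E N → Sym N → ℝ) (u : E N → ℝ) : Prop :=
  UpperSemicontinuousOn u (closure Ω) ∧
  (∀ x ∈ Ω, ∀ q ∈ closedSuperjet (closure Ω) u x, F x (u x) q.1 q.2 ≤ 0) ∧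
  (∀ x ∈ frontier Ω, ∀ q ∈ closedSuperjet (closure Ω) u x,
    min (F x (u x) q.1 q.2) (B x (u x) q.1 q.2) ≤ 0)

/-- Viscosity supersolutions of `F = 0` in `Ω`, `B = 0` on `∂Ω` (generalized sense). -/
def IsSupersolution (Ω : Set (E N)) (F B : E N → ℝ → E N → Sym N → ℝ) (v : E N → ℝ) : Prop :=
  LowerSemicontinuousOn v (closure Ω) ∧
  (∀ x ∈ Ω, ∀ q ∈ closedSubjet (closure Ω) v x, 0 ≤ F x (v x) q.1 q.2) ∧
  (∀ x ∈ frontier Ω, ∀ q ∈ closedSubjet (closure Ω) v x,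
    0 ≤ max (F x (v x) q.1 q.2) (B x (v x) q.1 q.2))

/-- Viscosity solutions (generalized sense); they are continuous on the closure of `Ω`. -/
def IsSolution (Ω : Set (E N)) (F B : E N → ℝ → E N → Sym N → ℝ) (w : E N → ℝ) : Prop :=
  IsSubsolution Ω F B w ∧ IsSupersolution Ω F B w

/-- Near `x`, the set `Ω` is `{ψ < 0}` with `ψ` of class `C¹` and `Dψ(x) ≠ 0`. -/
def IsC1DefiningFunctionAt (Ω : Set (E N)) (x : E N) (ψ : E N → ℝ) : Prop :=
  ContDiffAt ℝ 1 ψ x ∧ gradient ψ x ≠ 0 ∧ ∀ᶠ y in 𝓝 x, (y ∈ Ω ↔ ψ y < 0)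

/-- The closure of the open set `Ω` is a compact `C¹` `N`-submanifold of `ℝ^N` with boundary,
whose manifold boundary is the topological boundary of `Ω`. -/
def IsCompactC1Domain (Ω : Set (E N)) : Prop :=
  IsOpen Ω ∧ IsCompact (closure Ω) ∧
  ∀ x ∈ frontier Ω, ∃ ψ : E N → ℝ, IsC1DefiningFunctionAt Ω x ψ

/-- `ν` is the outward unit normal of `Ω` at `x`. -/
def IsOutwardUnitNormal (Ω : Set (E N)) (x ν : E N) : Prop :=
  ∃ ψ : E N → ℝ, IsC1DefiningFunctionAt Ω x ψ ∧ ν = (‖gradient ψ x‖)⁻¹ • gradient ψ x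

/-- The outward unit normal `n(x)` of `Ω` at `x` (with a dummy value where there is none). -/
def outwardNormal (Ω : Set (E N)) (x : E N) : E N :=
  Classical.epsilon (IsOutwardUnitNormal Ω x)

/-- The uniform exterior sphere condition. -/
def UniformExteriorSphere (Ω : Set (E N)) : Prop :=
  ∃ ρ : ℝ, 0 < ρ ∧ ∀ x ∈ frontier Ω,
    Metric.closedBall (x + ρ • outwardNormal Ω x) ρ ∩ Ω = ∅

/-- The Neumann-type boundary operator `B(x, r, p) = ⟨n(x), p⟩ + f(x, r)`. -/
def neumannB (Ω : Set (E N)) (f : E N → ℝ → ℝ) : E N → ℝ → E N → Sym N → ℝ :=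
  fun x r p _ => inner ℝ (outwardNormal Ω x) p + f x r

end Viscosity

end

namespace Viscosity

variable {N : ℕ}

/-! ### Quadratic forms -/

/-! Comparison rests on doubling the variables. If `u - v` has a positive maximum, maximize `u(x) -
v(y) - (α/2)|x - y|²` and let `α → ∞`: the maximizers tend to a maximum point `z` of `u - v`, and
`α|x - y|² → 0`. The theorem on sums (`theorem_on_sums`) gives jets with a common slope `α(x - y)`
and matrices `X`, `Y` obeying the block inequality. The structure condition makes `F(y, r, p, Y) -
F(x, r, p, X)` at most a small error, and strict monotonicity in `r` is then contradicted, provided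
the viscosity inequalities hold for `F` and not merely for `B`.

Three devices rule out `B`. Subtracting `δφ + C/2` from `u`, with `φ` smooth and `∂φ/∂n ≥ 1`, makes
the boundary inequality strict, while `γ` pays for the change in `F` (`exists_strict`). If `z` lies
on the boundary, the tilt `⟨g, x - y⟩` with `g = f(z, u(z)) n(z)` makes the limiting slope
compatible with `B`, and a quartic term isolates `z`. The exterior sphere bounds the unfavourable
part of the normal component of `α(x - y)` by `α|x - y|²/(2ρ)`, which vanishes
(`inner_normal_sub_le`).

The theorem on sums is obtained by Lasry–Lions regularization. The regularized functions have
Lipschitz gradients, so Rademacher's theorem, together with the fact that Lipschitz maps preserve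
null sets, yields second-order expansions of both functions near the maximum
(`exists_local_max_of_lipschitz_gradient`). Where the Hessian is not too large, these are superjets
of the original functions at shifted points (`lasryLions_contact`).

Existence is Perron's method. The upper envelope of the supremum of all subsolutions is the largest
subsolution. If its lower envelope failed to be a supersolution, a small smooth bump would produce a
larger subsolution. Comparison then identifies the two envelopes. Uniqueness is comparison applied
twice. -/

@[simp] lemma quad_add (X Y : Sym N) (ξ : E N) : quad (X + Y) ξ = quad X ξ + quad Y ξ := by
  simp [quad, inner_add_left]

@[simp] lemma quad_neg (X : Sym N) (ξ : E N) : quad (-X) ξ = -quad X ξ := by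
  simp [quad]

@[simp] lemma quad_sub (X Y : Sym N) (ξ : E N) : quad (X - Y) ξ = quad X ξ - quad Y ξ := by
  simp [quad, inner_sub_left]

@[simp] lemma quad_zero (ξ : E N) : quad (0 : Sym N) ξ = 0 := by simp [quad]

@[simp] lemma quad_smul (c : ℝ) (X : Sym N) (ξ : E N) : quad (c • X) ξ = c * quad X ξ := by
  simp [quad, inner_smul_left]

@[simp] lemma quad_one (ξ : E N) : quad (1 : Sym N) ξ = ‖ξ‖ ^ 2 := by
  simp [quad]

@[simp] lemma quad_vec_zero (X : Sym N) : quad X 0 = 0 := by simp [quad]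

lemma quad_vec_neg (X : Sym N) (ξ : E N) : quad X (-ξ) = quad X ξ := by simp [quad]

lemma quad_vec_smul (X : Sym N) (c : ℝ) (ξ : E N) : quad X (c • ξ) = c ^ 2 * quad X ξ := by
  simp only [quad, map_smul, inner_smul_left, inner_smul_right]; simp; ring

lemma inner_symm_op (X : Sym N) (v w : E N) :
    inner ℝ ((X : E N →L[ℝ] E N) v) w = inner ℝ v ((X : E N →L[ℝ] E N) w) :=
  (ContinuousLinearMap.isSelfAdjoint_iff_isSymmetric.1 X.2) v w

lemma quad_vec_add (X : Sym N) (v w : E N) :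
    quad X (v + w) = quad X v + 2 * inner ℝ ((X : E N →L[ℝ] E N) v) w + quad X w := by
  have := inner_symm_op X w v
  simp only [quad, map_add, inner_add_left, inner_add_right]
  rw [this, real_inner_comm w]; ring

lemma continuous_quad : Continuous (fun z : Sym N × E N => quad z.1 z.2) := by
  unfold quad
  fun_prop

/-- A symmetric operator whose quadratic form is bounded has bounded norm. -/
lemma norm_le_of_quad {X : Sym N} {C : ℝ} (hC : 0 ≤ C) (h : ∀ ξ, |quad X ξ| ≤ C * ‖ξ‖ ^ 2) :
    ‖X‖ ≤ 2 * C := by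
  refine ContinuousLinearMap.opNorm_le_bound (X : E N →L[ℝ] E N) (by positivity) fun v => ?_
  set w : E N := (X : E N →L[ℝ] E N) v with hw
  rcases eq_or_ne w 0 with h0 | h0
  · rw [h0]; simp; positivity
  have hv : v ≠ 0 := by rintro rfl; simp [hw] at h0
  have hvn : 0 < ‖v‖ := norm_pos_iff.2 hv
  have hwn : 0 < ‖w‖ := norm_pos_iff.2 h0
  -- Polarization with `v ± t • w`; this `t` gives `t • w` the length of `v`, so the cross term is
  -- `‖v‖ * ‖w‖`.
  set t : ℝ := ‖v‖ / ‖w‖ with ht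
  have e1 := quad_vec_add X v (t • w)
  have e2 := quad_vec_add X v (-(t • w))
  rw [quad_vec_neg, inner_neg_right] at e2
  rw [inner_smul_right, ← hw, real_inner_self_eq_norm_sq] at e1 e2
  have a1 := (abs_le.1 (h (v + t • w))).2
  have a2 := (abs_le.1 (h (v + -(t • w)))).1
  have par := parallelogram_law_with_norm ℝ v (t • w)
  have hn : ‖t • w‖ = ‖v‖ := by
    rw [norm_smul, Real.norm_of_nonneg (by positivity), ht]; field_simp
  rw [hn] at par
  have hs : v + -(t • w) = v - t • w := by abel
  rw [hs] at a2 e2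
  have : t * ‖w‖ ^ 2 = ‖v‖ * ‖w‖ := by rw [ht]; field_simp
  have key : 4 * (‖v‖ * ‖w‖) ≤ 4 * C * ‖v‖ ^ 2 := by
    nlinarith
  have : ‖w‖ ≤ C * ‖v‖ := by
    have : ‖v‖ * ‖w‖ ≤ ‖v‖ * (C * ‖v‖) := by nlinarith
    exact le_of_mul_le_mul_left this hvn
  nlinarith

/-! ### Semijets -/

lemma superjet_add {O : Set (E N)} {u θ : E N → ℝ} {x : E N} {a b : E N × Sym N}
    (ha : a ∈ superjet O u x) (hb : b ∈ superjet O θ x) :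
    a + b ∈ superjet O (fun y => u y + θ y) x := by
  intro ε hε
  filter_upwards [ha (ε / 2) (by positivity), hb (ε / 2) (by positivity)] with y h1 h2
  simp only [Prod.fst_add, Prod.snd_add, inner_add_left, quad_add]
  linarith

lemma superjet_of_eventually_le {O : Set (E N)} {u w : E N → ℝ} {x : E N} {a : E N × Sym N}
    (ha : a ∈ superjet O w x) (h : ∀ᶠ y in 𝓝[O] x, u y ≤ w y) (hx : u x = w x) :
    a ∈ superjet O u x := by
  intro ε hε
  filter_upwards [ha ε hε, h] with y h1 h2
  rw [hx]; linarith

lemma superjet_mono {O O' : Set (E N)} {u : E N → ℝ} {x : E N} (h : O ⊆ O') :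
    superjet O' u x ⊆ superjet O u x :=
  fun _ ha ε hε => (ha ε hε).filter_mono (nhdsWithin_mono x h)

lemma mem_subjet_iff {O : Set (E N)} {v : E N → ℝ} {x : E N} {a : E N × Sym N} :
    a ∈ subjet O v x ↔ -a ∈ superjet O (fun y => -v y) x := by
  simp only [subjet, superjet, mem_ofPred_eq]
  refine forall_congr' fun ε => imp_congr_right fun _ => eventually_congr (.of_forall fun y => ?_)
  simp only [Prod.fst_neg, Prod.snd_neg, inner_neg_left, quad_neg]
  constructor <;> intro h <;> linarith

lemma mem_closedSubjet_iff {O : Set (E N)} {v : E N → ℝ} {x : E N} {a : E N × Sym N} :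
    a ∈ closedSubjet O v x ↔ -a ∈ closedSuperjet O (fun y => -v y) x := by
  constructor
  · rintro ⟨z, j, h1, h2, h3, h4⟩
    exact ⟨z, fun k => -j k, fun k => ⟨(h1 k).1, mem_subjet_iff.1 (h1 k).2⟩, h2, h3.neg, h4.neg⟩
  · rintro ⟨z, j, h1, h2, h3, h4⟩
    refine ⟨z, fun k => -j k, fun k => ⟨(h1 k).1, mem_subjet_iff.2 (by simpa using (h1 k).2)⟩, h2,
      by simpa using h3.neg, by simpa using h4.neg⟩

lemma superjet_subset_closedSuperjet {O : Set (E N)} {u : E N → ℝ} {x : E N} (hx : x ∈ O) :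
    superjet O u x ⊆ closedSuperjet O u x := fun a ha =>
  ⟨fun _ => x, fun _ => a, fun _ => ⟨hx, ha⟩, tendsto_const_nhds, tendsto_const_nhds,
    tendsto_const_nhds⟩

/-- Adding a function with continuous second-order upper expansions shifts closed superjets. -/
lemma closedSuperjet_add {O : Set (E N)} {u θ : E N → ℝ} {J : E N → E N × Sym N} {x : E N}
    {a : E N × Sym N} (ha : a ∈ closedSuperjet O u x) (hJ : ∀ y ∈ O, J y ∈ superjet O θ y)
    (hθ : ContinuousAt θ x) (hJc : ContinuousAt J x) :
    a + J x ∈ closedSuperjet O (fun y => u y + θ y) x := by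
  obtain ⟨z, j, h1, h2, h3, h4⟩ := ha
  exact ⟨z, fun k => j k + J (z k), fun k => ⟨(h1 k).1, superjet_add (h1 k).2 (hJ _ (h1 k).1)⟩, h2,
    h3.add (hθ.tendsto.comp h2), h4.add (hJc.tendsto.comp h2)⟩

/-! ### Second-order expansions -/

/-- `f` has second-order expansion `(p, X)` at `x`. -/
def HasExpansionAt (f : E N → ℝ) (a : E N × Sym N) (x : E N) : Prop :=
  ∀ ε : ℝ, 0 < ε → ∀ᶠ y in 𝓝 x,
    |f y - f x - inner ℝ a.1 (y - x) - (1 / 2) * quad a.2 (y - x)| ≤ ε * ‖y - x‖ ^ 2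

lemma HasExpansionAt.mem_superjet {f : E N → ℝ} {a : E N × Sym N} {x : E N}
    (h : HasExpansionAt f a x) (O : Set (E N)) : a ∈ superjet O f x := by
  intro ε hε
  filter_upwards [mem_nhdsWithin_of_mem_nhds (h ε hε)] with y hy
  have := (abs_le.1 hy).2
  linarith

lemma HasExpansionAt.add {f g : E N → ℝ} {a b : E N × Sym N} {x : E N}
    (hf : HasExpansionAt f a x) (hg : HasExpansionAt g b x) :
    HasExpansionAt (fun y => f y + g y) (a + b) x := by
  intro ε hε
  filter_upwards [hf (ε / 2) (by positivity), hg (ε / 2) (by positivity)] with y h1 h2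
  simp only [Prod.fst_add, Prod.snd_add, inner_add_left, quad_add]
  rw [abs_le] at *
  constructor <;> linarith [h1.1, h1.2, h2.1, h2.2]

lemma HasExpansionAt.neg {f : E N → ℝ} {a : E N × Sym N} {x : E N}
    (hf : HasExpansionAt f a x) : HasExpansionAt (fun y => -f y) (-a) x := by
  intro ε hε
  filter_upwards [hf ε hε] with y h1
  simp only [Prod.fst_neg, Prod.snd_neg, inner_neg_left, quad_neg]
  rw [abs_le] at *
  constructor <;> linarith [h1.1, h1.2]

lemma HasExpansionAt.const_smul {f : E N → ℝ} {a : E N × Sym N} {x : E N}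
    (hf : HasExpansionAt f a x) (c : ℝ) : HasExpansionAt (fun y => c * f y) (c • a) x := by
  intro ε hε
  filter_upwards [hf (ε / (|c| + 1)) (by positivity)] with y h1
  simp only [Prod.smul_fst, Prod.smul_snd, inner_smul_left, quad_smul]
  have : c * f y - c * f x - (starRingEnd ℝ) c * inner ℝ a.1 (y - x) - 1 / 2 * (c * quad a.2 (y - x))
      = c * (f y - f x - inner ℝ a.1 (y - x) - 1 / 2 * quad a.2 (y - x)) := by
    simp; ring
  rw [this, abs_mul]
  calc |c| * _ ≤ |c| * (ε / (|c| + 1) * ‖y - x‖ ^ 2) := by gcongr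
    _ ≤ (|c| + 1) * (ε / (|c| + 1) * ‖y - x‖ ^ 2) := by gcongr; linarith
    _ = _ := by field_simp

lemma hasExpansionAt_const (c : ℝ) (x : E N) : HasExpansionAt (fun _ => c) 0 x := by
  intro ε hε
  filter_upwards with y
  simp; positivity

lemma hasExpansionAt_inner (g : E N) (x : E N) :
    HasExpansionAt (fun y => inner ℝ g y) (g, 0) x := by
  intro ε hε
  filter_upwards with y
  simp only [inner_sub_right, quad_zero]
  simp; positivity

lemma hasExpansionAt_quad (p : E N) (X : Sym N) (x₀ x : E N) :
    HasExpansionAt (fun y => inner ℝ p (y - x₀) + (1 / 2) * quad X (y - x₀))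
      (p + (X : E N →L[ℝ] E N) (x - x₀), X) x := by
  intro ε hε
  filter_upwards with y
  have : y - x₀ = (x - x₀) + (y - x) := by abel
  rw [this, quad_vec_add, inner_add_left, inner_add_right]
  ring_nf
  simp; positivity

/-- The derivative of a gradient is symmetric. -/
lemma isSelfAdjoint_of_hasFDerivAt_gradient {f : E N → ℝ} {P : E N → E N}
    {X : E N →L[ℝ] E N} {x : E N} (hP : ∀ᶠ y in 𝓝 x, HasGradientAt f (P y) y)
    (hX : HasFDerivAt P X x) : IsSelfAdjoint X := by
  rw [ContinuousLinearMap.isSelfAdjoint_iff_isSymmetric]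
  intro v w
  have h1 : ∀ᶠ y in 𝓝 x, HasFDerivAt f (innerSL ℝ (P y)) y := by
    filter_upwards [hP] with y hy
    exact hy.hasFDerivAt
  have h2 : HasFDerivAt (fun y => innerSL ℝ (P y)) ((innerSL ℝ).comp X) x :=
    (innerSL ℝ (E := E N)).hasFDerivAt.comp x hX
  have := second_derivative_symmetric_of_eventually h1 h2 v w
  simpa [real_inner_comm] using this

/-- Second-order Taylor expansion at a point where the gradient is differentiable. -/
lemma hasExpansionAt_of_hasFDerivAt_gradient {f : E N → ℝ} {P : E N → E N}
    {X : Sym N} {x : E N} (hP : ∀ᶠ y in 𝓝 x, HasGradientAt f (P y) y)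
    (hX : HasFDerivAt P (X : E N →L[ℝ] E N) x) : HasExpansionAt f (P x, X) x := by
  intro ε hε
  have h1 := hX.isLittleO.def hε
  obtain ⟨r, hr, hball⟩ := Metric.eventually_nhds_iff_ball.1 (h1.and hP)
  filter_upwards [Metric.ball_mem_nhds x hr] with y hy
  -- The remainder `e` has gradient `P z - P x - X (z - x)`, of norm at most `ε ‖y - x‖` on the ball
  -- of radius `‖y - x‖`; the mean value inequality concludes. Differentiability of `P` is needed
  -- only at `x`.
  set e : E N → ℝ := fun y => f y - f x - (inner ℝ (P x) (y - x) + (1 / 2) * quad X (y - x)) with he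
  have hq : ∀ z, HasFDerivAt (fun y => inner ℝ (P x) (y - x) + (1 / 2) * quad X (y - x))
      (innerSL ℝ (P x + (X : E N →L[ℝ] E N) (z - x))) z := by
    intro z
    have d0 : HasFDerivAt (fun y : E N => y - x) (ContinuousLinearMap.id ℝ (E N)) z :=
      (hasFDerivAt_id z).sub_const x
    have d1 : HasFDerivAt (fun y : E N => (X : E N →L[ℝ] E N) (y - x)) (X : E N →L[ℝ] E N) z := by
      exact (X : E N →L[ℝ] E N).hasFDerivAt.comp z d0
    have d2 := (innerSL ℝ (P x)).hasFDerivAt.comp z d0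
    have d3 := (d1.inner ℝ d0).const_mul (1 / 2)
    refine (d2.add d3).congr_fderiv ?_
    ext w
    simp only [innerSL_apply_apply, inner_add_left]
    simp only [one_div, ContinuousLinearMap.comp_id, add_apply, innerSL_apply_apply, smul_apply,
      ContinuousLinearMap.coe_comp, Function.comp_apply, ContinuousLinearMap.prod_apply,
      ContinuousLinearMap.coe_id', id_eq, fderivInnerCLM_apply, smul_eq_mul]
    rw [inner_symm_op X w, real_inner_comm w ((X : E N →L[ℝ] E N) (z - x))]
    ring
  have hd : ∀ z ∈ Metric.closedBall x ‖y - x‖, HasFDerivWithinAt e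
      (innerSL ℝ (P z) - innerSL ℝ (P x + (X : E N →L[ℝ] E N) (z - x)))
      (Metric.closedBall x ‖y - x‖) z := by
    intro z hz
    have hz' : z ∈ Metric.ball x r := by
      rw [Metric.mem_closedBall] at hz
      rw [Metric.mem_ball, dist_eq_norm] at hy
      exact lt_of_le_of_lt hz hy
    have hf : HasFDerivAt f (innerSL ℝ (P z)) z := (hball z hz').2.hasFDerivAt
    exact ((hf.sub_const (f x)).sub (hq z)).hasFDerivWithinAt
  have hb : ∀ z ∈ Metric.closedBall x ‖y - x‖,
      ‖innerSL ℝ (P z) - innerSL ℝ (P x + (X : E N →L[ℝ] E N) (z - x))‖ ≤ ε * ‖y - x‖ := by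
    intro z hz
    have hz' : z ∈ Metric.ball x r := by
      rw [Metric.mem_closedBall] at hz
      rw [Metric.mem_ball, dist_eq_norm] at hy
      exact lt_of_le_of_lt hz hy
    rw [← map_sub, innerSL_apply_norm]
    have := (hball z hz').1
    rw [Metric.mem_closedBall, dist_eq_norm] at hz
    calc ‖P z - (P x + (X : E N →L[ℝ] E N) (z - x))‖ = ‖P z - P x - (X : E N →L[ℝ] E N) (z - x)‖ := by
          rw [sub_sub]
      _ ≤ ε * ‖z - x‖ := this
      _ ≤ _ := by gcongr
  have := (convex_closedBall x ‖y - x‖).norm_image_sub_le_of_norm_hasFDerivWithin_le hd hb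
    (Metric.mem_closedBall_self (norm_nonneg _)) (by rw [Metric.mem_closedBall, dist_eq_norm])
  have hex : e x = 0 := by simp [he]
  rw [hex, sub_zero, Real.norm_eq_abs] at this
  calc _ = |e y| := by rw [he]; ring_nf
    _ ≤ _ := this
    _ = _ := by ring

end Viscosity

namespace Viscosity

variable {N : ℕ}

/-! ### Sup- and inf-convolutions -/

lemma exists_max_sub_sq {w : E N → ℝ} (hw : UpperSemicontinuous w) {K : ℝ} (hK : ∀ x, |w x| ≤ K)
    {c : ℝ} (hc : 0 < c) (y : E N) :
    ∃ x₀, ∀ x, w x - c * ‖x - y‖ ^ 2 ≤ w x₀ - c * ‖x₀ - y‖ ^ 2 := by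
  have hK0 : 0 ≤ K := (abs_nonneg _).trans (hK 0)
  -- Outside this ball the penalty is at least `c * R ≥ 2 * K + 1`, more than the oscillation of
  -- `w`; `R ≥ 1` gives `R ≤ R ^ 2`.
  set R : ℝ := (2 * K + 1) / c + 1 with hR
  have hR1 : 1 ≤ R := by rw [hR]; have : 0 ≤ (2 * K + 1) / c := by positivity
                         linarith
  have hcont : Continuous fun x : E N => -(c * ‖x - y‖ ^ 2) := by fun_prop
  have husc : UpperSemicontinuous fun x => w x + -(c * ‖x - y‖ ^ 2) :=
    hw.add hcont.upperSemicontinuous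
  obtain ⟨x₀, -, hx₀⟩ := UpperSemicontinuousOn.exists_isMaxOn
    (s := Metric.closedBall y R) ⟨y, Metric.mem_closedBall_self (by linarith)⟩
    (isCompact_closedBall y R) (husc.upperSemicontinuousOn _)
  refine ⟨x₀, fun x => ?_⟩
  by_cases hx : x ∈ Metric.closedBall y R
  · have := hx₀ hx
    simp only [mem_ofPred_eq] at this
    linarith
  · have h1 := hx₀ (Metric.mem_closedBall_self (x := y) (by linarith : 0 ≤ R))
    simp only [mem_ofPred_eq, sub_self, norm_zero] at h1
    rw [Metric.mem_closedBall, dist_eq_norm, not_le] at hx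
    have h2 : R ≤ ‖x - y‖ ^ 2 := by nlinarith
    have h3 : 2 * K + 1 ≤ c * R := by
      rw [hR, mul_add, mul_div_cancel₀ _ hc.ne']; linarith
    have h4 : c * R ≤ c * ‖x - y‖ ^ 2 := by gcongr
    have h5 := (abs_le.1 (hK x)).2
    have h6 := (abs_le.1 (hK y)).1
    nlinarith

/-- The sup-convolution `sup_x (w x - c |x - y|²)`. -/
noncomputable def supConv (c : ℝ) (w : E N → ℝ) (y : E N) : ℝ := ⨆ x, (w x - c * ‖x - y‖ ^ 2)

/-- The inf-convolution `inf_x (w x + c |x - y|²)`. -/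
noncomputable def infConv (c : ℝ) (w : E N → ℝ) (y : E N) : ℝ := -supConv c (fun x => -w x) y

section

variable {w : E N → ℝ} {K c : ℝ}

lemma bddAbove_supConv (hK : ∀ x, |w x| ≤ K) (hc : 0 ≤ c) (y : E N) :
    BddAbove (range fun x => w x - c * ‖x - y‖ ^ 2) := by
  refine ⟨K, ?_⟩
  rintro _ ⟨x, rfl⟩
  have := (abs_le.1 (hK x)).2
  have : 0 ≤ c * ‖x - y‖ ^ 2 := by positivity
  simp only
  linarith

lemma le_supConv (hK : ∀ x, |w x| ≤ K) (hc : 0 ≤ c) (x y : E N) :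
    w x - c * ‖x - y‖ ^ 2 ≤ supConv c w y :=
  le_ciSup (bddAbove_supConv hK hc y) x

lemma exists_supConv_eq (hw : UpperSemicontinuous w) (hK : ∀ x, |w x| ≤ K) (hc : 0 < c) (y : E N) :
    ∃ x, supConv c w y = w x - c * ‖x - y‖ ^ 2 := by
  obtain ⟨x₀, h⟩ := exists_max_sub_sq hw hK hc y
  exact ⟨x₀, le_antisymm (ciSup_le h) (le_supConv hK hc.le x₀ y)⟩

lemma abs_supConv_le (hK : ∀ x, |w x| ≤ K) (hc : 0 ≤ c) (y : E N) : |supConv c w y| ≤ K := by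
  rw [abs_le]
  constructor
  · have h1 := le_supConv hK hc y y
    have h2 := (abs_le.1 (hK y)).1
    simp at h1
    linarith
  · refine ciSup_le fun x => ?_
    have := (abs_le.1 (hK x)).2
    have : 0 ≤ c * ‖x - y‖ ^ 2 := by positivity
    linarith

lemma lowerSemicontinuous_supConv (hK : ∀ x, |w x| ≤ K) (hc : 0 ≤ c) :
    LowerSemicontinuous (supConv c w) := by
  refine lowerSemicontinuous_ciSup (fun y => bddAbove_supConv hK hc y) fun x => ?_
  exact Continuous.lowerSemicontinuous (by fun_prop)

lemma infConv_le (hK : ∀ x, |w x| ≤ K) (hc : 0 ≤ c) (x y : E N) :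
    infConv c w y ≤ w x + c * ‖x - y‖ ^ 2 := by
  have := le_supConv (w := fun x => -w x) (by simpa using hK) hc x y
  unfold infConv
  linarith

lemma exists_infConv_eq (hw : LowerSemicontinuous w) (hK : ∀ x, |w x| ≤ K) (hc : 0 < c) (y : E N) :
    ∃ x, infConv c w y = w x + c * ‖x - y‖ ^ 2 := by
  have hu : UpperSemicontinuous fun x => -w x :=
    continuous_neg.comp_lowerSemicontinuous_antitone hw fun _ _ h => neg_le_neg h
  obtain ⟨x, hx⟩ := exists_supConv_eq (w := fun x => -w x) hu (by simpa using hK) hc y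
  exact ⟨x, by unfold infConv; rw [hx]; ring⟩

end

/-! ### A `C^{1,1}` regularization from above -/

/-- The Lasry–Lions regularization of `u`, with parameter `α`. -/
noncomputable def lasryLions (α : ℝ) (u : E N → ℝ) : E N → ℝ := infConv (6 * α) (supConv (2 * α) u)

section

variable {u : E N → ℝ} {K α : ℝ}

lemma lasryLions_le (hK : ∀ x, |u x| ≤ K) (hα : 0 < α) (x y : E N) :
    lasryLions α u x ≤ supConv (2 * α) u y + 6 * α * ‖y - x‖ ^ 2 :=
  infConv_le (abs_supConv_le hK (by positivity)) (by positivity) y x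

lemma exists_lasryLions_eq (hK : ∀ x, |u x| ≤ K) (hα : 0 < α) (x : E N) :
    ∃ y, lasryLions α u x = supConv (2 * α) u y + 6 * α * ‖y - x‖ ^ 2 :=
  exists_infConv_eq (lowerSemicontinuous_supConv hK (by positivity))
    (abs_supConv_le hK (by positivity)) (by positivity) x

/-- Inverse parameters add under sup-convolution. As `1/2 = 1/3 + 1/6`, the parameter `2α` amounts
to `3α` followed by `6α`, and the inf-convolution with `6α` undoes the latter up to an inequality.
-/
lemma sub_sq_le_lasryLions (hK : ∀ x, |u x| ≤ K) (hα : 0 < α) (x ξ : E N) :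
    u x - 3 * α * ‖x - ξ‖ ^ 2 ≤ lasryLions α u ξ := by
  obtain ⟨y, hy⟩ := exists_lasryLions_eq hK hα ξ
  have h := le_supConv hK (by positivity : 0 ≤ 2 * α) x y
  rw [hy]
  have e : x - y = (x - ξ) - (y - ξ) := by abel
  rw [e, norm_sub_sq_real] at h
  have k : 0 ≤ ‖(x - ξ) + (2 : ℝ) • (y - ξ)‖ ^ 2 := by positivity
  rw [norm_add_sq_real, inner_smul_right, norm_smul, Real.norm_of_nonneg (by norm_num)] at k
  have := mul_nonneg hα.le k
  nlinarith

/-- Semiconcavity: the minimizer `y` for `x` is kept as a competitor at `x + h`. -/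
lemma exists_lasryLions_add_le (hK : ∀ x, |u x| ≤ K) (hα : 0 < α) (x : E N) :
    ∃ p, ∀ h, lasryLions α u (x + h) ≤ lasryLions α u x + inner ℝ p h + 6 * α * ‖h‖ ^ 2 := by
  obtain ⟨y, hy⟩ := exists_lasryLions_eq hK hα x
  refine ⟨-((12 * α) • (y - x)), fun h => ?_⟩
  have h1 := lasryLions_le hK hα (x + h) y
  have e : y - (x + h) = (y - x) - h := by abel
  rw [e, norm_sub_sq_real] at h1
  rw [hy, inner_neg_left, inner_smul_left]
  simp only [conj_trivial]
  nlinarith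

/-- Semiconvexity survives the inf-convolution because `6α` exceeds `2α`. With minimizers `y₁`, `y₂`
at `x ± h`, their midpoint competes at `x`, and the maximizer `z` at the midpoint competes at `y₁`
and `y₂`. -/
lemma lasryLions_second_difference (hu : UpperSemicontinuous u) (hK : ∀ x, |u x| ≤ K) (hα : 0 < α)
    (x h : E N) : -(6 * α * ‖h‖ ^ 2) ≤
      lasryLions α u (x + h) + lasryLions α u (x - h) - 2 * lasryLions α u x := by
  obtain ⟨y₁, h₁⟩ := exists_lasryLions_eq hK hα (x + h)
  obtain ⟨y₂, h₂⟩ := exists_lasryLions_eq hK hα (x - h)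
  set y₀ : E N := (1 / 2 : ℝ) • (y₁ + y₂) with hy₀
  set k : E N := (1 / 2 : ℝ) • (y₁ - y₂) with hk
  obtain ⟨z, hz⟩ := exists_supConv_eq hu hK (by positivity : 0 < 2 * α) y₀
  have e1 : y₁ = y₀ + k := by rw [hy₀, hk]; module
  have e2 : y₂ = y₀ - k := by rw [hy₀, hk]; module
  have g0 := lasryLions_le hK hα x y₀
  have g1 := le_supConv hK (by positivity : 0 ≤ 2 * α) z y₁
  have g2 := le_supConv hK (by positivity : 0 ≤ 2 * α) z y₂
  rw [h₁, h₂]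
  rw [hz] at g0
  have a1 : z - y₁ = (z - y₀) - k := by rw [e1]; abel
  have a2 : z - y₂ = (z - y₀) + k := by rw [e2]; abel
  have a3 : y₁ - (x + h) = (y₀ - x) + (k - h) := by rw [e1]; abel
  have a4 : y₂ - (x - h) = (y₀ - x) - (k - h) := by rw [e2]; abel
  rw [a1, norm_sub_sq_real] at g1
  rw [a2, norm_add_sq_real] at g2
  rw [a3, a4, norm_add_sq_real (y₀ - x), norm_sub_sq_real (y₀ - x)]
  rw [norm_sub_sq_real k h]
  -- `12|k - h|² - 4|k|² + 6|h|² = 2|3h - 2k|²`.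
  have p : 0 ≤ ‖(3 : ℝ) • h - (2 : ℝ) • k‖ ^ 2 := by positivity
  rw [norm_sub_sq_real, inner_smul_left, inner_smul_right, norm_smul, norm_smul,
    Real.norm_of_nonneg (by norm_num), Real.norm_of_nonneg (by norm_num), conj_trivial,
    real_inner_comm] at p
  have := mul_nonneg hα.le p
  nlinarith

end

/-! ### Functions with two-sided quadratic bounds -/

/-- Expanding from `x` to `y`, from `x` to `y + h` and from `y` to `y + h` bounds `⟨P y - P x, h⟩`
by `(1 + 4 + 1)|C| d²`, where `d = ‖x - y‖ = ‖h‖`. Taking `h` parallel to `P y - P x` gives the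
Lipschitz constant `6|C|`. -/
lemma exists_lipschitz_gradient {f : E N → ℝ} {C : ℝ}
    (hf : ∀ x, ∃ p, ∀ h, |f (x + h) - f x - inner ℝ p h| ≤ C * ‖h‖ ^ 2) :
    ∃ P : E N → E N, (∀ x, HasGradientAt f (P x) x) ∧ ∃ L : NNReal, LipschitzWith L P := by
  choose P hP using hf
  refine ⟨P, fun x => ?_, Real.toNNReal (6 * |C|), LipschitzWith.of_dist_le_mul fun x y => ?_⟩
  · rw [hasGradientAt_iff_isLittleO]
    have : (fun y => f y - f x - inner ℝ (P x) (y - x)) =O[𝓝 x] fun y => ‖y - x‖ ^ 2 := by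
      refine Asymptotics.IsBigO.of_bound |C| (.of_forall fun y => ?_)
      have := hP x (y - x)
      rw [add_sub_cancel] at this
      rw [Real.norm_eq_abs]
      refine this.trans ?_
      rw [Real.norm_of_nonneg (by positivity)]
      gcongr
      exact le_abs_self C
    refine this.trans_isLittleO ?_
    have h2 := Asymptotics.isLittleO_norm_pow_id (E' := E N) (n := 2) (by norm_num)
    have h3 : Tendsto (fun y : E N => y - x) (𝓝 x) (𝓝 0) := by
      have : Continuous fun y : E N => y - x := by fun_prop
      simpa using this.tendsto x
    exact h2.comp_tendsto h3
  · rw [Real.coe_toNNReal _ (by positivity), dist_eq_norm, dist_eq_norm]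
    set q := P y - P x with hq
    rcases eq_or_ne q 0 with h0 | h0
    · have : P x - P y = 0 := by rw [← neg_sub, ← hq, h0, neg_zero]
      rw [this, norm_zero]; positivity
    have hqn : 0 < ‖q‖ := norm_pos_iff.2 h0
    set d := ‖x - y‖ with hd
    set h : E N := (d / ‖q‖) • q with hh
    have hhn : ‖h‖ = d := by
      rw [hh, norm_smul, Real.norm_of_nonneg (by positivity)]; field_simp
    have i1 := hP x (y + h - x)
    have i2 := hP x (y - x)
    have i3 := hP y h
    rw [add_sub_cancel] at i1 i2
    have e : y + h - x = (y - x) + h := by abel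
    have n1 : ‖y + h - x‖ ≤ 2 * d := by
      rw [e]; refine (norm_add_le _ _).trans ?_
      rw [hhn, norm_sub_rev, ← hd]; linarith
    have n2 : ‖y - x‖ = d := by rw [norm_sub_rev]
    rw [e, inner_add_right, ← e] at i1
    rw [n2] at i2
    rw [hhn] at i3
    have n3 : C * ‖y + h - x‖ ^ 2 ≤ |C| * (2 * d) ^ 2 := by
      gcongr; exact le_abs_self C
    have n4 : C * d ^ 2 ≤ |C| * d ^ 2 := by gcongr; exact le_abs_self C
    have key : inner ℝ q h ≤ 6 * |C| * d ^ 2 := by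
      rw [hq, inner_sub_left]
      have := abs_le.1 i1; have := abs_le.1 i2; have := abs_le.1 i3
      linarith
    have : inner ℝ q h = d * ‖q‖ := by
      rw [hh, inner_smul_right, real_inner_self_eq_norm_sq]; field_simp
    rw [this] at key
    have hd0 : 0 ≤ d := norm_nonneg _
    have hPn : ‖P x - P y‖ = ‖q‖ := norm_sub_rev _ _
    rw [hPn]
    rcases hd0.eq_or_lt with h' | h'
    · exfalso
      have hxy : x = y := by rw [← sub_eq_zero, ← norm_eq_zero, ← hd, ← h']
      apply h0; rw [hq, hxy, sub_self]
    · nlinarith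

/-- The upper bound at `-h` and the second-difference bound together give the lower bound at `h`,
with constant `6α + 6α`. -/
lemma lasryLions_gradient {u : E N → ℝ} {K α : ℝ} (hu : UpperSemicontinuous u)
    (hK : ∀ x, |u x| ≤ K) (hα : 0 < α) :
    ∃ P : E N → E N, (∀ x, HasGradientAt (lasryLions α u) (P x) x) ∧
      ∃ L : NNReal, LipschitzWith L P := by
  refine exists_lipschitz_gradient (C := 12 * α) fun x => ?_
  obtain ⟨p, hp⟩ := exists_lasryLions_add_le hK hα x
  refine ⟨p, fun h => ?_⟩
  have h1 := hp h
  have h2 := hp (-h)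
  have h3 := lasryLions_second_difference hu hK hα x h
  rw [inner_neg_right, norm_neg, ← sub_eq_add_neg] at h2
  have : 0 ≤ α * ‖h‖ ^ 2 := by positivity
  rw [abs_le]
  constructor <;> linarith

end Viscosity

namespace Viscosity

variable {N : ℕ}

/-! ### Comparing sub- and superjets along a direction -/

/-- Both jets are tested along the ray `x + t • d`. Only this ray has to enter `O`, so the
comparison remains available at boundary points for inward directions. -/
lemma eventually_expansion_le {O : Set (E N)} {w : E N → ℝ} {x d : E N} {a b : E N × Sym N}
    (ha : a ∈ superjet O w x) (hb : b ∈ subjet O w x)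
    (hd : ∀ᶠ t : ℝ in 𝓝[>] 0, x + t • d ∈ O) {ε : ℝ} (hε : 0 < ε) :
    ∀ᶠ t : ℝ in 𝓝[>] 0, t * inner ℝ b.1 d + t ^ 2 * (1 / 2 * quad b.2 d) ≤
      t * inner ℝ a.1 d + t ^ 2 * (1 / 2 * quad a.2 d) + ε * t ^ 2 := by
  have hc : Continuous fun t : ℝ => x + t • d := by fun_prop
  have ht : Tendsto (fun t : ℝ => x + t • d) (𝓝[>] 0) (𝓝[O] x) := by
    refine tendsto_nhdsWithin_iff.2 ⟨?_, hd⟩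
    have := hc.tendsto 0
    simp only [zero_smul, add_zero] at this
    exact this.mono_left nhdsWithin_le_nhds
  set ε' := ε / (2 * (‖d‖ ^ 2 + 1)) with hε'
  have hε'0 : 0 < ε' := by positivity
  filter_upwards [ht.eventually (ha ε' hε'0), ht.eventually (hb ε' hε'0)] with t h1 h2
  simp only [add_sub_cancel_left, inner_smul_right, quad_vec_smul, norm_smul, mul_pow,
    Real.norm_eq_abs, sq_abs] at h1 h2
  have h3 : 2 * ε' * ‖d‖ ^ 2 ≤ ε := by
    have : 2 * ε' * (‖d‖ ^ 2 + 1) = ε := by rw [hε']; field_simp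
    nlinarith
  have h4 : t ^ 2 * (2 * ε' * ‖d‖ ^ 2) ≤ t ^ 2 * ε := by gcongr
  nlinarith

lemma inner_le_of_mem_jets {O : Set (E N)} {w : E N → ℝ} {x d : E N} {a b : E N × Sym N}
    (ha : a ∈ superjet O w x) (hb : b ∈ subjet O w x)
    (hd : ∀ᶠ t : ℝ in 𝓝[>] 0, x + t • d ∈ O) : inner ℝ b.1 d ≤ inner ℝ a.1 d := by
  have h := eventually_expansion_le ha hb hd one_pos
  set A := 1 / 2 * quad a.2 d
  set B := 1 / 2 * quad b.2 d
  have h1 : Tendsto (fun t : ℝ => inner ℝ b.1 d + t * B) (𝓝[>] 0) (𝓝 (inner ℝ b.1 d)) := by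
    have : Continuous fun t : ℝ => inner ℝ b.1 d + t * B := by fun_prop
    simpa using (this.tendsto 0).mono_left nhdsWithin_le_nhds
  have h2 : Tendsto (fun t : ℝ => inner ℝ a.1 d + t * (A + 1)) (𝓝[>] 0) (𝓝 (inner ℝ a.1 d)) := by
    have : Continuous fun t : ℝ => inner ℝ a.1 d + t * (A + 1) := by fun_prop
    simpa using (this.tendsto 0).mono_left nhdsWithin_le_nhds
  refine le_of_tendsto_of_tendsto h1 h2 ?_
  filter_upwards [h, self_mem_nhdsWithin] with t ht ht0
  rw [mem_Ioi] at ht0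
  refine le_of_mul_le_mul_left ?_ ht0
  nlinarith

lemma quad_le_of_mem_jets {O : Set (E N)} {w : E N → ℝ} {x d : E N} {a b : E N × Sym N}
    (ha : a ∈ superjet O w x) (hb : b ∈ subjet O w x)
    (hd : ∀ᶠ t : ℝ in 𝓝[>] 0, x + t • d ∈ O) (hab : inner ℝ b.1 d = inner ℝ a.1 d) :
    quad b.2 d ≤ quad a.2 d := by
  refine le_of_forall_pos_le_add fun ε hε => ?_
  obtain ⟨t, ht, ht0⟩ := ((eventually_expansion_le ha hb hd (half_pos hε)).and
    self_mem_nhdsWithin).exists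
  replace ht0 : 0 < t := ht0
  have : 0 < t ^ 2 := by positivity
  rw [hab] at ht
  refine le_of_mul_le_mul_left (a := t ^ 2) ?_ this
  nlinarith

lemma HasExpansionAt.mem_subjet {f : E N → ℝ} {a : E N × Sym N} {x : E N}
    (h : HasExpansionAt f a x) (O : Set (E N)) : a ∈ subjet O f x :=
  mem_subjet_iff.2 (h.neg.mem_superjet O)

lemma hasExpansionAt_sq (c : ℝ) (x₀ x : E N) :
    HasExpansionAt (fun y => c * ‖y - x₀‖ ^ 2) ((2 * c) • (x - x₀), (2 * c) • 1) x := by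
  have h := hasExpansionAt_quad (0 : E N) ((2 * c) • (1 : Sym N)) x₀ x
  have e1 : (fun y => inner ℝ (0 : E N) (y - x₀) + (1 / 2) * quad ((2 * c) • (1 : Sym N)) (y - x₀))
      = fun y => c * ‖y - x₀‖ ^ 2 := by
    funext y; simp; ring
  rw [e1] at h
  simpa using h

lemma eventually_add_smul_mem_univ (x d : E N) :
    ∀ᶠ t : ℝ in 𝓝[>] 0, x + t • d ∈ (univ : Set (E N)) := .of_forall fun _ => mem_univ _

lemma fst_eq_of_mem_jets {w : E N → ℝ} {x : E N} {a b : E N × Sym N}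
    (ha : a ∈ superjet univ w x) (hb : b ∈ subjet univ w x) : a.1 = b.1 := by
  refine ext_inner_right ℝ fun d => ?_
  have h1 := inner_le_of_mem_jets ha hb (eventually_add_smul_mem_univ x d)
  have h2 := inner_le_of_mem_jets ha hb (eventually_add_smul_mem_univ x (-d))
  simp only [inner_neg_right] at h2
  linarith

lemma HasExpansionAt.tendsto_second_difference {f : E N → ℝ} {a : E N × Sym N} {x : E N}
    (h : HasExpansionAt f a x) (d : E N) :
    Tendsto (fun t : ℝ => (f (x + t • d) + f (x - t • d) - 2 * f x) / t ^ 2) (𝓝[>] 0)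
      (𝓝 (quad a.2 d)) := by
  have hc : Tendsto (fun t : ℝ => x + t • d) (𝓝[>] 0) (𝓝 x) := by
    have : Continuous fun t : ℝ => x + t • d := by fun_prop
    simpa using (this.tendsto 0).mono_left nhdsWithin_le_nhds
  have hc' : Tendsto (fun t : ℝ => x - t • d) (𝓝[>] 0) (𝓝 x) := by
    have : Continuous fun t : ℝ => x - t • d := by fun_prop
    simpa using (this.tendsto 0).mono_left nhdsWithin_le_nhds
  rw [Metric.tendsto_nhds]
  intro ε hε
  set ε' := ε / (4 * (‖d‖ ^ 2 + 1)) with hε'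
  have hε'0 : 0 < ε' := by positivity
  filter_upwards [hc.eventually (h ε' hε'0), hc'.eventually (h ε' hε'0), self_mem_nhdsWithin]
    with t h1 h2 ht
  rw [mem_Ioi] at ht
  have e : x - t • d - x = -(t • d) := by abel
  rw [e, inner_neg_right, quad_vec_neg, norm_neg] at h2
  simp only [add_sub_cancel_left, inner_smul_right, quad_vec_smul, norm_smul, mul_pow,
    Real.norm_eq_abs, sq_abs] at h1 h2
  rw [Real.dist_eq, div_sub' (by positivity), abs_div, abs_of_pos (by positivity : 0 < t ^ 2),
    div_lt_iff₀ (by positivity)]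
  have h3 : 4 * ε' * (‖d‖ ^ 2 + 1) = ε := by rw [hε']; field_simp
  have h4 : 2 * (ε' * (t ^ 2 * ‖d‖ ^ 2)) < ε * t ^ 2 := by
    rw [← h3]
    have : 0 < ε' * t ^ 2 := by positivity
    nlinarith [mul_nonneg this.le (sq_nonneg ‖d‖)]
  rw [abs_le] at h1 h2
  rw [abs_lt]
  constructor <;> linarith [h1.1, h1.2, h2.1, h2.2]

/-! ### Jets of the regularization come from jets of the function -/

/-- With `y` minimizing at `ξ` and `x` maximizing at `y`, the regularization lies below a paraboloid
centred at `y` with Hessian `12α` and above one centred at `x` with Hessian `-6α`. These touch at `ξ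
+ h`, and the upper one is attained on the whole segment from `ξ` to `ξ + h`. A Hessian below `12α`
therefore forces `h = 0`, so the lower paraboloid also touches at `ξ`. -/
lemma lasryLions_contact {u : E N → ℝ} {K α c : ℝ} (hu : UpperSemicontinuous u)
    (hK : ∀ x, |u x| ≤ K) (hα : 0 < α) {ξ : E N} {a : E N × Sym N}
    (ha : HasExpansionAt (lasryLions α u) a ξ) (hc : c < 12 * α)
    (hX : ∀ h, quad a.2 h ≤ c * ‖h‖ ^ 2) :
    ∃ x, a.1 = (6 * α) • (x - ξ) ∧ lasryLions α u ξ = u x - 3 * α * ‖x - ξ‖ ^ 2 ∧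
      a ∈ superjet univ u x := by
  set f := lasryLions α u with hf
  obtain ⟨y, hy⟩ := exists_lasryLions_eq hK hα ξ
  obtain ⟨x, hx⟩ := exists_supConv_eq hu hK (by positivity : 0 < 2 * α) y
  rw [← hf] at hy
  have hup : ∀ z, f z ≤ supConv (2 * α) u y + 6 * α * ‖z - y‖ ^ 2 := fun z => by
    rw [norm_sub_rev]; exact lasryLions_le hK hα z y
  have hlow : ∀ z, u x - 3 * α * ‖x - z‖ ^ 2 ≤ f z := fun z => sub_sq_le_lasryLions hK hα x z
  -- the two paraboloids touch at `ξ + h`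
  set h : E N := (1 / 3 : ℝ) • (x + (2 : ℝ) • y) - ξ with hh
  have hz : u x - 3 * α * ‖x - (ξ + h)‖ ^ 2 = supConv (2 * α) u y + 6 * α * ‖y - (ξ + h)‖ ^ 2 := by
    have e1 : x - (ξ + h) = (2 / 3 : ℝ) • (x - y) := by rw [hh]; module
    have e2 : y - (ξ + h) = -((1 / 3 : ℝ) • (x - y)) := by rw [hh]; module
    rw [hx, e1, e2, norm_neg, norm_smul, norm_smul, Real.norm_of_nonneg (by norm_num),
      Real.norm_of_nonneg (by norm_num)]
    ring
  -- For a competitor `y'`, the difference between its paraboloid and that of `y` is affine in `t`,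
  -- because the quadratic terms cancel. It is nonnegative at `t = 0` and at `t = 1`, hence in
  -- between.
  have hseg : ∀ t : ℝ, 0 ≤ t → t ≤ 1 →
      f (ξ + t • h) = supConv (2 * α) u y + 6 * α * ‖(ξ + t • h) - y‖ ^ 2 := by
    intro t ht0 ht1
    refine le_antisymm (hup _) ?_
    obtain ⟨y', hy'⟩ := exists_lasryLions_eq hK hα (ξ + t • h)
    rw [← hf] at hy'
    have k1 : f ξ ≤ supConv (2 * α) u y' + 6 * α * ‖y' - ξ‖ ^ 2 := lasryLions_le hK hα ξ y'
    have k2 : f (ξ + h) ≤ supConv (2 * α) u y' + 6 * α * ‖y' - (ξ + h)‖ ^ 2 :=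
      lasryLions_le hK hα (ξ + h) y'
    have k3 := hlow (ξ + h)
    rw [hy']
    rw [hy] at k1
    rw [hz] at k3
    have id : ∀ z : E N, ‖z - (ξ + t • h)‖ ^ 2
        = (1 - t) * ‖z - ξ‖ ^ 2 + t * ‖z - (ξ + h)‖ ^ 2 - t * (1 - t) * ‖h‖ ^ 2 := by
      intro z
      rw [← sub_sub, ← sub_sub, norm_sub_sq_real (z - ξ), norm_sub_sq_real (z - ξ),
        inner_smul_right, norm_smul, mul_pow, Real.norm_eq_abs, sq_abs]
      ring
    rw [norm_sub_rev _ y, id y, id y']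
    have m1 := mul_le_mul_of_nonneg_left k1 (by linarith : 0 ≤ 1 - t)
    have m2 := mul_le_mul_of_nonneg_left (k3.trans k2) ht0
    nlinarith
  have hpar := (hasExpansionAt_const (supConv (2 * α) u y) ξ).add (hasExpansionAt_sq (6 * α) y ξ)
  rw [zero_add] at hpar
  have hgrad : (2 * (6 * α)) • (ξ - y) = a.1 :=
    fst_eq_of_mem_jets (superjet_of_eventually_le (hpar.mem_superjet univ) (.of_forall hup)
      (by rw [hy, norm_sub_rev])) (ha.mem_subjet univ)
  have hh0 : h = 0 := by
    by_contra hne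
    set O : Set (E N) := (fun t : ℝ => ξ + t • h) '' Icc 0 1 with hO
    have hd : ∀ᶠ t : ℝ in 𝓝[>] 0, ξ + t • h ∈ O := by
      filter_upwards [Ioc_mem_nhdsGT (zero_lt_one' ℝ)] with t ht
      exact ⟨t, ⟨ht.1.le, ht.2⟩, rfl⟩
    have hsub : (2 * (6 * α)) • (ξ - y) = a.1 := hgrad
    have hb : ((2 * (6 * α)) • (ξ - y), (2 * (6 * α)) • (1 : Sym N)) ∈ subjet O f ξ := by
      rw [mem_subjet_iff]
      refine superjet_of_eventually_le (hpar.neg.mem_superjet O) ?_ (by rw [hy, norm_sub_rev])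
      filter_upwards [self_mem_nhdsWithin] with z hz
      obtain ⟨t, ht, rfl⟩ := hz
      rw [hseg t ht.1 ht.2]
    have := quad_le_of_mem_jets (ha.mem_superjet O) hb hd (by rw [hgrad])
    simp only [quad_smul, quad_one] at this
    have h2 := hX h
    have : 0 < ‖h‖ := norm_pos_iff.2 hne
    have : 0 < ‖h‖ ^ 2 := by positivity
    nlinarith
  rw [hh0, add_zero] at hz
  have hfξ : f ξ = u x - 3 * α * ‖x - ξ‖ ^ 2 := by rw [hz, hy]
  have hxy : ξ - y = (1 / 2 : ℝ) • (x - ξ) := by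
    have : ξ = (1 / 3 : ℝ) • (x + (2 : ℝ) • y) := by
      rw [hh, sub_eq_zero] at hh0; exact hh0.symm
    rw [this]; module
  refine ⟨x, by rw [← hgrad, hxy, smul_smul]; congr 1; ring, hfξ, ?_⟩
  -- `u z ≤ f (z - x + ξ) + 3α‖x - ξ‖²`, with equality at `z = x`, so the expansion of `f` at `ξ`
  -- translates to `u` at `x`.
  intro ε hε
  have ht : Tendsto (fun z : E N => z - x + ξ) (𝓝 x) (𝓝 ξ) := by
    have : Continuous fun z : E N => z - x + ξ := by fun_prop
    simpa using this.tendsto x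
  rw [nhdsWithin_univ]
  filter_upwards [ht.eventually (ha ε hε)] with z hz
  have h1 := sub_sq_le_lasryLions hK hα z (z - x + ξ)
  have e1 : z - (z - x + ξ) = x - ξ := by abel
  have e2 : z - x + ξ - ξ = z - x := by abel
  rw [e1, ← hf] at h1
  rw [e2] at hz
  have := (abs_le.1 hz).2
  linarith

/-! ### A Jensen-type lemma -/

lemma gradient_eq_of_isLocalMax {f : E N → ℝ} {p ξ : E N} (hf : HasGradientAt f p ξ)
    {c₁ c₂ q : E N} {κ δ : ℝ}
    (h : IsLocalMax (fun y => f y - κ * ‖y - c₁‖ ^ 2 - δ * ‖y - c₂‖ ^ 2 - inner ℝ q y) ξ) :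
    p - (2 * κ) • (ξ - c₁) - (2 * δ) • (ξ - c₂) = q := by
  have hsq : ∀ c : E N, HasFDerivAt (fun y : E N => ‖y - c‖ ^ 2)
      (2 • (innerSL ℝ (ξ - c))) ξ := fun c => by
    simpa using ((hasFDerivAt_id ξ).sub_const c).norm_sq
  have a1 : HasFDerivAt f (innerSL ℝ p) ξ := hf.hasFDerivAt
  have d : HasFDerivAt (fun y => f y - κ * ‖y - c₁‖ ^ 2 - δ * ‖y - c₂‖ ^ 2 - inner ℝ q y)
      (innerSL ℝ p - κ • (2 • innerSL ℝ (ξ - c₁)) - δ • (2 • innerSL ℝ (ξ - c₂)) - innerSL ℝ q) ξ :=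
    ((a1.sub ((hsq c₁).const_mul κ)).sub ((hsq c₂).const_mul δ)).sub (innerSL ℝ q).hasFDerivAt
  have := h.hasFDerivAt_eq_zero d
  refine ext_inner_right ℝ fun w => ?_
  have := DFunLike.congr_fun this w
  simp [inner_sub_left, inner_smul_left] at this ⊢
  linarith

/-- For every small `q` the tilted function has an interior maximum `z`, and the first-order
condition reads `T z = q` with `T` Lipschitz. If `P` or `Q` were non-differentiable at all these
points, the `T`-image of a null set would contain a ball. -/
lemma exists_local_max_of_lipschitz_gradient {f g : E N → ℝ} {P Q : E N → E N}
    (hP : ∀ x, HasGradientAt f (P x) x) (hQ : ∀ x, HasGradientAt g (Q x) x)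
    {L L' : NNReal} (hPL : LipschitzWith L P) (hQL : LipschitzWith L' Q) {κ M : ℝ} {ξ₀ η₀ : E N}
    (hM : ∀ ξ η, f ξ + g η - κ * ‖ξ - η‖ ^ 2 ≤ M)
    (hM₀ : f ξ₀ + g η₀ - κ * ‖ξ₀ - η₀‖ ^ 2 = M) {δ r : ℝ} (hδ : 0 < δ) (hr : 0 < r) :
    ∃ ξ η q₁ q₂ : E N, ‖ξ - ξ₀‖ < r ∧ ‖η - η₀‖ < r ∧
      DifferentiableAt ℝ P ξ ∧ DifferentiableAt ℝ Q η ∧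
      IsLocalMax (fun z : E N × E N => f z.1 + g z.2 - κ * ‖z.1 - z.2‖ ^ 2
        - δ * (‖z.1 - ξ₀‖ ^ 2 + ‖z.2 - η₀‖ ^ 2) - inner ℝ q₁ z.1 - inner ℝ q₂ z.2) (ξ, η) := by
  classical
  set H : E N × E N → E N × E N → ℝ := fun q z => f z.1 + g z.2 - κ * ‖z.1 - z.2‖ ^ 2
        - δ * (‖z.1 - ξ₀‖ ^ 2 + ‖z.2 - η₀‖ ^ 2) - inner ℝ q.1 z.1 - inner ℝ q.2 z.2 with hH
  set T : E N × E N → E N × E N := fun z =>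
    (P z.1 - (2 * κ) • (z.1 - z.2) - (2 * δ) • (z.1 - ξ₀),
     Q z.2 + (2 * κ) • (z.1 - z.2) - (2 * δ) • (z.2 - η₀)) with hT
  have hfc : Continuous f := continuous_iff_continuousAt.2 fun x => (hP x).continuousAt
  have hgc : Continuous g := continuous_iff_continuousAt.2 fun x => (hQ x).continuousAt
  have hHc : ∀ q, Continuous (H q) := fun q => by simp only [hH]; fun_prop
  -- every small `q` is attained at an interior local maximum
  have key : ∀ q ∈ Metric.ball (0 : E N × E N) (δ * r / 2),
      ∃ z ∈ Metric.ball ((ξ₀, η₀) : E N × E N) r, IsLocalMax (H q) z ∧ T z = q := by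
    rintro ⟨q₁, q₂⟩ hq
    rw [mem_ball_zero_iff, Prod.norm_mk, max_lt_iff] at hq
    obtain ⟨z, hz, hzmax⟩ := (isCompact_closedBall ((ξ₀, η₀) : E N × E N) r).exists_isMaxOn
      ⟨_, Metric.mem_closedBall_self hr.le⟩ (hHc (q₁, q₂)).continuousOn
    obtain ⟨ξ, η⟩ := z
    have h0 := hzmax (Metric.mem_closedBall_self hr.le)
    simp only [mem_ofPred_eq, hH, sub_self, norm_zero] at h0
    have h1 := hM ξ η
    have hz' : ‖ξ - ξ₀‖ ≤ r ∧ ‖η - η₀‖ ≤ r := by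
      rw [Metric.mem_closedBall, dist_eq_norm, Prod.mk_sub_mk, Prod.norm_mk, max_le_iff] at hz
      exact hz
    have h2 : inner ℝ q₁ ξ₀ - inner ℝ q₁ ξ ≤ ‖q₁‖ * ‖ξ - ξ₀‖ := by
      rw [← inner_sub_right, norm_sub_rev]; exact real_inner_le_norm _ _
    have h3 : inner ℝ q₂ η₀ - inner ℝ q₂ η ≤ ‖q₂‖ * ‖η - η₀‖ := by
      rw [← inner_sub_right, norm_sub_rev]; exact real_inner_le_norm _ _
    have h4 : ‖q₁‖ * ‖ξ - ξ₀‖ ≤ ‖q₁‖ * r := by gcongr; exact hz'.1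
    have h5 : ‖q₂‖ * ‖η - η₀‖ ≤ ‖q₂‖ * r := by gcongr; exact hz'.2
    -- The tilts gain less than `2 · (δr/2) · r`, while reaching the edge of the ball costs at least
    -- `δr²`; hence the maximum is interior.
    have h6 : δ * (‖ξ - ξ₀‖ ^ 2 + ‖η - η₀‖ ^ 2) < δ * r ^ 2 := by nlinarith
    have h7 := lt_of_mul_lt_mul_left h6 hδ.le
    have hint : ((ξ, η) : E N × E N) ∈ Metric.ball ((ξ₀, η₀) : E N × E N) r := by
      rw [Metric.mem_ball, dist_eq_norm, Prod.mk_sub_mk, Prod.norm_mk, max_lt_iff]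
      constructor
      · refine lt_of_pow_lt_pow_left₀ 2 hr.le ?_; nlinarith [sq_nonneg ‖η - η₀‖]
      · refine lt_of_pow_lt_pow_left₀ 2 hr.le ?_; nlinarith [sq_nonneg ‖ξ - ξ₀‖]
    have hloc : IsLocalMax (H (q₁, q₂)) (ξ, η) := by
      filter_upwards [Metric.isOpen_ball.mem_nhds hint] with w hw
      exact hzmax (Metric.ball_subset_closedBall hw)
    refine ⟨(ξ, η), hint, hloc, ?_⟩
    have l1 : IsLocalMax (fun y => f y - κ * ‖y - η‖ ^ 2 - δ * ‖y - ξ₀‖ ^ 2 - inner ℝ q₁ y) ξ := by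
      have : Tendsto (fun y : E N => (y, η)) (𝓝 ξ) (𝓝 (ξ, η)) :=
        (Continuous.prodMk_left η).tendsto ξ
      filter_upwards [this.eventually hloc] with y hy
      simp only [hH] at hy
      linarith
    have l2 : IsLocalMax (fun y => g y - κ * ‖y - ξ‖ ^ 2 - δ * ‖y - η₀‖ ^ 2 - inner ℝ q₂ y) η := by
      have : Tendsto (fun y : E N => (ξ, y)) (𝓝 η) (𝓝 (ξ, η)) :=
        (Continuous.prodMk_right ξ).tendsto η
      filter_upwards [this.eventually hloc] with y hy
      simp only [hH] at hy
      rw [norm_sub_rev y ξ, norm_sub_rev η ξ]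
      linarith
    refine Prod.ext (gradient_eq_of_isLocalMax (hP ξ) l1) ?_
    rw [← gradient_eq_of_isLocalMax (hQ η) l2]
    simp only [hT]
    module
  by_contra hcon
  push Not at hcon
  set S : Set (E N × E N) := {z | ¬ (DifferentiableAt ℝ P z.1 ∧ DifferentiableAt ℝ Q z.2)} with hS
  have hsub : Metric.ball (0 : E N × E N) (δ * r / 2) ⊆ T '' S := by
    intro q hq
    obtain ⟨⟨ξ, η⟩, hz, hloc, hTz⟩ := key q hq
    refine ⟨(ξ, η), ?_, hTz⟩
    rw [Metric.mem_ball, dist_eq_norm, Prod.mk_sub_mk, Prod.norm_mk, max_lt_iff] at hz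
    rintro ⟨d1, d2⟩
    exact hcon ξ η q.1 q.2 hz.1 hz.2 d1 d2 hloc
  have hTL : ∃ K : NNReal, LipschitzWith K T := by
    have p1 : LipschitzWith 1 (Prod.fst : E N × E N → E N) := LipschitzWith.prod_fst
    have p2 : LipschitzWith 1 (Prod.snd : E N × E N → E N) := LipschitzWith.prod_snd
    have s : ∀ c : ℝ, LipschitzWith ‖c‖₊ (fun x : E N => c • x) := fun c => lipschitzWith_smul c
    have d1 := (s (2 * κ)).comp (p1.sub p2)
    have c1 := (s (2 * δ)).comp (p1.sub (LipschitzWith.const ξ₀))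
    have c2 := (s (2 * δ)).comp (p2.sub (LipschitzWith.const η₀))
    exact ⟨_, (((hPL.comp p1).sub d1).sub c1).prodMk (((hQL.comp p2).add d1).sub c2)⟩
  obtain ⟨K, hK⟩ := hTL
  -- In top dimension the Hausdorff measure is a Haar measure, so Rademacher's theorem in each
  -- factor makes `S` null for it.
  have hnull : MeasureTheory.Measure.hausdorffMeasure (Module.finrank ℝ (E N × E N) : ℝ) S = 0 := by
    have v0 : ((MeasureTheory.volume : MeasureTheory.Measure (E N)).prod
        (MeasureTheory.volume : MeasureTheory.Measure (E N))) S = 0 := by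
      have e1 := (MeasureTheory.Measure.quasiMeasurePreserving_fst
        (μ := (MeasureTheory.volume : MeasureTheory.Measure (E N)))
        (ν := (MeasureTheory.volume : MeasureTheory.Measure (E N)))).ae
        (hPL.ae_differentiableAt (μ := MeasureTheory.volume))
      have e2 := (MeasureTheory.Measure.quasiMeasurePreserving_snd
        (μ := (MeasureTheory.volume : MeasureTheory.Measure (E N)))
        (ν := (MeasureTheory.volume : MeasureTheory.Measure (E N)))).ae
        (hQL.ae_differentiableAt (μ := MeasureTheory.volume))
      have := e1.and e2
      rw [MeasureTheory.ae_iff] at this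
      exact this
    exact MeasureTheory.Measure.absolutelyContinuous_isAddHaarMeasure _
      ((MeasureTheory.volume : MeasureTheory.Measure (E N)).prod MeasureTheory.volume) v0
  have himg := hK.hausdorffMeasure_image_le (d := (Module.finrank ℝ (E N × E N) : ℝ)) (by positivity) S
  rw [hnull, mul_zero] at himg
  have hpos : 0 < MeasureTheory.Measure.hausdorffMeasure (Module.finrank ℝ (E N × E N) : ℝ)
      (Metric.ball (0 : E N × E N) (δ * r / 2)) :=
    Metric.measure_ball_pos _ _ (by positivity)
  exact absurd (MeasureTheory.measure_mono hsub) (not_le.2 (lt_of_le_of_lt himg hpos))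

end Viscosity

namespace Viscosity

variable {N : ℕ}

/-! ### The theorem on sums -/

instance : FiniteDimensional ℝ (Sym N) :=
  inferInstanceAs (FiniteDimensional ℝ (selfAdjoint.submodule ℝ (E N →L[ℝ] E N)))

instance : ProperSpace (Sym N) := FiniteDimensional.proper ℝ (Sym N)

/-- Inverse penalties again: the coefficient `α/2` has inverse `2/α`, which loses `1/(2α)` per
variable in the sup-convolutions and regains `1/(6α)` per variable in the inf-convolutions. This
leaves `4/(3α)`. Moving `ξ` and `η` towards each other by an eighth of their difference gives this
sharp constant. -/
lemma lasryLions_add_le {u w : E N → ℝ} {K α M : ℝ} (hu : UpperSemicontinuous u)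
    (hw : UpperSemicontinuous w) (huK : ∀ x, |u x| ≤ K) (hwK : ∀ x, |w x| ≤ K) (hα : 0 < α)
    (hM : ∀ x y, u x + w y - α / 2 * ‖x - y‖ ^ 2 ≤ M) (ξ η : E N) :
    lasryLions α u ξ + lasryLions α w η - 3 * α / 4 * ‖ξ - η‖ ^ 2 ≤ M := by
  set D := ξ - η with hD
  set y : E N := ξ - (1 / 8 : ℝ) • D with hy
  set y' : E N := η + (1 / 8 : ℝ) • D with hy'
  obtain ⟨x, hx⟩ := exists_supConv_eq hu huK (by positivity : 0 < 2 * α) y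
  obtain ⟨x', hx'⟩ := exists_supConv_eq hw hwK (by positivity : 0 < 2 * α) y'
  have h1 := lasryLions_le huK hα ξ y
  have h2 := lasryLions_le hwK hα η y'
  have h3 := hM x x'
  have e1 : y - ξ = -((1 / 8 : ℝ) • D) := by rw [hy]; abel
  have e2 : y' - η = (1 / 8 : ℝ) • D := by rw [hy']; abel
  have e3 : x - x' = (3 / 4 : ℝ) • D + ((x - y) - (x' - y')) := by
    rw [hy, hy', hD]; module
  rw [e1, norm_neg, norm_smul, Real.norm_of_nonneg (by norm_num), hx] at h1
  rw [e2, norm_smul, Real.norm_of_nonneg (by norm_num), hx'] at h2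
  rw [e3] at h3
  set A := x - y
  set B := x' - y'
  have p1 := parallelogram_law_with_norm ℝ A B
  have p2 := parallelogram_law_with_norm ℝ ((3 / 4 : ℝ) • D) (A - B)
  have p3 : 0 ≤ ‖A + B‖ ^ 2 := by positivity
  have p4 : 0 ≤ ‖(3 / 4 : ℝ) • D - (A - B)‖ ^ 2 := by positivity
  have p5 : ‖(3 / 4 : ℝ) • D‖ = 3 / 4 * ‖D‖ := by
    rw [norm_smul, Real.norm_of_nonneg (by norm_num)]
  rw [p5] at p2
  have key : 1 / 2 * ‖(3 / 4 : ℝ) • D + (A - B)‖ ^ 2 ≤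
      9 / 16 * ‖D‖ ^ 2 + 2 * ‖A‖ ^ 2 + 2 * ‖B‖ ^ 2 := by nlinarith
  have := mul_le_mul_of_nonneg_left key hα.le
  nlinarith

/-- Approximate form of the theorem on sums for the regularized functions. -/
lemma exists_jets_near {u w : E N → ℝ} {K α : ℝ} (hu : UpperSemicontinuous u)
    (hw : UpperSemicontinuous w) (huK : ∀ x, |u x| ≤ K) (hwK : ∀ x, |w x| ≤ K) (hα : 0 < α)
    {P Q : E N → E N} (hP : ∀ x, HasGradientAt (lasryLions α u) (P x) x)
    (hQ : ∀ x, HasGradientAt (lasryLions α w) (Q x) x)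
    {L L' : NNReal} (hPL : LipschitzWith L P) (hQL : LipschitzWith L' Q)
    {M : ℝ} {ξ₀ η₀ : E N} (hM : ∀ x y, u x + w y - α / 2 * ‖x - y‖ ^ 2 ≤ M)
    (hM₀ : lasryLions α u ξ₀ + lasryLions α w η₀ - 3 * α / 4 * ‖ξ₀ - η₀‖ ^ 2 = M)
    {δ : ℝ} (hδ : 0 < δ) (hδα : δ ≤ α) :
    ∃ ξ η : E N, ∃ X Y : Sym N, ‖ξ - ξ₀‖ < δ ∧ ‖η - η₀‖ < δ ∧
      (∃ x, P ξ = (6 * α) • (x - ξ) ∧ lasryLions α u ξ = u x - 3 * α * ‖x - ξ‖ ^ 2 ∧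
        (P ξ, X) ∈ superjet univ u x) ∧
      (∃ y, Q η = (6 * α) • (y - η) ∧ lasryLions α w η = w y - 3 * α * ‖y - η‖ ^ 2 ∧
        (Q η, Y) ∈ superjet univ w y) ∧
      (∀ a, -(6 * α * ‖a‖ ^ 2) ≤ quad X a) ∧ (∀ a, -(6 * α * ‖a‖ ^ 2) ≤ quad Y a) ∧
      ∀ a b, quad X a + quad Y b ≤ 3 * α / 2 * ‖a - b‖ ^ 2 + 2 * δ * (‖a‖ ^ 2 + ‖b‖ ^ 2) := by
  obtain ⟨ξ, η, q₁, q₂, hξ, hη, dP, dQ, hloc⟩ := exists_local_max_of_lipschitz_gradient hP hQ hPL hQL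
    (fun ξ η => lasryLions_add_le hu hw huK hwK hα hM ξ η) hM₀ hδ hδ
  set X : Sym N := ⟨fderiv ℝ P ξ,
    isSelfAdjoint_of_hasFDerivAt_gradient (.of_forall hP) dP.hasFDerivAt⟩ with hX
  set Y : Sym N := ⟨fderiv ℝ Q η,
    isSelfAdjoint_of_hasFDerivAt_gradient (.of_forall hQ) dQ.hasFDerivAt⟩ with hY
  have eX : HasExpansionAt (lasryLions α u) (P ξ, X) ξ :=
    hasExpansionAt_of_hasFDerivAt_gradient (.of_forall hP) dP.hasFDerivAt
  have eY : HasExpansionAt (lasryLions α w) (Q η, Y) η :=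
    hasExpansionAt_of_hasFDerivAt_gradient (.of_forall hQ) dQ.hasFDerivAt
  have low : ∀ {v : E N → ℝ} (_ : UpperSemicontinuous v) (_ : ∀ x, |v x| ≤ K) {z : E N}
      {a : E N × Sym N} (_ : HasExpansionAt (lasryLions α v) a z) (d : E N),
      -(6 * α * ‖d‖ ^ 2) ≤ quad a.2 d := by
    intro v hv hvK z a ha d
    refine ge_of_tendsto (ha.tendsto_second_difference d) ?_
    filter_upwards [self_mem_nhdsWithin] with t ht
    rw [mem_Ioi] at ht
    rw [le_div_iff₀ (by positivity)]
    have := lasryLions_second_difference hv hvK hα z (t • d)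
    rw [norm_smul, mul_pow, Real.norm_eq_abs, sq_abs] at this
    linarith
  have up : ∀ a b, quad X a + quad Y b ≤
      3 * α / 2 * ‖a - b‖ ^ 2 + 2 * δ * (‖a‖ ^ 2 + ‖b‖ ^ 2) := by
    intro a b
    refine le_of_tendsto ((eX.tendsto_second_difference a).add (eY.tendsto_second_difference b)) ?_
    have t1 : Tendsto (fun t : ℝ => (ξ + t • a, η + t • b)) (𝓝[>] 0) (𝓝 (ξ, η)) := by
      have : Continuous fun t : ℝ => (ξ + t • a, η + t • b) := by fun_prop
      simpa using (this.tendsto 0).mono_left nhdsWithin_le_nhds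
    have t2 : Tendsto (fun t : ℝ => (ξ - t • a, η - t • b)) (𝓝[>] 0) (𝓝 (ξ, η)) := by
      have : Continuous fun t : ℝ => (ξ - t • a, η - t • b) := by fun_prop
      simpa using (this.tendsto 0).mono_left nhdsWithin_le_nhds
    filter_upwards [self_mem_nhdsWithin, t1.eventually hloc, t2.eventually hloc] with t ht h1 h2
    rw [mem_Ioi] at ht
    rw [← add_div, div_le_iff₀ (by positivity)]
    have par : ∀ c d : E N, ‖c + t • d‖ ^ 2 + ‖c - t • d‖ ^ 2 = 2 * ‖c‖ ^ 2 + 2 * t ^ 2 * ‖d‖ ^ 2 := by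
      intro c d
      rw [norm_add_sq_real, norm_sub_sq_real, norm_smul, mul_pow, Real.norm_eq_abs, sq_abs]; ring
    have p1 := par (ξ - η) (a - b)
    have p2 := par (ξ - ξ₀) a
    have p3 := par (η - η₀) b
    have r1 : ξ + t • a - (η + t • b) = ξ - η + t • (a - b) := by module
    have r2 : ξ - t • a - (η - t • b) = ξ - η - t • (a - b) := by module
    have r3 : ξ + t • a - ξ₀ = ξ - ξ₀ + t • a := by abel
    have r4 : ξ - t • a - ξ₀ = ξ - ξ₀ - t • a := by abel
    have r5 : η + t • b - η₀ = η - η₀ + t • b := by abel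
    have r6 : η - t • b - η₀ = η - η₀ - t • b := by abel
    rw [r1, r3, r5, inner_add_right, inner_add_right] at h1
    rw [r2, r4, r6, inner_sub_right, inner_sub_right] at h2
    have q1 := congrArg (fun s => 3 * α / 4 * s) p1
    have q2 := congrArg (fun s => δ * s) p2
    have q3 := congrArg (fun s => δ * s) p3
    linarith
  refine ⟨ξ, η, X, Y, hξ, hη, ?_, ?_, low hu huK eX, low hw hwK eY, up⟩
  -- With `b = 0`, `up` bounds `X` by `3α/2 + 2δ ≤ 7α/2`, well below the threshold `12α`.
  · refine lasryLions_contact hu huK hα eX (c := 4 * α) (by linarith) fun h => ?_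
    have := up h 0
    have h0 : 0 ≤ ‖h‖ ^ 2 := by positivity
    simp at this
    nlinarith
  · refine lasryLions_contact hw hwK hα eY (c := 4 * α) (by linarith) fun h => ?_
    have := up 0 h
    have h0 : 0 ≤ ‖h‖ ^ 2 := by positivity
    simp at this
    nlinarith

/-- The theorem on sums for bounded semicontinuous functions on the whole space. -/
lemma theorem_on_sums_univ {u w : E N → ℝ} {K α : ℝ} (hu : UpperSemicontinuous u)
    (hw : UpperSemicontinuous w) (huK : ∀ x, |u x| ≤ K) (hwK : ∀ x, |w x| ≤ K) (hα : 0 < α)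
    {x₀ y₀ : E N} (hM : ∀ x y, u x + w y - α / 2 * ‖x - y‖ ^ 2 ≤
      u x₀ + w y₀ - α / 2 * ‖x₀ - y₀‖ ^ 2) :
    ∃ X Y : Sym N, (α • (x₀ - y₀), X) ∈ closedSuperjet univ u x₀ ∧
      (-(α • (x₀ - y₀)), Y) ∈ closedSuperjet univ w y₀ ∧ BlockBound (2 * α) X (-Y) := by
  set M := u x₀ + w y₀ - α / 2 * ‖x₀ - y₀‖ ^ 2 with hMdef
  obtain ⟨P, hP, L, hPL⟩ := lasryLions_gradient hu huK hα
  obtain ⟨Q, hQ, L', hQL⟩ := lasryLions_gradient hw hwK hα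
  set d := x₀ - y₀ with hd
  -- At these points all the inequalities are equalities: two costs `3α|d|²/36` plus
  -- `(3α/4)(4/9)|d|²` make `(α/2)|d|²`. The gradient there is `6α · d/6 = α • d`.
  set ξ₀ : E N := x₀ - (1 / 6 : ℝ) • d with hξ₀
  set η₀ : E N := y₀ + (1 / 6 : ℝ) • d with hη₀
  have eξ : x₀ - ξ₀ = (1 / 6 : ℝ) • d := by rw [hξ₀]; abel
  have eη : y₀ - η₀ = -((1 / 6 : ℝ) • d) := by rw [hη₀]; abel
  have eξη : ξ₀ - η₀ = (2 / 3 : ℝ) • d := by rw [hξ₀, hη₀, hd]; module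
  have lu := sub_sq_le_lasryLions huK hα x₀ ξ₀
  have lw := sub_sq_le_lasryLions hwK hα y₀ η₀
  have hle := lasryLions_add_le hu hw huK hwK hα hM ξ₀ η₀
  have nd : ∀ c : ℝ, ‖c • d‖ ^ 2 = c ^ 2 * ‖d‖ ^ 2 := fun c => by
    rw [norm_smul, mul_pow, Real.norm_eq_abs, sq_abs]
  have eqs : lasryLions α u ξ₀ + lasryLions α w η₀ - 3 * α / 4 * ‖ξ₀ - η₀‖ ^ 2 = M ∧
      lasryLions α u ξ₀ = u x₀ - 3 * α * ‖x₀ - ξ₀‖ ^ 2 ∧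
      lasryLions α w η₀ = w y₀ - 3 * α * ‖y₀ - η₀‖ ^ 2 := by
    rw [eξ, nd] at lu ⊢
    rw [eη, norm_neg, nd] at lw ⊢
    rw [eξη, nd] at hle ⊢
    refine ⟨by linarith, by linarith, by linarith⟩
  obtain ⟨hM₀, hfu, hfw⟩ := eqs
  have grad : ∀ {f v : E N → ℝ} {x ξ : E N} {p : E N} (_ : HasGradientAt f p ξ)
      (_ : ∀ z, v x - 3 * α * ‖x - z‖ ^ 2 ≤ f z) (_ : f ξ = v x - 3 * α * ‖x - ξ‖ ^ 2),
      p = (6 * α) • (x - ξ) := by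
    intro f v x ξ p hf hle heq
    have hmin : IsLocalMax (fun y => -f y - 3 * α * ‖y - x‖ ^ 2 - 0 * ‖y - x‖ ^ 2
        - inner ℝ (0 : E N) y) ξ := by
      refine .of_forall fun z => ?_
      have := hle z
      simp only [inner_zero_left, zero_mul, norm_sub_rev _ x]
      linarith
    have hneg : HasGradientAt (fun y => -f y) (-p) ξ := by
      rw [hasGradientAt_iff_hasFDerivAt] at hf ⊢
      rw [map_neg]; exact hf.neg
    have := gradient_eq_of_isLocalMax hneg hmin
    simp only [mul_zero, zero_smul, sub_zero] at this
    rw [sub_eq_zero] at this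
    rw [← neg_neg p, this]
    module
  have hPξ : P ξ₀ = α • d := by
    rw [grad (hP ξ₀) (fun z => sub_sq_le_lasryLions huK hα x₀ z) hfu, eξ, smul_smul]
    congr 1; ring
  have hQη : Q η₀ = -(α • d) := by
    rw [grad (hQ η₀) (fun z => sub_sq_le_lasryLions hwK hα y₀ z) hfw, eη, smul_neg, smul_smul]
    congr 2; ring
  set δ : ℕ → ℝ := fun k => α / (k + 1) with hδdef
  have hδ0 : ∀ k, 0 < δ k := fun k => by simp only [hδdef]; positivity
  have hδ1 : ∀ k, δ k ≤ α := fun k => div_le_self hα.le (by simp)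
  have hδt : Tendsto δ atTop (𝓝 0) := by
    have := (tendsto_one_div_add_atTop_nhds_zero_nat (𝕜 := ℝ)).const_mul α
    simpa [hδdef, div_eq_mul_inv] using this
  choose ξ η X Y hξ hη hx hy lX lY hXY using fun k =>
    exists_jets_near hu hw huK hwK hα hP hQ hPL hQL hM hM₀ (hδ0 k) (hδ1 k)
  choose x hx1 hx2 hx3 using hx
  choose y hy1 hy2 hy3 using hy
  have tξ : Tendsto ξ atTop (𝓝 ξ₀) := tendsto_iff_norm_sub_tendsto_zero.2
    (squeeze_zero (fun _ => norm_nonneg _) (fun k => (hξ k).le) hδt)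
  have tη : Tendsto η atTop (𝓝 η₀) := tendsto_iff_norm_sub_tendsto_zero.2
    (squeeze_zero (fun _ => norm_nonneg _) (fun k => (hη k).le) hδt)
  have tP : Tendsto (fun k => P (ξ k)) atTop (𝓝 (α • d)) := by
    rw [← hPξ]; exact (hPL.continuous.tendsto ξ₀).comp tξ
  have tQ : Tendsto (fun k => Q (η k)) atTop (𝓝 (-(α • d))) := by
    rw [← hQη]; exact (hQL.continuous.tendsto η₀).comp tη
  have point : ∀ {z ζ : ℕ → E N} {R : E N → E N} {e ζ₀ : E N}, Tendsto ζ atTop (𝓝 ζ₀) →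
      Tendsto (fun k => R (ζ k)) atTop (𝓝 (α • e)) → (∀ k, R (ζ k) = (6 * α) • (z k - ζ k)) →
      Tendsto z atTop (𝓝 (ζ₀ + (1 / 6 : ℝ) • e)) := by
    intro z ζ R e ζ₀ t1 t2 h
    have h' : z = fun k => ζ k + (1 / (6 * α)) • R (ζ k) := by
      funext k
      rw [h k, smul_smul, one_div_mul_cancel (by positivity)]; module
    rw [h']
    have := t1.add (t2.const_smul (1 / (6 * α)))
    rw [smul_smul] at this
    convert this using 4
    field_simp
  have tx : Tendsto x atTop (𝓝 x₀) := by
    have := point tξ tP hx1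
    rwa [hξ₀, sub_add_cancel] at this
  have ty : Tendsto y atTop (𝓝 y₀) := by
    have := point (e := -d) tη (by rw [smul_neg]; exact tQ) hy1
    rwa [hη₀, smul_neg, add_neg_cancel_right] at this
  have cu : Continuous (lasryLions α u) := continuous_iff_continuousAt.2 fun z => (hP z).continuousAt
  have cw : Continuous (lasryLions α w) := continuous_iff_continuousAt.2 fun z => (hQ z).continuousAt
  have tux : Tendsto (fun k => u (x k)) atTop (𝓝 (u x₀)) := by
    have h1 : (fun k => u (x k)) = fun k => lasryLions α u (ξ k) + 3 * α * ‖x k - ξ k‖ ^ 2 := by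
      funext k; rw [hx2 k]; ring
    have h2 : u x₀ = lasryLions α u ξ₀ + 3 * α * ‖x₀ - ξ₀‖ ^ 2 := by rw [hfu]; ring
    rw [h1, h2]
    exact ((cu.tendsto ξ₀).comp tξ).add (((tx.sub tξ).norm.pow 2).const_mul _)
  have twy : Tendsto (fun k => w (y k)) atTop (𝓝 (w y₀)) := by
    have h1 : (fun k => w (y k)) = fun k => lasryLions α w (η k) + 3 * α * ‖y k - η k‖ ^ 2 := by
      funext k; rw [hy2 k]; ring
    have h2 : w y₀ = lasryLions α w η₀ + 3 * α * ‖y₀ - η₀‖ ^ 2 := by rw [hfw]; ring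
    rw [h1, h2]
    exact ((cw.tendsto η₀).comp tη).add (((ty.sub tη).norm.pow 2).const_mul _)
  have bX : ∀ k, ‖X k‖ ≤ 2 * (6 * α) := fun k => norm_le_of_quad (by positivity) fun a => by
    have h0 : 0 ≤ ‖a‖ ^ 2 := by positivity
    have h1 := hXY k a 0
    have h2 := hδ1 k
    simp at h1
    rw [abs_le]; constructor
    · linarith [lX k a]
    · nlinarith
  have bY : ∀ k, ‖Y k‖ ≤ 2 * (6 * α) := fun k => norm_le_of_quad (by positivity) fun a => by
    have h0 : 0 ≤ ‖a‖ ^ 2 := by positivity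
    have h1 := hXY k 0 a
    have h2 := hδ1 k
    simp at h1
    rw [abs_le]; constructor
    · linarith [lY k a]
    · nlinarith
  obtain ⟨⟨X', Y'⟩, -, φ, hφ, hlim⟩ := (isCompact_closedBall (0 : Sym N × Sym N) (2 * (6 * α))).tendsto_subseq
    (x := fun k => (X k, Y k)) fun k => by
      rw [mem_closedBall_zero_iff, Prod.norm_mk]; exact max_le (bX k) (bY k)
  have tX : Tendsto (fun k => X (φ k)) atTop (𝓝 X') := (continuous_fst.tendsto _).comp hlim
  have tY : Tendsto (fun k => Y (φ k)) atTop (𝓝 Y') := (continuous_snd.tendsto _).comp hlim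
  have qX : ∀ a, Tendsto (fun k => quad (X (φ k)) a) atTop (𝓝 (quad X' a)) := fun a =>
    ((continuous_quad.comp (Continuous.prodMk_left a)).tendsto X').comp tX
  have qY : ∀ a, Tendsto (fun k => quad (Y (φ k)) a) atTop (𝓝 (quad Y' a)) := fun a =>
    ((continuous_quad.comp (Continuous.prodMk_left a)).tendsto Y').comp tY
  have hφt := hφ.tendsto_atTop
  refine ⟨X', Y', ⟨fun k => x (φ k), fun k => (P (ξ (φ k)), X (φ k)),
    fun k => ⟨mem_univ _, hx3 _⟩, tx.comp hφt, tux.comp hφt, (tP.comp hφt).prodMk_nhds tX⟩,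
    ⟨fun k => y (φ k), fun k => (Q (η (φ k)), Y (φ k)),
    fun k => ⟨mem_univ _, hy3 _⟩, ty.comp hφt, twy.comp hφt, (tQ.comp hφt).prodMk_nhds tY⟩, ?_⟩
  intro a b
  rw [quad_neg, sub_neg_eq_add]
  constructor
  -- The lower bound `-6α` dictates the parameter `2 * α` in the block bound; the upper bound `3α/2`
  -- has room to spare.
  · have h1 := ge_of_tendsto' (qX a) fun k => lX (φ k) a
    have h2 := ge_of_tendsto' (qY b) fun k => lY (φ k) b
    linarith
  · have h1 : Tendsto (fun k => 3 * α / 2 * ‖a - b‖ ^ 2 + 2 * δ (φ k) * (‖a‖ ^ 2 + ‖b‖ ^ 2)) atTop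
        (𝓝 (3 * α / 2 * ‖a - b‖ ^ 2 + 2 * 0 * (‖a‖ ^ 2 + ‖b‖ ^ 2))) :=
      (((hδt.comp hφt).const_mul 2).mul_const _).const_add _
    have h2 := le_of_tendsto_of_tendsto' ((qX a).add (qY b)) h1 fun k => hXY (φ k) a b
    have : 0 ≤ α * ‖a - b‖ ^ 2 := by positivity
    linarith

/-- Extension of a function from `O`, cut off from below at the level `m`. -/
noncomputable def cutExtend (O : Set (E N)) (m : ℝ) (u : E N → ℝ) (x : E N) : ℝ :=
  open Classical in if x ∈ O then max (u x) m else m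

lemma cutExtend_of_mem {O : Set (E N)} {m : ℝ} {u : E N → ℝ} {x : E N} (hx : x ∈ O) :
    cutExtend O m u x = max (u x) m := if_pos hx

lemma le_cutExtend (O : Set (E N)) (m : ℝ) (u : E N → ℝ) (x : E N) : m ≤ cutExtend O m u x := by
  unfold cutExtend; split_ifs <;> simp

lemma cutExtend_le {O : Set (E N)} {m K : ℝ} {u : E N → ℝ} (hu : ∀ x ∈ O, u x ≤ K) (hm : m ≤ K)
    (x : E N) : cutExtend O m u x ≤ K := by
  unfold cutExtend; split_ifs with h
  · exact max_le (hu x h) hm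
  · exact hm

lemma upperSemicontinuous_cutExtend {O : Set (E N)} (hO : IsClosed O) {m : ℝ} {u : E N → ℝ}
    (hu : UpperSemicontinuousOn u O) : UpperSemicontinuous (cutExtend O m u) := by
  intro x c hc
  by_cases hx : x ∈ O
  · rw [cutExtend_of_mem hx, max_lt_iff] at hc
    have := hu x hx c hc.1
    rw [eventually_nhdsWithin_iff] at this
    filter_upwards [this] with y hy
    unfold cutExtend
    split_ifs with h
    · exact max_lt (hy h) hc.2
    · exact hc.2
  · have hm : m < c := by simpa [cutExtend, hx] using hc
    filter_upwards [hO.isOpen_compl.mem_nhds hx] with y hy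
    unfold cutExtend
    rw [if_neg hy]; exact hm

/-- A value above `m` forces the point into `O` and agreement with `u` there. Convergence of the
values to `u x > m` puts a tail of the approximating sequence in this situation. -/
lemma closedSuperjet_cutExtend {O : Set (E N)} {m : ℝ} {u : E N → ℝ} {x : E N} (hx : x ∈ O)
    (hm : m < u x) : closedSuperjet univ (cutExtend O m u) x ⊆ closedSuperjet O u x := by
  rintro a ⟨z, j, h1, h2, h3, h4⟩
  rw [cutExtend_of_mem hx, max_eq_left hm.le] at h3
  obtain ⟨k₀, hk₀⟩ := eventually_atTop.1 (h3.eventually (lt_mem_nhds hm))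
  have key : ∀ y, m < cutExtend O m u y → y ∈ O ∧ cutExtend O m u y = u y := by
    intro y hy
    by_cases h : y ∈ O
    · refine ⟨h, ?_⟩
      rw [cutExtend_of_mem h] at hy ⊢
      rcases le_total (u y) m with h' | h'
      · rw [max_eq_right h'] at hy; exact absurd hy (lt_irrefl _)
      · exact max_eq_left h'
    · simp [cutExtend, h] at hy
  have hk : ∀ k, m < cutExtend O m u (z (k + k₀)) := fun k => hk₀ _ (by omega)
  have ht : Tendsto (fun k => k + k₀) atTop atTop := tendsto_add_atTop_nat k₀
  refine ⟨fun k => z (k + k₀), fun k => j (k + k₀), fun k => ⟨(key _ (hk k)).1, ?_⟩, h2.comp ht, ?_,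
    h4.comp ht⟩
  · refine superjet_of_eventually_le (superjet_mono (subset_univ O) (h1 _).2) ?_ (key _ (hk k)).2.symm
    filter_upwards [self_mem_nhdsWithin] with y hy
    rw [cutExtend_of_mem hy]; exact le_max_left _ _
  · have := h3.comp ht
    refine this.congr fun k => ?_
    exact (key _ (hk k)).2

/-- The theorem on sums, relative to a compact set. -/
theorem theorem_on_sums {O : Set (E N)} (hO : IsCompact O) {u v : E N → ℝ} {α : ℝ}
    (hu : UpperSemicontinuousOn u O) (hv : LowerSemicontinuousOn v O) (hα : 0 < α)
    {x₀ y₀ : E N} (hx₀ : x₀ ∈ O) (hy₀ : y₀ ∈ O)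
    (hM : ∀ x ∈ O, ∀ y ∈ O, u x - v y - α / 2 * ‖x - y‖ ^ 2 ≤
      u x₀ - v y₀ - α / 2 * ‖x₀ - y₀‖ ^ 2) :
    ∃ X Y : Sym N, (α • (x₀ - y₀), X) ∈ closedSuperjet O u x₀ ∧
      (α • (x₀ - y₀), Y) ∈ closedSubjet O v y₀ ∧ BlockBound (2 * α) X Y := by
  have hw : UpperSemicontinuousOn (fun y => -v y) O :=
    continuous_neg.comp_lowerSemicontinuousOn_antitone hv fun _ _ h => neg_le_neg h
  obtain ⟨K₁, hK₁⟩ := hu.bddAbove_of_isCompact hO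
  obtain ⟨K₂, hK₂⟩ := hw.bddAbove_of_isCompact hO
  have hK₁' : ∀ x ∈ O, u x ≤ K₁ := fun x hx => hK₁ ⟨x, hx, rfl⟩
  have hK₂' : ∀ x ∈ O, -v x ≤ K₂ := fun x hx => hK₂ ⟨x, hx, rfl⟩
  set M := u x₀ - v y₀ - α / 2 * ‖x₀ - y₀‖ ^ 2 with hMdef
  set K := max K₁ K₂ with hK
  -- Since `m + K ≤ M`, pairs at which either function is cut cannot beat the maximum; the other two
  -- bounds keep the contact points above the cut.
  set m := min (M - K) (min (u x₀ - 1) (-v y₀ - 1)) with hm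
  have m1 : m ≤ M - K := min_le_left _ _
  have m2 : m < u x₀ := lt_of_le_of_lt ((min_le_right _ _).trans (min_le_left _ _)) (by linarith)
  have m3 : m < -v y₀ := lt_of_le_of_lt ((min_le_right _ _).trans (min_le_right _ _)) (by linarith)
  have k1 : ∀ x ∈ O, u x ≤ K := fun x hx => (hK₁' x hx).trans (le_max_left _ _)
  have k2 : ∀ x ∈ O, -v x ≤ K := fun x hx => (hK₂' x hx).trans (le_max_right _ _)
  have hmK : m ≤ K := m2.le.trans (k1 x₀ hx₀)
  have bound : ∀ {f : E N → ℝ}, (∀ x ∈ O, f x ≤ K) → ∀ x, |cutExtend O m f x| ≤ max |K| |m| := by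
    intro f hf x
    exact abs_le_max_abs_abs (le_cutExtend O m f x) (cutExtend_le hf hmK x) |>.trans
      (le_of_eq (max_comm _ _))
  have e1 : cutExtend O m u x₀ = u x₀ := by rw [cutExtend_of_mem hx₀, max_eq_left m2.le]
  have e2 : cutExtend O m (fun y => -v y) y₀ = -v y₀ := by
    rw [cutExtend_of_mem hy₀, max_eq_left m3.le]
  obtain ⟨X, Y, hX, hY, hXY⟩ := theorem_on_sums_univ (x₀ := x₀) (y₀ := y₀)
    (upperSemicontinuous_cutExtend hO.isClosed (m := m) hu)
    (upperSemicontinuous_cutExtend hO.isClosed (m := m) hw) (bound k1) (bound k2) hα (by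
      intro x y
      rw [e1, e2]
      have hsq : 0 ≤ α / 2 * ‖x - y‖ ^ 2 := by positivity
      have c1 := cutExtend_le k1 hmK x
      have c2 := cutExtend_le k2 hmK y
      have alt : ∀ f : E N → ℝ, ∀ z, cutExtend O m f z = m ∨ z ∈ O ∧ cutExtend O m f z = f z := by
        intro f z
        by_cases h : z ∈ O
        · rw [cutExtend_of_mem h]
          rcases max_choice (f z) m with h' | h'
          · exact .inr ⟨h, h'⟩
          · exact .inl h'
        · exact .inl (by simp [cutExtend, h])
      rcases alt u x with h1 | ⟨h1, h1'⟩
      · rw [h1]; linarith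
      rcases alt (fun y => -v y) y with h2 | ⟨h2, h2'⟩
      · rw [h2]; linarith
      rw [h1', h2']
      have := hM x h1 y h2
      linarith)
  refine ⟨X, -Y, closedSuperjet_cutExtend hx₀ m2 hX, ?_, hXY⟩
  rw [mem_closedSubjet_iff]
  simpa using closedSuperjet_cutExtend (u := fun y => -v y) hy₀ m3 hY

end Viscosity

namespace Viscosity

variable {N : ℕ}

/-! ### Geometry of `C¹` domains -/

section Normal

variable {Ω : Set (E N)} {x : E N} {ψ : E N → ℝ}

lemma IsC1DefiningFunctionAt.eq_zero (hΩ : IsOpen Ω) (hx : x ∈ frontier Ω)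
    (h : IsC1DefiningFunctionAt Ω x ψ) : ψ x = 0 := by
  obtain ⟨h1, -, h3⟩ := h
  rw [hΩ.frontier_eq] at hx
  refine le_antisymm ?_ (not_lt.1 fun hlt => hx.2 (h3.self_of_nhds.2 hlt))
  by_contra! hpos
  have h4 := h1.continuousAt.eventually (lt_mem_nhds hpos)
  obtain ⟨y, hy, hy1, hy2⟩ := ((mem_closure_iff_frequently.1 hx.1).and_eventually (h4.and h3)).exists
  exact absurd (hy2.1 hy) (not_lt.2 hy1.le)

lemma IsC1DefiningFunctionAt.tendsto_slope (hΩ : IsOpen Ω) (hx : x ∈ frontier Ω)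
    (h : IsC1DefiningFunctionAt Ω x ψ) (d : E N) :
    Tendsto (fun t : ℝ => t⁻¹ * ψ (x + t • d)) (𝓝[>] 0) (𝓝 (inner ℝ (gradient ψ x) d)) := by
  have hd : HasFDerivAt ψ (innerSL ℝ (gradient ψ x)) x :=
    (h.1.differentiableAt one_ne_zero).hasGradientAt.hasFDerivAt
  have hc : HasDerivAt (fun t : ℝ => x + t • d) d 0 := by
    simpa using ((hasDerivAt_id (0 : ℝ)).smul_const d).const_add x
  have hcomp : HasDerivAt (fun t : ℝ => ψ (x + t • d)) (inner ℝ (gradient ψ x) d) 0 := by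
    have hd' : HasFDerivAt ψ (innerSL ℝ (gradient ψ x)) (x + (0 : ℝ) • d) := by simpa using hd
    exact hd'.comp_hasDerivAt 0 hc
  have := hasDerivAt_iff_tendsto_slope_zero.1 hcomp
  simp only [zero_add, zero_smul, add_zero, h.eq_zero hΩ hx, sub_zero, smul_eq_mul] at this
  exact this.mono_left (nhdsWithin_mono 0 fun t ht => ne_of_gt ht)

lemma IsC1DefiningFunctionAt.eventually_mem (hΩ : IsOpen Ω) (hx : x ∈ frontier Ω)
    (h : IsC1DefiningFunctionAt Ω x ψ) {d : E N} (hd : inner ℝ (gradient ψ x) d < 0) :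
    ∀ᶠ t : ℝ in 𝓝[>] 0, x + t • d ∈ Ω := by
  have hc : Tendsto (fun t : ℝ => x + t • d) (𝓝[>] 0) (𝓝 x) := by
    have : Continuous fun t : ℝ => x + t • d := by fun_prop
    simpa using (this.tendsto 0).mono_left nhdsWithin_le_nhds
  filter_upwards [(h.tendsto_slope hΩ hx d).eventually (gt_mem_nhds hd), hc.eventually h.2.2,
    self_mem_nhdsWithin] with t h1 h2 ht
  rw [mem_Ioi] at ht
  refine h2.2 ?_
  have : 0 < t⁻¹ := by positivity
  by_contra! hcon
  exact absurd h1 (not_lt.2 (by positivity))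

/-- If the unit normals `a'` and `b'` differed, the direction `b' - a'` would point strictly into
`Ω` according to one defining function and strictly out of it according to the other. This makes the
choice in `outwardNormal` harmless. -/
lemma IsC1DefiningFunctionAt.normal_unique {ψ' : E N → ℝ} (hΩ : IsOpen Ω) (hx : x ∈ frontier Ω)
    (h : IsC1DefiningFunctionAt Ω x ψ) (h' : IsC1DefiningFunctionAt Ω x ψ') :
    (‖gradient ψ x‖)⁻¹ • gradient ψ x = (‖gradient ψ' x‖)⁻¹ • gradient ψ' x := by
  set a := gradient ψ x with ha
  set b := gradient ψ' x with hb
  have ha0 : 0 < ‖a‖ := norm_pos_iff.2 h.2.1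
  have hb0 : 0 < ‖b‖ := norm_pos_iff.2 h'.2.1
  have key : ∀ d, inner ℝ a d < 0 → inner ℝ b d ≤ 0 := by
    intro d hd
    have hc : Tendsto (fun t : ℝ => x + t • d) (𝓝[>] 0) (𝓝 x) := by
      have : Continuous fun t : ℝ => x + t • d := by fun_prop
      simpa using (this.tendsto 0).mono_left nhdsWithin_le_nhds
    refine le_of_tendsto (h'.tendsto_slope hΩ hx d) ?_
    filter_upwards [h.eventually_mem hΩ hx hd, hc.eventually h'.2.2, self_mem_nhdsWithin]
      with t h1 h2 ht
    rw [mem_Ioi] at ht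
    exact mul_nonpos_of_nonneg_of_nonpos (by positivity) (h2.1 h1).le
  set a' := ‖a‖⁻¹ • a with ha'
  set b' := ‖b‖⁻¹ • b with hb'
  have na : ‖a'‖ = 1 := by rw [ha', norm_smul, norm_inv, norm_norm, inv_mul_cancel₀ ha0.ne']
  have nb : ‖b'‖ = 1 := by rw [hb', norm_smul, norm_inv, norm_norm, inv_mul_cancel₀ hb0.ne']
  by_contra hne
  have hlt : inner ℝ a' b' < 1 := by
    have h1 : 0 < ‖a' - b'‖ ^ 2 := by
      have := norm_pos_iff.2 (sub_ne_zero.2 hne); positivity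
    rw [norm_sub_sq_real, na, nb] at h1
    linarith
  have h1 : inner ℝ a (b' - a') < 0 := by
    have e : a = ‖a‖ • a' := by rw [ha', smul_smul, mul_inv_cancel₀ ha0.ne', one_smul]
    rw [e, inner_smul_left, inner_sub_right, real_inner_self_eq_norm_sq, na]
    simp only [conj_trivial]
    nlinarith
  have h2 := key _ h1
  have e : b = ‖b‖ • b' := by rw [hb', smul_smul, mul_inv_cancel₀ hb0.ne', one_smul]
  rw [e, inner_smul_left, inner_sub_right, real_inner_self_eq_norm_sq, nb, real_inner_comm] at h2
  simp only [conj_trivial] at h2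
  nlinarith

lemma IsC1DefiningFunctionAt.outwardNormal_eq (hΩ : IsOpen Ω) (hx : x ∈ frontier Ω)
    (h : IsC1DefiningFunctionAt Ω x ψ) :
    outwardNormal Ω x = (‖gradient ψ x‖)⁻¹ • gradient ψ x := by
  have hex : ∃ ν, IsOutwardUnitNormal Ω x ν := ⟨_, ψ, h, rfl⟩
  obtain ⟨ψ', h', he⟩ : IsOutwardUnitNormal Ω x (outwardNormal Ω x) := Classical.epsilon_spec hex
  rw [he]
  exact h'.normal_unique hΩ hx h

lemma IsC1DefiningFunctionAt.continuousAt_gradient (h : IsC1DefiningFunctionAt Ω x ψ) :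
    ContinuousAt (gradient ψ) x := by
  have h1 : ContinuousAt (fderiv ℝ ψ) x := h.1.continuousAt_fderiv one_ne_zero
  exact (InnerProductSpace.toDual ℝ (E N)).symm.continuous.continuousAt.comp h1

lemma IsC1DefiningFunctionAt.eventually (h : IsC1DefiningFunctionAt Ω x ψ) :
    ∀ᶠ y in 𝓝 x, IsC1DefiningFunctionAt Ω y ψ := by
  filter_upwards [h.1.eventually (by simp), h.continuousAt_gradient.eventually_ne h.2.1,
    eventually_eventually_nhds.2 h.2.2] with y h1 h2 h3
  exact ⟨h1, h2, h3⟩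

end Normal

namespace IsCompactC1Domain

variable {Ω : Set (E N)} (hΩ : IsCompactC1Domain Ω)
include hΩ

lemma isCompact_frontier : IsCompact (frontier Ω) :=
  hΩ.2.1.of_isClosed_subset isClosed_frontier frontier_subset_closure

lemma norm_outwardNormal {x : E N} (hx : x ∈ frontier Ω) : ‖outwardNormal Ω x‖ = 1 := by
  obtain ⟨ψ, h⟩ := hΩ.2.2 x hx
  rw [h.outwardNormal_eq hΩ.1 hx, norm_smul, norm_inv, norm_norm,
    inv_mul_cancel₀ (norm_ne_zero_iff.2 h.2.1)]

lemma eventually_sub_smul_normal_mem {x : E N} (hx : x ∈ frontier Ω) :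
    ∀ᶠ t : ℝ in 𝓝[>] 0, x + t • (-outwardNormal Ω x) ∈ closure Ω := by
  obtain ⟨ψ, h⟩ := hΩ.2.2 x hx
  have hpos : 0 < ‖gradient ψ x‖ := norm_pos_iff.2 h.2.1
  refine (h.eventually_mem hΩ.1 hx ?_).mono fun t ht => subset_closure ht
  rw [h.outwardNormal_eq hΩ.1 hx, inner_neg_right, inner_smul_right, real_inner_self_eq_norm_sq]
  have : 0 < ‖gradient ψ x‖⁻¹ * ‖gradient ψ x‖ ^ 2 := by positivity
  linarith

lemma continuousOn_outwardNormal : ContinuousOn (outwardNormal Ω) (frontier Ω) := by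
  intro x hx
  obtain ⟨ψ, h⟩ := hΩ.2.2 x hx
  have hc : ContinuousAt (fun y => (‖gradient ψ y‖)⁻¹ • gradient ψ y) x :=
    (h.continuousAt_gradient.norm.inv₀ (norm_ne_zero_iff.2 h.2.1)).smul h.continuousAt_gradient
  refine hc.continuousWithinAt.congr_of_eventuallyEq ?_ (h.outwardNormal_eq hΩ.1 hx)
  filter_upwards [self_mem_nhdsWithin, mem_nhdsWithin_of_mem_nhds h.eventually] with y hy hy'
  exact hy'.outwardNormal_eq hΩ.1 hy

/-- At a boundary point, superjets have smaller normal slope than any lower expansion. -/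
lemma inner_normal_le_of_mem_jets {w : E N → ℝ} {x : E N} {a b : E N × Sym N}
    (hx : x ∈ frontier Ω) (ha : a ∈ superjet (closure Ω) w x) (hb : b ∈ subjet (closure Ω) w x) :
    inner ℝ (outwardNormal Ω x) a.1 ≤ inner ℝ (outwardNormal Ω x) b.1 := by
  have := inner_le_of_mem_jets ha hb (hΩ.eventually_sub_smul_normal_mem hx)
  simp only [inner_neg_right] at this
  rw [real_inner_comm, real_inner_comm b.1]
  linarith

omit hΩ in
-- Expand `|y - x - ρn|² ≥ ρ²`. Applied to the penalty slope, it bounds `α⟨n(x), y - x⟩` by `α|x -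
-- y|²/(2ρ)`.
lemma inner_normal_sub_le {ρ : ℝ} (hρ : 0 < ρ) {x y : E N} 
    (hn : ‖outwardNormal Ω x‖ = 1)
    (hs : Metric.closedBall (x + ρ • outwardNormal Ω x) ρ ∩ Ω = ∅) (hy : y ∈ closure Ω) :
    2 * ρ * inner ℝ (outwardNormal Ω x) (y - x) ≤ ‖y - x‖ ^ 2 := by
  have h1 : closure Ω ⊆ {z | ρ ≤ ‖z - x - ρ • outwardNormal Ω x‖} := by
    refine closure_minimal (fun z hz => ?_) (isClosed_le continuous_const (by fun_prop))
    by_contra hcon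
    rw [mem_ofPred_eq, not_le] at hcon
    have : z ∈ Metric.closedBall (x + ρ • outwardNormal Ω x) ρ ∩ Ω := by
      refine ⟨?_, hz⟩
      rw [Metric.mem_closedBall, dist_eq_norm, ← sub_sub]
      exact hcon.le
    rw [hs] at this
    exact this
  have h2 : ρ ≤ ‖y - x - ρ • outwardNormal Ω x‖ := h1 hy
  have h3 : ρ ^ 2 ≤ ‖y - x - ρ • outwardNormal Ω x‖ ^ 2 := by gcongr
  rw [norm_sub_sq_real, norm_smul, hn, inner_smul_right, Real.norm_of_nonneg hρ.le,
    real_inner_comm] at h3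
  linarith

end IsCompactC1Domain

end Viscosity

namespace Viscosity

variable {N : ℕ}

/-! ### A smooth function with large normal derivative -/

namespace IsCompactC1Domain

variable {Ω : Set (E N)}

/-- A bump times the defining function: since `ψ` vanishes on the boundary, the derivative of the
bump does not contribute, and the normal derivative is `χ |∇ψ| ≥ 0`. -/
lemma exists_local_normal_function (hΩ : IsCompactC1Domain Ω) {x : E N} (hx : x ∈ frontier Ω) :
    ∃ Ψ : E N → ℝ, ContDiff ℝ 1 Ψ ∧ HasCompactSupport Ψ ∧
      (∀ y ∈ frontier Ω, 0 ≤ fderiv ℝ Ψ y (outwardNormal Ω y)) ∧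
      0 < fderiv ℝ Ψ x (outwardNormal Ω x) := by
  obtain ⟨ψ, h⟩ := hΩ.2.2 x hx
  obtain ⟨r, hr, hball⟩ := Metric.eventually_nhds_iff_ball.1 h.eventually
  set χ : ContDiffBump x := ⟨r / 4, r / 2, by positivity, by linarith⟩ with hχ
  have htsupp : tsupport χ = Metric.closedBall x (r / 2) := χ.tsupport_eq
  have hzero : ∀ y ∉ Metric.ball x r, ∀ᶠ z in 𝓝 y, (χ z * ψ z) = 0 := by
    intro y hy
    have : y ∉ tsupport χ := by
      rw [htsupp]; intro hy'
      exact hy (Metric.closedBall_subset_ball (by linarith) hy')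
    filter_upwards [notMem_tsupport_iff_eventuallyEq.1 this] with z hz
    simp only [Pi.zero_apply] at hz
    rw [hz, zero_mul]
  have hder : ∀ y ∈ frontier Ω, y ∈ Metric.ball x r →
      fderiv ℝ (fun z => χ z * ψ z) y (outwardNormal Ω y) = χ y * ‖gradient ψ y‖ := by
    intro y hy hyr
    have hψ := hball y hyr
    have h1 : DifferentiableAt ℝ ψ y := hψ.1.differentiableAt one_ne_zero
    have h2 : DifferentiableAt ℝ χ y := (χ.contDiff (n := 1)).differentiable one_ne_zero y
    rw [fderiv_fun_mul h2 h1, hψ.eq_zero hΩ.1 hy, hψ.outwardNormal_eq hΩ.1 hy]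
    have h3 : fderiv ℝ ψ y = innerSL ℝ (gradient ψ y) := h1.hasGradientAt.hasFDerivAt.fderiv
    rw [h3]
    have : ‖gradient ψ y‖ ≠ 0 := norm_ne_zero_iff.2 hψ.2.1
    simp
    field_simp
  refine ⟨fun z => χ z * ψ z, contDiff_iff_contDiffAt.2 fun y => ?_, ?_, fun y hy => ?_, ?_⟩
  · by_cases hy : y ∈ Metric.ball x r
    · exact (χ.contDiff.contDiffAt).mul (hball y hy).1
    · exact (contDiffAt_const (c := (0 : ℝ))).congr_of_eventuallyEq (hzero y hy)
  · exact χ.hasCompactSupport.mul_right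
  · by_cases hyr : y ∈ Metric.ball x r
    · rw [hder y hy hyr]; exact mul_nonneg χ.nonneg (norm_nonneg _)
    · have : (fun z => χ z * ψ z) =ᶠ[𝓝 y] fun _ => 0 := hzero y hyr
      rw [this.fderiv_eq]; simp
  · rw [hder x hx (Metric.mem_ball_self hr)]
    have : χ x = 1 := χ.one_of_mem_closedBall (Metric.mem_closedBall_self (by simp [hχ]; linarith))
    rw [this, one_mul]
    exact norm_pos_iff.2 h.2.1

/-- Local functions are added over a finite cover; their nonnegative normal derivatives on the
entire boundary prevent cancellation. The repeated membership in `key` is the form produced by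
induction over subsets of the compact frontier. -/
lemma exists_normal_function (hΩ : IsCompactC1Domain Ω) :
    ∃ Ψ : E N → ℝ, ContDiff ℝ 1 Ψ ∧ HasCompactSupport Ψ ∧
      ∀ y ∈ frontier Ω, 0 < fderiv ℝ Ψ y (outwardNormal Ω y) := by
  have key : ∃ Ψ : E N → ℝ, ContDiff ℝ 1 Ψ ∧ HasCompactSupport Ψ ∧
      (∀ y ∈ frontier Ω, 0 ≤ fderiv ℝ Ψ y (outwardNormal Ω y)) ∧
      ∀ y ∈ frontier Ω, y ∈ frontier Ω → 0 < fderiv ℝ Ψ y (outwardNormal Ω y) := by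
    refine hΩ.isCompact_frontier.induction_on
      (p := fun s => ∃ Ψ : E N → ℝ, ContDiff ℝ 1 Ψ ∧ HasCompactSupport Ψ ∧
        (∀ y ∈ frontier Ω, 0 ≤ fderiv ℝ Ψ y (outwardNormal Ω y)) ∧
        ∀ y ∈ s, y ∈ frontier Ω → 0 < fderiv ℝ Ψ y (outwardNormal Ω y)) ?_ ?_ ?_ ?_
    · exact ⟨0, contDiff_const, HasCompactSupport.zero, by simp, by simp⟩
    · rintro s t hst ⟨Ψ, h1, h2, h3, h4⟩
      exact ⟨Ψ, h1, h2, h3, fun y hy => h4 y (hst hy)⟩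
    · rintro s t ⟨Ψ, h1, h2, h3, h4⟩ ⟨Ψ', h1', h2', h3', h4'⟩
      have hsum : ∀ y, fderiv ℝ (Ψ + Ψ') y = fderiv ℝ Ψ y + fderiv ℝ Ψ' y := fun y =>
        fderiv_add (h1.differentiable one_ne_zero y) (h1'.differentiable one_ne_zero y)
      refine ⟨Ψ + Ψ', h1.add h1', h2.add h2', fun y hy => ?_, ?_⟩
      · rw [hsum]; exact add_nonneg (h3 y hy) (h3' y hy)
      · rintro y (hy | hy) hyf
        · rw [hsum]; exact add_pos_of_pos_of_nonneg (h4 y hy hyf) (h3' y hyf)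
        · rw [hsum]; exact add_pos_of_nonneg_of_pos (h3 y hyf) (h4' y hy hyf)
    · intro x hx
      obtain ⟨Ψ, h1, h2, h3, h4⟩ := hΩ.exists_local_normal_function hx
      have hc : ContinuousOn (fun y => fderiv ℝ Ψ y (outwardNormal Ω y)) (frontier Ω) :=
        (h1.continuous_fderiv one_ne_zero).continuousOn.clm_apply hΩ.continuousOn_outwardNormal
      refine ⟨{y | 0 < fderiv ℝ Ψ y (outwardNormal Ω y)}, (hc x hx).eventually (lt_mem_nhds h4), Ψ,
        h1, h2, h3, fun y hy _ => hy⟩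
  obtain ⟨Ψ, h1, h2, -, h4⟩ := key
  exact ⟨Ψ, h1, h2, fun y hy => h4 y hy hy⟩

open MeasureTheory in
/-- `C¹`-approximation of a compactly supported `C¹` function by a smooth one. -/
lemma _root_.Viscosity.exists_smooth_fderiv_approx {Ψ : E N → ℝ} (h : ContDiff ℝ 1 Ψ)
    (hc : HasCompactSupport Ψ) {ε : ℝ} (hε : 0 < ε) :
    ∃ Φ : E N → ℝ, ContDiff ℝ 3 Φ ∧ ∀ x, ‖fderiv ℝ Φ x - fderiv ℝ Ψ x‖ ≤ ε := by
  have hcd : Continuous (fderiv ℝ Ψ) := h.continuous_fderiv one_ne_zero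
  have huc : UniformContinuous (fderiv ℝ Ψ) := 
    (hc.fderiv ℝ).uniformContinuous_of_continuous hcd
  obtain ⟨δ, hδ, hdist⟩ := Metric.uniformContinuous_iff.1 huc ε hε
  set χ : ContDiffBump (0 : E N) := ⟨δ / 2, δ, by positivity, by linarith⟩ with hχ
  have hli : LocallyIntegrable (χ.normed volume) volume :=
    χ.continuous_normed.locallyIntegrable
  refine ⟨convolution (χ.normed volume) Ψ (ContinuousLinearMap.lsmul ℝ ℝ) volume, ?_, fun x => ?_⟩
  · exact χ.hasCompactSupport_normed.contDiff_convolution_left (n := 3) _ χ.contDiff_normed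
      h.continuous.locallyIntegrable
  -- The derivative falls on `Ψ`, so `fderiv ℝ Φ` is the mollification of a uniformly continuous
  -- map.
  · have hd := hc.hasFDerivAt_convolution_right (ContinuousLinearMap.lsmul ℝ ℝ) hli h x
    rw [hd.fderiv, ← dist_eq_norm]
    have hprec : (ContinuousLinearMap.lsmul ℝ ℝ : ℝ →L[ℝ] ℝ →L[ℝ] ℝ).precompR (E N) =
        ContinuousLinearMap.lsmul ℝ ℝ := by
      ext a L; simp
    rw [hprec]
    refine χ.dist_normed_convolution_le hcd.aestronglyMeasurable fun y hy => ?_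
    exact (hdist (by simpa [hχ] using hy)).le

open scoped Manifold in
/-- A `C³` function supported near the boundary whose normal derivative is at least one there. -/
lemma exists_smooth_normal_function (hΩ : IsCompactC1Domain Ω) {U : Set (E N)} (hU : IsOpen U)
    (hUΩ : frontier Ω ⊆ U) :
    ∃ φ : E N → ℝ, ContDiff ℝ 3 φ ∧ (∀ x ∉ U, ∀ᶠ y in 𝓝 x, φ y = 0) ∧
      ∀ y ∈ frontier Ω, 1 ≤ fderiv ℝ φ y (outwardNormal Ω y) := by
  obtain ⟨Ψ, h1, h2, h3⟩ := hΩ.exists_normal_function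
  have hc : ContinuousOn (fun y => fderiv ℝ Ψ y (outwardNormal Ω y)) (frontier Ω) :=
    (h1.continuous_fderiv one_ne_zero).continuousOn.clm_apply hΩ.continuousOn_outwardNormal
  obtain ⟨c, hc0, hcle⟩ := hΩ.isCompact_frontier.exists_forall_le' hc h3
  -- An error `c / 2` leaves normal derivative at least `c / 2`, which the factor `2 / c` normalizes
  -- to `1`.
  obtain ⟨Φ, hΦ, hΦd⟩ := exists_smooth_fderiv_approx h1 h2 (half_pos hc0)
  obtain ⟨χ, hχ0, hχ1, -⟩ := exists_contMDiffMap_zero_one_nhds_of_isClosed (n := 3) 𝓘(ℝ, E N)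
    hU.isClosed_compl isClosed_frontier (disjoint_left.2 fun x hx hx' => hx (hUΩ hx'))
  have hχs : ContDiff ℝ 3 χ := contMDiff_iff_contDiff.1 χ.contMDiff
  refine ⟨fun y => (2 / c) * (χ y * Φ y), contDiff_const.mul (hχs.mul hΦ), fun x hx => ?_,
    fun y hy => ?_⟩
  · filter_upwards [(eventually_nhdsSet_iff_forall.1 hχ0) x hx] with y hy
    rw [hy]; simp
  · have he : (fun y => (2 / c) * (χ y * Φ y)) =ᶠ[𝓝 y] fun y => (2 / c) * Φ y := by
      filter_upwards [(eventually_nhdsSet_iff_forall.1 hχ1) y hy] with z hz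
      rw [hz, one_mul]
    rw [he.fderiv_eq, fderiv_const_mul (hΦ.differentiable (by norm_num) y)]
    have k1 := hcle y hy
    have k2 := (fderiv ℝ Φ y - fderiv ℝ Ψ y).le_opNorm (outwardNormal Ω y)
    rw [hΩ.norm_outwardNormal hy, mul_one, Real.norm_eq_abs] at k2
    have k3 := (abs_le.1 (k2.trans (hΦd y))).1
    rw [sub_apply] at k3
    rw [smul_apply, smul_eq_mul]
    have k4 : c / 2 ≤ fderiv ℝ Φ y (outwardNormal Ω y) := by linarith
    calc (1 : ℝ) = 2 / c * (c / 2) := by field_simp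
      _ ≤ _ := by gcongr

/-- The barrier function together with its continuous field of second-order jets. -/
lemma exists_barrier (hΩ : IsCompactC1Domain Ω) {U : Set (E N)} (hU : IsOpen U)
    (hUΩ : frontier Ω ⊆ U) :
    ∃ (φ : E N → ℝ) (J : E N → E N × Sym N), Continuous φ ∧ Continuous J ∧
      (∀ x, HasExpansionAt φ (J x) x) ∧ (∀ x ∉ U, J x = 0) ∧
      ∀ y ∈ frontier Ω, 1 ≤ inner ℝ (outwardNormal Ω y) (J y).1 := by
  obtain ⟨φ, h1, h2, h3⟩ := hΩ.exists_smooth_normal_function hU hUΩ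
  have hdiff : Differentiable ℝ φ := h1.differentiable (by norm_num)
  have hg : ∀ x, HasGradientAt φ (gradient φ x) x := fun x => (hdiff x).hasGradientAt
  have hP : ContDiff ℝ 2 (gradient φ) :=
    (InnerProductSpace.toDual ℝ (E N)).symm.contDiff.comp (h1.fderiv_right (by norm_num))
  have hPd : Differentiable ℝ (gradient φ) := hP.differentiable (by norm_num)
  have hsa : ∀ x, IsSelfAdjoint (fderiv ℝ (gradient φ) x) := fun x =>
    isSelfAdjoint_of_hasFDerivAt_gradient (.of_forall hg) (hPd x).hasFDerivAt
  refine ⟨φ, fun x => (gradient φ x, ⟨fderiv ℝ (gradient φ) x, hsa x⟩), h1.continuous,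
    hP.continuous.prodMk ((hP.continuous_fderiv (by norm_num)).subtype_mk _), fun x => ?_,
    fun x hx => ?_, fun y hy => ?_⟩
  · exact hasExpansionAt_of_hasFDerivAt_gradient (.of_forall hg) (hPd x).hasFDerivAt
  · have e0 : ∀ᶠ y in 𝓝 x, gradient φ y = 0 := by
      filter_upwards [eventually_eventually_nhds.2 (h2 x hx)] with y hy
      have : φ =ᶠ[𝓝 y] fun _ => 0 := hy
      rw [gradient, this.fderiv_eq]; simp
    have e1 : fderiv ℝ (gradient φ) x = 0 := by
      have : gradient φ =ᶠ[𝓝 x] fun _ => 0 := e0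
      rw [this.fderiv_eq]; simp
    refine Prod.ext e0.self_of_nhds (Subtype.ext ?_)
    exact e1
  · have := h3 y hy
    have e : fderiv ℝ φ y = innerSL ℝ (gradient φ y) := (hg y).hasFDerivAt.fderiv
    rw [e, innerSL_apply_apply, real_inner_comm] at this
    exact this

end IsCompactC1Domain

end Viscosity

namespace Viscosity

variable {N : ℕ}

/-! ### The standing hypotheses -/

instance : ContinuousSMul ℝ (Sym N) :=
  ⟨(continuous_fst.smul (continuous_subtype_val.comp continuous_snd)).subtype_mk _⟩

instance : ContinuousConstSMul ℝ (Sym N) :=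
  ⟨fun c => (continuous_subtype_val.const_smul c).subtype_mk _⟩

lemma Sym.norm_smul (c : ℝ) (X : Sym N) : ‖c • X‖ = |c| * ‖X‖ :=
  _root_.norm_smul c (X : E N →L[ℝ] E N)

lemma Sym.norm_neg (X : Sym N) : ‖-X‖ = ‖X‖ := _root_.norm_neg (X : E N →L[ℝ] E N)

lemma Sym.eq_of_norm_sub_le {X Y : Sym N} (h : ‖X - Y‖ ≤ 0) : X = Y :=
  Subtype.ext (sub_eq_zero.1 (norm_le_zero_iff.1 (h : ‖(X : E N →L[ℝ] E N) - Y‖ ≤ 0)))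

lemma Sym.smul_zero (c : ℝ) : c • (0 : Sym N) = 0 :=
  Subtype.ext (_root_.smul_zero (A := E N →L[ℝ] E N) c)

lemma Sym.norm_nonneg (X : Sym N) : 0 ≤ ‖X‖ := _root_.norm_nonneg (X : E N →L[ℝ] E N)

/-- The hypotheses on the domain and on the data of the boundary value problem. -/
structure Admissible (Ω : Set (E N)) (F : E N → ℝ → E N → Sym N → ℝ) (f : E N → ℝ → ℝ)
    (γ : ℝ) (ω : ℝ → ℝ≥0∞) (U : Set (E N)) : Prop where
  dom : IsCompactC1Domain Ω
  sphere : UniformExteriorSphere Ω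
  cont : ContinuousOn (fun z : E N × ℝ × E N × Sym N => F z.1 z.2.1 z.2.2.1 z.2.2.2)
    (closure Ω ×ˢ Set.univ)
  proper : IsProper (closure Ω) F
  pos : 0 < γ
  strictMono : ∀ x ∈ closure Ω, ∀ (r s : ℝ) (p : E N) (X : Sym N),
    s ≤ r → γ * (r - s) ≤ F x r p X - F x s p X
  modulus : Tendsto ω (𝓝[>] 0) (𝓝 0)
  isOpen_nhd : IsOpen U
  frontier_subset : frontier Ω ⊆ U
  unif : ∀ x ∈ U ∩ closure Ω, ∀ (r : ℝ) (p q : E N) (X Y : Sym N),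
    ENNReal.ofReal |F x r p X - F x r q Y| ≤ ω (‖p - q‖ + ‖X - Y‖)
  struct : ∀ α : ℝ, 0 < α → ∀ x ∈ closure Ω, ∀ y ∈ closure Ω,
    ∀ (r : ℝ) (p : E N) (X Y : Sym N), BlockBound α X Y →
    ENNReal.ofReal (F y r p Y - F x r p X) ≤ ω (α * ‖x - y‖ ^ 2 + ‖x - y‖ * (‖p‖ + 1))
  bdry_cont : ContinuousOn (fun z : E N × ℝ => f z.1 z.2) (frontier Ω ×ˢ Set.univ)
  bdry_mono : ∀ x ∈ frontier Ω, Monotone (f x)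

/-- The operator satisfied by `-u` when `u` satisfies `F`. -/
noncomputable def reflectOp (F : E N → ℝ → E N → Sym N → ℝ) : E N → ℝ → E N → Sym N → ℝ :=
  fun x r p X => -F x (-r) (-p) (-X)

/-- The boundary nonlinearity satisfied by `-u` when `u` satisfies `f`. -/
noncomputable def reflectBdry (f : E N → ℝ → ℝ) : E N → ℝ → ℝ := fun x r => -f x (-r)

lemma neumannB_reflect (Ω : Set (E N)) (f : E N → ℝ → ℝ) (x : E N) (r : ℝ) (p : E N) (X : Sym N) :
    neumannB Ω (reflectBdry f) x r p X = -neumannB Ω f x (-r) (-p) (-X) := by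
  simp [neumannB, reflectBdry]; ring

lemma isSubsolution_reflect {Ω : Set (E N)} {F : E N → ℝ → E N → Sym N → ℝ} {f : E N → ℝ → ℝ}
    {v : E N → ℝ} (hv : IsSupersolution Ω F (neumannB Ω f) v) :
    IsSubsolution Ω (reflectOp F) (neumannB Ω (reflectBdry f)) (fun x => -v x) := by
  obtain ⟨h1, h2, h3⟩ := hv
  refine ⟨continuous_neg.comp_lowerSemicontinuousOn_antitone h1 fun _ _ h => neg_le_neg h,
    fun x hx q hq => ?_, fun x hx q hq => ?_⟩
  · have := h2 x hx (-q) (mem_closedSubjet_iff.2 (by simpa using hq))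
    simpa [reflectOp] using this
  · have := h3 x hx (-q) (mem_closedSubjet_iff.2 (by simpa using hq))
    rw [neumannB_reflect]
    simp only [reflectOp, neg_neg]
    rw [min_neg_neg]
    simpa using this

lemma isSupersolution_reflect {Ω : Set (E N)} {F : E N → ℝ → E N → Sym N → ℝ} {f : E N → ℝ → ℝ}
    {u : E N → ℝ} (hu : IsSubsolution Ω (reflectOp F) (neumannB Ω (reflectBdry f)) u) :
    IsSupersolution Ω F (neumannB Ω f) (fun x => -u x) := by
  obtain ⟨h1, h2, h3⟩ := hu
  refine ⟨continuous_neg.comp_upperSemicontinuousOn_antitone h1 fun _ _ h => neg_le_neg h,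
    fun x hx q hq => ?_, fun x hx q hq => ?_⟩
  · have := h2 x hx (-q) (by simpa using mem_closedSubjet_iff.1 hq)
    simpa [reflectOp] using this
  · have := h3 x hx (-q) (by simpa using mem_closedSubjet_iff.1 hq)
    rw [neumannB_reflect] at this
    simp only [reflectOp, Prod.fst_neg, Prod.snd_neg, neg_neg] at this
    rw [min_neg_neg] at this
    simpa using this

lemma ofReal_le_imp {a ε : ℝ} {b : ℝ≥0∞} (hε : 0 ≤ ε) (h : ENNReal.ofReal a ≤ b)
    (hb : b ≤ ENNReal.ofReal ε) : a ≤ ε :=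
  (ENNReal.ofReal_le_ofReal_iff hε).1 (h.trans hb)

namespace Admissible

variable {Ω : Set (E N)} {F : E N → ℝ → E N → Sym N → ℝ} {f : E N → ℝ → ℝ}
  {γ : ℝ} {ω : ℝ → ℝ≥0∞} {U : Set (E N)}

/-- The hypotheses are invariant under `u ↦ -u`, with `X` and `Y` exchanging roles in the block
bound. Each statement about subsolutions thus yields one about supersolutions. -/
lemma reflect (H : Admissible Ω F f γ ω U) :
    Admissible Ω (reflectOp F) (reflectBdry f) γ ω U where
  dom := H.dom
  sphere := H.sphere
  cont := by
    have : ContinuousOn (fun z : E N × ℝ × E N × Sym N => (z.1, -z.2.1, -z.2.2.1, -z.2.2.2))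
      (closure Ω ×ˢ Set.univ) := by fun_prop
    exact (H.cont.comp this fun z hz => ⟨hz.1, mem_univ _⟩).neg
  proper := by
    intro x hx r s p X Y hrs hXY
    refine neg_le_neg (H.proper x hx _ _ _ _ _ (neg_le_neg hrs) fun ξ => ?_)
    simpa using hXY ξ
  pos := H.pos
  strictMono := by
    intro x hx r s p X hsr
    have := H.strictMono x hx (-s) (-r) (-p) (-X) (neg_le_neg hsr)
    simp only [reflectOp]
    linarith
  modulus := H.modulus
  isOpen_nhd := H.isOpen_nhd
  frontier_subset := H.frontier_subset
  unif := by
    intro x hx r p q X Y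
    have := H.unif x hx (-r) (-q) (-p) (-Y) (-X)
    have e1 : -q - -p = p - q := by abel
    have e2 : -Y - -X = X - Y := by abel
    rw [e1, e2] at this
    have e3 : reflectOp F x r p X - reflectOp F x r q Y = 
      F x (-r) (-q) (-Y) - F x (-r) (-p) (-X) := by simp only [reflectOp]; ring
    rw [e3]; exact this
  struct := by
    intro α hα x hx y hy r p X Y h
    have hb : BlockBound α (-Y) (-X) := by
      intro ξ η
      have := h η ξ
      rw [norm_sub_rev] at this
      simp only [quad_neg]
      constructor <;> linarith [this.1, this.2]
    have := H.struct α hα y hy x hx (-r) (-p) (-Y) (-X) hb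
    rw [norm_sub_rev, norm_neg] at this
    have e3 : reflectOp F y r p Y - reflectOp F x r p X =
      F x (-r) (-p) (-X) - F y (-r) (-p) (-Y) := by simp only [reflectOp]; ring
    rw [e3]; exact this
  bdry_cont := by
    have : ContinuousOn (fun z : E N × ℝ => (z.1, -z.2)) (frontier Ω ×ˢ Set.univ) := by fun_prop
    exact (H.bdry_cont.comp this fun z hz => ⟨hz.1, mem_univ _⟩).neg
  bdry_mono := fun x hx r s hrs => neg_le_neg (H.bdry_mono x hx (neg_le_neg hrs))

lemma exists_modulus_le (H : Admissible Ω F f γ ω U) {ε : ℝ} (hε : 0 < ε) :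
    ∃ t₀ > 0, ∀ t, 0 < t → t < t₀ → ω t ≤ ENNReal.ofReal ε := by
  have h1 := H.modulus.eventually (Iic_mem_nhds (by simpa using hε : (0 : ℝ≥0∞) < ENNReal.ofReal ε))
  obtain ⟨t₀, ht₀, h⟩ := mem_nhdsGT_iff_exists_Ioo_subset.1 h1
  exact ⟨t₀, ht₀, fun t h1 h2 => h ⟨h1, h2⟩⟩

lemma abs_sub_le (H : Admissible Ω F f γ ω U) {ε : ℝ} (hε : 0 < ε) :
    ∃ t₀ > 0, ∀ x ∈ U ∩ closure Ω, ∀ (r : ℝ) (p q : E N) (X Y : Sym N),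
      ‖p - q‖ + ‖X - Y‖ < t₀ → |F x r p X - F x r q Y| ≤ ε := by
  obtain ⟨t₀, ht₀, h⟩ := H.exists_modulus_le hε
  refine ⟨t₀, ht₀, fun x hx r p q X Y hlt => ?_⟩
  have hp := norm_nonneg (p - q)
  have hX := Sym.norm_nonneg (X - Y)
  -- The limit of `ω` at `0` from the right says nothing about `ω 0`, so a zero argument is treated
  -- separately.
  rcases (add_nonneg hp hX).eq_or_lt with h' | h'
  · have h1 : p = q := sub_eq_zero.1 (norm_eq_zero.1 (by linarith))
    have h2 : X = Y := Sym.eq_of_norm_sub_le (by linarith)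
    rw [h1, h2, sub_self, abs_zero]; exact hε.le
  · exact ofReal_le_imp hε.le (H.unif x hx r p q X Y) (h _ h' hlt)

lemma sub_le_of_blockBound (H : Admissible Ω F f γ ω U) {ε : ℝ} (hε : 0 < ε) :
    ∃ t₀ > 0, ∀ α : ℝ, 0 < α → ∀ x ∈ closure Ω, ∀ y ∈ closure Ω,
      ∀ (r : ℝ) (p : E N) (X Y : Sym N), BlockBound α X Y →
      α * ‖x - y‖ ^ 2 + ‖x - y‖ * (‖p‖ + 1) < t₀ → F y r p Y - F x r p X ≤ ε := by
  obtain ⟨t₀, ht₀, h⟩ := H.exists_modulus_le hε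
  refine ⟨t₀, ht₀, fun α hα x hx y hy r p X Y hb hlt => ?_⟩
  -- For `x = y` the argument of `ω` is zero; the block bound on the diagonal gives `X ≤ Y`, and
  -- properness suffices.
  rcases eq_or_ne x y with rfl | hne
  · have : SymLE X Y := fun ξ => by
      have := (hb ξ ξ).2
      simp at this
      linarith
    have := H.proper x hx r r p Y X le_rfl this
    linarith
  · have hpos : 0 < ‖x - y‖ := norm_pos_iff.2 (sub_ne_zero.2 hne)
    exact ofReal_le_imp hε.le (H.struct α hα x hx y hy r p X Y hb) (h _ (by positivity) hlt)

lemma notMem_frontier (H : Admissible Ω F f γ ω U) {x : E N} (hx : x ∈ Ω) : x ∉ frontier Ω := by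
  rw [H.dom.1.frontier_eq]; exact fun h => h.2 hx

lemma mem_or_mem_frontier (H : Admissible Ω F f γ ω U) {x : E N} (hx : x ∈ closure Ω) :
    x ∈ Ω ∨ x ∈ frontier Ω := by
  rw [H.dom.1.frontier_eq]
  by_cases h : x ∈ Ω
  · exact .inl h
  · exact .inr ⟨hx, h⟩

/-! ### Strict subsolutions -/

/-- Every subsolution can be perturbed to one that is strict at the boundary. -/
lemma exists_strict (H : Admissible Ω F f γ ω U) {u : E N → ℝ}
    (hu : IsSubsolution Ω F (neumannB Ω f) u) {C : ℝ} (hC : 0 < C) :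
    ∃ (u' : E N → ℝ) (δ : ℝ), 0 < δ ∧ UpperSemicontinuousOn u' (closure Ω) ∧
      (∀ x ∈ closure Ω, u x - C ≤ u' x) ∧
      ∀ x ∈ closure Ω, ∀ q ∈ closedSuperjet (closure Ω) u' x, F x (u' x) q.1 q.2 ≤ 0 ∨
        (x ∈ frontier Ω ∧ neumannB Ω f x (u' x) q.1 q.2 ≤ -δ) := by
  obtain ⟨φ, J, hφ, hJ, hexp, hJ0, hn⟩ := H.dom.exists_barrier H.isOpen_nhd H.frontier_subset
  obtain ⟨K₁, hK₁⟩ := H.dom.2.1.exists_bound_of_continuousOn hφ.continuousOn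
  obtain ⟨K₂, hK₂⟩ := H.dom.2.1.exists_bound_of_continuousOn hJ.continuousOn
  obtain ⟨t₀, ht₀, hF⟩ := H.abs_sub_le (ε := γ * (C / 4)) (mul_pos H.pos (by positivity))
  set K := |K₁| + |K₂| + 1 with hK
  have hKpos : 0 < K := by positivity
  -- Small enough that `δφ` is at most `C / 4` and that its jet changes `F` by at most `γC/4` near
  -- the boundary.
  set δ := min (t₀ / (4 * K)) (C / (4 * K)) with hδ
  have hδ0 : 0 < δ := by positivity
  have hδ1 : δ * K ≤ t₀ / 4 := by
    have : δ * K ≤ t₀ / (4 * K) * K := by gcongr; exact min_le_left _ _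
    refine this.trans (le_of_eq ?_); field_simp
  have hδ2 : δ * K ≤ C / 4 := by
    have : δ * K ≤ C / (4 * K) * K := by gcongr; exact min_le_right _ _
    refine this.trans (le_of_eq ?_); field_simp
  have hφK : ∀ x ∈ closure Ω, |δ * φ x| ≤ C / 4 := by
    intro x hx
    rw [abs_mul, abs_of_pos hδ0]
    refine le_trans ?_ hδ2
    gcongr
    have := (hK₁ x hx).trans (le_abs_self K₁)
    rw [Real.norm_eq_abs] at this
    linarith [abs_nonneg K₂]
  have hJK : ∀ x ∈ closure Ω, ‖δ • (J x).1‖ + ‖δ • (J x).2‖ < t₀ := by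
    intro x hx
    rw [norm_smul, Sym.norm_smul, Real.norm_of_nonneg hδ0.le, abs_of_pos hδ0, ← mul_add]
    have h1 := (norm_fst_le (J x)).trans ((hK₂ x hx).trans (le_abs_self K₂))
    have h2 := (norm_snd_le (J x)).trans ((hK₂ x hx).trans (le_abs_self K₂))
    have : δ * (‖(J x).1‖ + ‖(J x).2‖) ≤ δ * (2 * K) := by
      gcongr
      linarith [abs_nonneg K₁]
    linarith
  -- Since `θ ≥ C / 4`, lowering `u` by `θ` decreases `F` by at least `γC/4`, which pays for the
  -- change of jet; the normal derivative of `δφ` supplies the strictness `δ` in `B`.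
  set θ : E N → ℝ := fun x => δ * φ x + C / 2 with hθ
  have hθc : Continuous θ := by fun_prop
  refine ⟨fun x => u x - θ x, δ, hδ0, ?_, fun x hx => ?_, fun x hx q hq => ?_⟩
  · simpa only [sub_eq_add_neg] using
      hu.1.add (f := u) (g := fun x => -θ x) hθc.neg.continuousOn.upperSemicontinuousOn
  · have := (abs_le.1 (hφK x hx)).2
    simp only [hθ]; linarith
  · have hq' := closedSuperjet_add (θ := θ) (J := fun y => δ • J y) hq (fun y _ => by
      have := (((hexp y).const_smul δ).add (hasExpansionAt_const (C / 2) y)).mem_superjet (closure Ω)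
      rwa [add_zero] at this) hθc.continuousAt (hJ.const_smul δ).continuousAt
    simp only [sub_add_cancel] at hq'
    have hb := abs_le.1 (hφK x hx)
    have hθ0 : C / 4 ≤ θ x := by simp only [hθ]; linarith
    have hdiff : F x (u x) q.1 q.2 - F x (u x) (q.1 + δ • (J x).1) (q.2 + δ • (J x).2) ≤
        γ * (C / 4) := by
      by_cases hxU : x ∈ U
      · refine (le_abs_self _).trans (hF x ⟨hxU, hx⟩ _ _ _ _ _ ?_)
        have := hJK x hx
        rwa [sub_add_cancel_left, sub_add_cancel_left, norm_neg, Sym.norm_neg]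
      -- Away from the boundary uniform continuity of `F` is not available, but there the jet of `φ`
      -- vanishes.
      · rw [hJ0 x hxU]
        rw [Prod.fst_zero, Prod.snd_zero, smul_zero, Sym.smul_zero, add_zero, add_zero, sub_self]
        have := H.pos; positivity
    have hF1 : F x (u x) (q.1 + δ • (J x).1) (q.2 + δ • (J x).2) ≤ 0 →
        F x (u x - θ x) q.1 q.2 ≤ 0 := by
      intro h0
      have h1 := H.strictMono x hx (u x) (u x - θ x) q.1 q.2 (by linarith)
      have h2 : γ * (C / 4) ≤ γ * (u x - (u x - θ x)) := by
        have := H.pos; gcongr; linarith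
      linarith
    rcases H.mem_or_mem_frontier hx with hxi | hxb
    · exact .inl (hF1 (hu.2.1 x hxi _ hq'))
    · rcases min_le_iff.1 (hu.2.2 x hxb _ hq') with h0 | h0
      · exact .inl (hF1 h0)
      · refine .inr ⟨hxb, ?_⟩
        simp only [neumannB, Prod.fst_add, Prod.smul_fst, inner_add_right, inner_smul_right] at h0 ⊢
        have h1 := H.bdry_mono x hxb (by linarith : u x - θ x ≤ u x)
        have h2 : δ * 1 ≤ δ * inner ℝ (outwardNormal Ω x) (J x).1 := by gcongr; exact hn x hxb
        linarith

end Admissible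

end Viscosity

namespace Viscosity

variable {N : ℕ}

/-! ### Doubling of variables -/

lemma exists_max_doubled {O : Set (E N)} (hO : IsCompact O) (hne : O.Nonempty) {u v : E N → ℝ}
    (hu : UpperSemicontinuousOn u O) (hv : LowerSemicontinuousOn v O) (α : ℝ) :
    ∃ x ∈ O, ∃ y ∈ O, ∀ x' ∈ O, ∀ y' ∈ O,
      u x' - v y' - α / 2 * ‖x' - y'‖ ^ 2 ≤ u x - v y - α / 2 * ‖x - y‖ ^ 2 := by
  have hw : UpperSemicontinuousOn (fun y => -v y) O :=
    continuous_neg.comp_lowerSemicontinuousOn_antitone hv fun _ _ h => neg_le_neg h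
  have h1 : UpperSemicontinuousOn (fun z : E N × E N => u z.1) (O ×ˢ O) :=
    UpperSemicontinuousOn.comp hu continuousOn_fst fun z hz => hz.1
  have h2 : UpperSemicontinuousOn (fun z : E N × E N => -v z.2) (O ×ˢ O) :=
    UpperSemicontinuousOn.comp (f := fun y => -v y) hw continuousOn_snd fun z hz => hz.2
  have h3 : UpperSemicontinuousOn (fun z : E N × E N => -(α / 2 * ‖z.1 - z.2‖ ^ 2)) (O ×ˢ O) :=
    ContinuousOn.upperSemicontinuousOn (by fun_prop)
  obtain ⟨⟨x, y⟩, hz, hmax⟩ := UpperSemicontinuousOn.exists_isMaxOn (hne.prod hne) (hO.prod hO)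
    ((h1.add h2).add h3)
  refine ⟨x, hz.1, y, hz.2, fun x' hx' y' hy' => ?_⟩
  have := hmax (show (x', y') ∈ O ×ˢ O from ⟨hx', hy'⟩)
  simp only [mem_ofPred_eq] at this
  linarith

/-- Testing the maximum on the diagonal bounds the penalty, so the two sequences share a limit `z`
along a subsequence. Semicontinuity of `u` and `v` then squeezes the values and sends the penalty to
zero. -/
lemma exists_penalized_sequence {O : Set (E N)} (hO : IsCompact O) (hne : O.Nonempty)
    {u v : E N → ℝ} (hu : UpperSemicontinuousOn u O) (hv : LowerSemicontinuousOn v O) :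
    ∃ (α : ℕ → ℝ) (x y : ℕ → E N) (z : E N), z ∈ O ∧ (∀ w ∈ O, u w - v w ≤ u z - v z) ∧
      (∀ k, 0 < α k) ∧ (∀ k, x k ∈ O) ∧ (∀ k, y k ∈ O) ∧
      (∀ k, ∀ x' ∈ O, ∀ y' ∈ O, u x' - v y' - α k / 2 * ‖x' - y'‖ ^ 2 ≤
        u (x k) - v (y k) - α k / 2 * ‖x k - y k‖ ^ 2) ∧
      Tendsto x atTop (𝓝 z) ∧ Tendsto y atTop (𝓝 z) ∧
      Tendsto (fun k => u (x k)) atTop (𝓝 (u z)) ∧ Tendsto (fun k => v (y k)) atTop (𝓝 (v z)) ∧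
      Tendsto (fun k => α k * ‖x k - y k‖ ^ 2) atTop (𝓝 0) := by
  have hw : UpperSemicontinuousOn (fun y => -v y) O :=
    continuous_neg.comp_lowerSemicontinuousOn_antitone hv fun _ _ h => neg_le_neg h
  obtain ⟨K₁, hK₁⟩ := hu.bddAbove_of_isCompact hO
  obtain ⟨K₂, hK₂⟩ := hw.bddAbove_of_isCompact hO
  have hK₁' : ∀ x ∈ O, u x ≤ K₁ := fun x hx => hK₁ ⟨x, hx, rfl⟩
  have hK₂' : ∀ x ∈ O, -v x ≤ K₂ := fun x hx => hK₂ ⟨x, hx, rfl⟩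
  choose x hx y hy hmax using fun k : ℕ => exists_max_doubled hO hne hu hv ((k : ℝ) + 1)
  obtain ⟨⟨z, z'⟩, hz, φ, hφ, hlim⟩ := (hO.prod hO).tendsto_subseq (x := fun k => (x k, y k))
    fun k => ⟨hx k, hy k⟩
  have tx : Tendsto (fun k => x (φ k)) atTop (𝓝 z) := (continuous_fst.tendsto _).comp hlim
  have ty : Tendsto (fun k => y (φ k)) atTop (𝓝 z') := (continuous_snd.tendsto _).comp hlim
  set α : ℕ → ℝ := fun k => (φ k : ℝ) + 1 with hα
  have hα0 : ∀ k, 0 < α k := fun k => by simp only [hα]; positivity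
  have hαt : Tendsto α atTop atTop :=
    tendsto_atTop_add_const_right _ _ (tendsto_natCast_atTop_atTop.comp hφ.tendsto_atTop)
  have diag : ∀ w ∈ O, ∀ k, u w - v w ≤ u (x (φ k)) - v (y (φ k))
      - α k / 2 * ‖x (φ k) - y (φ k)‖ ^ 2 := by
    intro w hw k
    have := hmax (φ k) w hw w hw
    simpa using this
  obtain ⟨w₀, hw₀⟩ := hne
  have hzz : z = z' := by
    have h1 : Tendsto (fun k => ‖x (φ k) - y (φ k)‖ ^ 2) atTop (𝓝 (‖z - z'‖ ^ 2)) :=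
      ((tx.sub ty).norm).pow 2
    have h2 : Tendsto (fun k => 2 * (K₁ + K₂ - (u w₀ - v w₀)) * (α k)⁻¹) atTop
        (𝓝 (2 * (K₁ + K₂ - (u w₀ - v w₀)) * 0)) :=
      (tendsto_inv_atTop_zero.comp hαt).const_mul _
    have h3 := le_of_tendsto_of_tendsto' h1 h2 fun k => by
      have a1 := diag w₀ hw₀ k
      have a2 := hK₁' _ (hx (φ k))
      have a3 := hK₂' _ (hy (φ k))
      rw [← div_eq_mul_inv, le_div_iff₀ (hα0 k)]
      linarith
    rw [mul_zero] at h3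
    have h4 : ‖z - z'‖ = 0 := by
      have : 0 ≤ ‖z - z'‖ := norm_nonneg _
      nlinarith
    exact sub_eq_zero.1 (norm_eq_zero.1 h4)
  subst hzz
  have eu : ∀ ε > 0, ∀ᶠ k in atTop, u (x (φ k)) < u z + ε := fun ε hε => by
    have t : Tendsto (fun k => x (φ k)) atTop (𝓝[O] z) :=
      tendsto_nhdsWithin_iff.2 ⟨tx, .of_forall fun k => hx _⟩
    exact t.eventually (hu z hz.1 _ (by linarith))
  have ev : ∀ ε > 0, ∀ᶠ k in atTop, v z - ε < v (y (φ k)) := fun ε hε => by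
    have t : Tendsto (fun k => y (φ k)) atTop (𝓝[O] z) :=
      tendsto_nhdsWithin_iff.2 ⟨ty, .of_forall fun k => hy _⟩
    exact t.eventually (hv z hz.1 _ (by linarith))
  have nn : ∀ k, 0 ≤ α k / 2 * ‖x (φ k) - y (φ k)‖ ^ 2 := fun k => by
    have := hα0 k; positivity
  refine ⟨α, fun k => x (φ k), fun k => y (φ k), z, hz.1, fun w hw => ?_, hα0, fun k => hx _,
    fun k => hy _, fun k => hmax (φ k), tx, ty, ?_, ?_, ?_⟩
  · refine le_of_forall_pos_le_add fun ε hε => ?_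
    obtain ⟨k, h1, h2⟩ := ((eu (ε / 2) (by positivity)).and (ev (ε / 2) (by positivity))).exists
    have := diag w hw k
    have := nn k
    linarith
  · rw [Metric.tendsto_nhds]
    intro ε hε
    filter_upwards [eu ε hε, ev ε hε] with k h1 h2
    have := diag z hz.1 k
    have := nn k
    rw [Real.dist_eq, abs_lt]
    constructor <;> linarith
  · rw [Metric.tendsto_nhds]
    intro ε hε
    filter_upwards [eu ε hε, ev ε hε] with k h1 h2
    have := diag z hz.1 k
    have := nn k
    rw [Real.dist_eq, abs_lt]
    constructor <;> linarith
  · rw [Metric.tendsto_nhds]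
    intro ε hε
    filter_upwards [eu (ε / 4) (by positivity), ev (ε / 4) (by positivity)] with k h1 h2
    have h3 := diag z hz.1 k
    have h4 := nn k
    rw [Real.dist_eq, sub_zero, abs_lt]
    constructor <;> linarith

/-- Second-order upper expansion of `κ |x - z|⁴ - ⟨g, x⟩`. -/
lemma quartic_mem_superjet {O : Set (E N)} {κ : ℝ} (hκ : 0 ≤ κ) (g z x : E N) :
    ((-g + (4 * κ * ‖x - z‖ ^ 2) • (x - z), (12 * κ * ‖x - z‖ ^ 2) • (1 : Sym N)) : E N × Sym N) ∈
      superjet O (fun y => -inner ℝ g y + κ * ‖y - z‖ ^ 4) x := by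
  intro ε hε
  set a := x - z with ha
  have ht : Tendsto (fun y => κ * (4 * ‖a‖ * ‖y - x‖ + ‖y - x‖ ^ 2)) (𝓝 x) (𝓝 0) := by
    have : Continuous fun y : E N => κ * (4 * ‖a‖ * ‖y - x‖ + ‖y - x‖ ^ 2) := by fun_prop
    simpa using this.tendsto x
  filter_upwards [mem_nhdsWithin_of_mem_nhds (ht.eventually (gt_mem_nhds hε))] with y hy
  set h := y - x with hh
  have e : y - z = a + h := by rw [ha, hh]; abel
  have e2 : y = x + h := by rw [hh]; abel
  rw [e]
  have hpow : ‖a + h‖ ^ 4 = (‖a‖ ^ 2 + 2 * inner ℝ a h + ‖h‖ ^ 2) ^ 2 := by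
    rw [← norm_add_sq_real]; ring
  rw [hpow]
  have hin : inner ℝ a h ≤ ‖a‖ * ‖h‖ := real_inner_le_norm a h
  have hin2 : inner ℝ a h ^ 2 ≤ ‖a‖ ^ 2 * ‖h‖ ^ 2 := by
    have := abs_real_inner_le_norm a h
    calc inner ℝ a h ^ 2 = |inner ℝ a h| ^ 2 := (sq_abs _).symm
      _ ≤ (‖a‖ * ‖h‖) ^ 2 := by gcongr
      _ = _ := by ring
  simp only [inner_add_left, inner_neg_left, inner_smul_left, quad_smul, quad_one, conj_trivial]
  have hgy : inner ℝ g y = inner ℝ g x + inner ℝ g h := by rw [← inner_add_right, ← e2]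
  rw [hgy]
  have k1 : κ * (4 * (inner ℝ a h) * ‖h‖ ^ 2 + ‖h‖ ^ 2 * ‖h‖ ^ 2) ≤ ε * ‖h‖ ^ 2 := by
    calc κ * (4 * (inner ℝ a h) * ‖h‖ ^ 2 + ‖h‖ ^ 2 * ‖h‖ ^ 2)
        ≤ κ * (4 * (‖a‖ * ‖h‖) * ‖h‖ ^ 2 + ‖h‖ ^ 2 * ‖h‖ ^ 2) := by gcongr
      _ = (κ * (4 * ‖a‖ * ‖h‖ + ‖h‖ ^ 2)) * ‖h‖ ^ 2 := by ring
      _ ≤ ε * ‖h‖ ^ 2 := by gcongr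
  -- The Hessian `4κ|a|² I + 8κ a ⊗ a` is bounded above by `12κ|a|² I`.
  have k2 : κ * (inner ℝ a h ^ 2) ≤ κ * (‖a‖ ^ 2 * ‖h‖ ^ 2) := by gcongr
  nlinarith

namespace Admissible

variable {Ω : Set (E N)} {F : E N → ℝ → E N → Sym N → ℝ} {f : E N → ℝ → ℝ}
  {γ : ℝ} {ω : ℝ → ℝ≥0∞} {U : Set (E N)}

lemma continuousOn_bdry_sub (H : Admissible Ω F f γ ω U) (g : E N) :
    ContinuousOn (fun w : E N × ℝ => f w.1 w.2 - inner ℝ (outwardNormal Ω w.1) g)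
      (frontier Ω ×ˢ univ) := by
  have h1 : ContinuousOn (fun w : E N × ℝ => outwardNormal Ω w.1) (frontier Ω ×ˢ univ) :=
    H.dom.continuousOn_outwardNormal.comp continuousOn_fst fun w hw => hw.1
  have h2 : ContinuousOn (fun w : E N × ℝ => inner ℝ (outwardNormal Ω w.1) g)
      (frontier Ω ×ˢ univ) := h1.inner continuousOn_const
  exact H.bdry_cont.sub h2

lemma mul_inner_normal_sub_le (H : Admissible Ω F f γ ω U) {ρ α : ℝ} (hρ : 0 < ρ) (hα : 0 < α)
    {x y : E N} (hx : x ∈ frontier Ω)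
    (hs : Metric.closedBall (x + ρ • outwardNormal Ω x) ρ ∩ Ω = ∅) (hy : y ∈ closure Ω) :
    α * (inner ℝ (outwardNormal Ω x) y - inner ℝ (outwardNormal Ω x) x) ≤
      α * ‖x - y‖ ^ 2 / (2 * ρ) := by
  have h := IsCompactC1Domain.inner_normal_sub_le hρ (H.dom.norm_outwardNormal hx) hs hy
  rw [← inner_sub_right, le_div_iff₀ (by positivity), norm_sub_rev]
  have := mul_le_mul_of_nonneg_left h hα.le
  linarith

set_option maxHeartbeats 1000000 in
/-- The doubling argument once the penalization has been chosen. -/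
lemma comparison_aux (H : Admissible Ω F f γ ω U) {u v : E N → ℝ} {δ : ℝ} (hδ : 0 < δ)
    (hu : UpperSemicontinuousOn u (closure Ω)) (hv : LowerSemicontinuousOn v (closure Ω))
    (hus : ∀ x ∈ closure Ω, ∀ q ∈ closedSuperjet (closure Ω) u x, F x (u x) q.1 q.2 ≤ 0 ∨
      (x ∈ frontier Ω ∧ neumannB Ω f x (u x) q.1 q.2 ≤ -δ))
    (hvs : ∀ x ∈ closure Ω, ∀ q ∈ closedSubjet (closure Ω) v x, 0 ≤ F x (v x) q.1 q.2 ∨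
      (x ∈ frontier Ω ∧ δ ≤ neumannB Ω f x (v x) q.1 q.2))
    {g z₀ : E N} {κ : ℝ} (hκ : 0 ≤ κ)
    (hpos : ∀ z ∈ closure Ω, (∀ w ∈ closure Ω,
        u w - v w - κ * ‖w - z₀‖ ^ 4 ≤ u z - v z - κ * ‖z - z₀‖ ^ 4) →
      v z < u z ∧ ((z ∈ Ω ∧ κ = 0) ∨
        (z ∈ frontier Ω ∧ z = z₀ ∧ g = f z (u z) • outwardNormal Ω z))) : closure Ω = ∅ := by
  by_contra hemp
  have hne : (closure Ω).Nonempty := nonempty_iff_ne_empty.2 hemp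
  have hO := H.dom.2.1
  obtain ⟨ρ, hρ, hsph⟩ := H.sphere
  -- The doubled functional gains `⟨g, x - y⟩ - κ|x - z₀|⁴`. The tilt vanishes on the diagonal, so
  -- it leaves the limiting maximum points unchanged while shifting the slopes by `-g`.
  set θ : E N → ℝ := fun y => -inner ℝ g y + κ * ‖y - z₀‖ ^ 4 with hθ
  have hθc : Continuous θ := by fun_prop
  set u₁ : E N → ℝ := fun x => u x + -θ x with hu₁
  set v₁ : E N → ℝ := fun y => v y + inner ℝ g y with hv₁
  have hu₁s : UpperSemicontinuousOn u₁ (closure Ω) :=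
    hu.add hθc.neg.continuousOn.upperSemicontinuousOn
  have hv₁s : LowerSemicontinuousOn v₁ (closure Ω) :=
    hv.add (ContinuousOn.lowerSemicontinuousOn (by fun_prop))
  obtain ⟨α, x, y, z, hz, hzmax, hα, hx, hy, hmax, tx, ty, tu₁, tv₁, ts⟩ :=
    exists_penalized_sequence hO hne hu₁s hv₁s
  obtain ⟨hlt, hcase⟩ := hpos z hz fun w hw => by
    have := hzmax w hw
    simp only [hu₁, hv₁, hθ] at this
    linarith
  have tu : Tendsto (fun k => u (x k)) atTop (𝓝 (u z)) := by
    have := tu₁.add ((hθc.tendsto z).comp tx)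
    simpa [hu₁] using this
  have tv : Tendsto (fun k => v (y k)) atTop (𝓝 (v z)) := by
    have hc : Continuous fun y => inner ℝ g y := by fun_prop
    have := tv₁.sub ((hc.tendsto z).comp ty)
    simpa [hv₁] using this
  choose X Y hX hY hXY using fun k =>
    theorem_on_sums hO hu₁s hv₁s (hα k) (hx k) (hy k) (hmax k)
  set e : ℕ → E N := fun k => (4 * κ * ‖x k - z₀‖ ^ 2) • (x k - z₀) with he
  set A : ℕ → Sym N := fun k => (12 * κ * ‖x k - z₀‖ ^ 2) • (1 : Sym N) with hA
  set q : ℕ → E N := fun k => α k • (x k - y k) - g with hq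
  have hXu : ∀ k, ((q k + e k, X k + A k) : E N × Sym N) ∈ closedSuperjet (closure Ω) u (x k) := by
    intro k
    have := closedSuperjet_add (θ := θ)
      (J := fun x => (-g + (4 * κ * ‖x - z₀‖ ^ 2) • (x - z₀),
        (12 * κ * ‖x - z₀‖ ^ 2) • (1 : Sym N))) (hX k)
      (fun y _ => quartic_mem_superjet hκ g z₀ y) hθc.continuousAt
      (Continuous.continuousAt (by fun_prop))
    have e1 : (fun y => u₁ y + θ y) = u := by funext y; simp [hu₁]
    rw [e1, Prod.mk_add_mk] at this
    have e2 : q k + e k = α k • (x k - y k) +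
        (-g + (4 * κ * ‖x k - z₀‖ ^ 2) • (x k - z₀)) := by
      simp only [hq, he]; abel
    rw [e2]; exact this
  have hYv : ∀ k, ((q k, Y k) : E N × Sym N) ∈ closedSubjet (closure Ω) v (y k) := by
    intro k
    rw [mem_closedSubjet_iff]
    have h1 := mem_closedSubjet_iff.1 (hY k)
    have := closedSuperjet_add (θ := fun y => inner ℝ g y) (J := fun _ => (g, (0 : Sym N))) h1
      (fun y _ => (hasExpansionAt_inner g y).mem_superjet _)
      (Continuous.continuousAt (by fun_prop)) continuousAt_const
    have e1 : (fun y => -v₁ y + inner ℝ g y) = fun y => -v y := by funext y; simp [hv₁]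
    rw [e1, Prod.neg_mk, Prod.mk_add_mk, add_zero] at this
    have e2 : -q k = -(α k • (x k - y k)) + g := by simp only [hq]; abel
    rw [Prod.neg_mk, e2]; exact this
  have te : Tendsto (fun k => ‖e k‖) atTop (𝓝 (‖(4 * κ * ‖z - z₀‖ ^ 2) • (z - z₀)‖)) := by
    have hc : Continuous fun x => ‖(4 * κ * ‖x - z₀‖ ^ 2) • (x - z₀)‖ := by fun_prop
    exact (hc.tendsto z).comp tx
  have tA : Tendsto (fun k => ‖A k‖) atTop (𝓝 (‖(12 * κ * ‖z - z₀‖ ^ 2) • (1 : Sym N)‖)) := by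
    have hc : Continuous fun x => ‖(12 * κ * ‖x - z₀‖ ^ 2) • (1 : Sym N)‖ := by
      simp only [Sym.norm_smul]; fun_prop
    exact (hc.tendsto z).comp tx
  -- Either `κ = 0` or `z = z₀`, so the quartic corrections `e k` and `A k` to the jets tend to
  -- zero.
  have hκz : κ * ‖z - z₀‖ ^ 2 = 0 := by
    rcases hcase with ⟨-, h⟩ | ⟨-, h, -⟩
    · rw [h, zero_mul]
    · rw [h]; simp
  rw [mul_assoc 4, hκz] at te
  rw [mul_assoc 12, hκz, mul_zero, Sym.norm_smul, abs_zero, zero_mul] at tA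
  simp only [mul_zero, zero_smul, norm_zero] at te
  -- the boundary conditions cannot be active
  have hFu : ∀ᶠ k in atTop, F (x k) (u (x k)) (q k + e k) (X k + A k) ≤ 0 := by
    rcases hcase with ⟨hzi, -⟩ | ⟨hzb, -, hg⟩
    · filter_upwards [tx.eventually (H.dom.1.mem_nhds hzi)] with k hk
      exact (hus _ (hx k) _ (hXu k)).resolve_right fun h => H.notMem_frontier hk h.1
    -- Here `B = (f - ⟨n, g⟩) + α⟨n, x - y⟩ + ⟨n, e⟩`. The choice of `g`, the exterior sphere and
    -- the vanishing of `e` make each term eventually greater than `-δ/3`, so `B ≤ -δ` is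
    -- impossible.
    · have hc := H.continuousOn_bdry_sub g
      have h0 : f z (u z) - inner ℝ (outwardNormal Ω z) g = 0 := by
        rw [hg, inner_smul_right, real_inner_self_eq_norm_sq, H.dom.norm_outwardNormal hzb]; simp
      have h1 := hc (z, u z) ⟨hzb, mem_univ _⟩
      have h2 := h1.eventually (lt_mem_nhds (show -(δ / 3) < f z (u z)
        - inner ℝ (outwardNormal Ω z) g by rw [h0]; linarith))
      rw [eventually_nhdsWithin_iff] at h2
      have ts' : Tendsto (fun k => α k * ‖x k - y k‖ ^ 2 / (2 * ρ)) atTop (𝓝 (0 / (2 * ρ))) :=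
        ts.div_const _
      rw [zero_div] at ts'
      filter_upwards [(tx.prodMk_nhds tu).eventually h2,
        ts'.eventually (gt_mem_nhds (show 0 < δ / 3 by positivity)),
        te.eventually (gt_mem_nhds (show 0 < δ / 3 by positivity))] with k k1 k2 k3
      refine (hus _ (hx k) _ (hXu k)).resolve_right ?_
      rintro ⟨hb, hB⟩
      have k4 := k1 ⟨hb, mem_univ _⟩
      have hn := H.dom.norm_outwardNormal hb
      have k5 := H.mul_inner_normal_sub_le hρ (hα k) hb (hsph _ hb) (hy k)
      have k6 := (abs_le.1 (abs_real_inner_le_norm (outwardNormal Ω (x k)) (e k))).1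
      rw [hn, one_mul] at k6
      simp only [neumannB, hq, inner_add_right, inner_sub_right, inner_smul_right] at hB
      linarith
  have hFv : ∀ᶠ k in atTop, 0 ≤ F (y k) (v (y k)) (q k) (Y k) := by
    rcases hcase with ⟨hzi, -⟩ | ⟨hzb, -, hg⟩
    · filter_upwards [ty.eventually (H.dom.1.mem_nhds hzi)] with k hk
      exact (hvs _ (hy k) _ (hYv k)).resolve_right fun h => H.notMem_frontier hk h.1
    -- For `v` the first term has nonpositive limit since `f(z, v z) ≤ f(z, u z)`, and there is no
    -- quartic correction.
    · have hc := H.continuousOn_bdry_sub g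
      have h0 : f z (v z) - inner ℝ (outwardNormal Ω z) g ≤ 0 := by
        rw [hg, inner_smul_right, real_inner_self_eq_norm_sq, H.dom.norm_outwardNormal hzb]
        have := H.bdry_mono z hzb hlt.le
        linarith
      have h1 := hc (z, v z) ⟨hzb, mem_univ _⟩
      have h2 := h1.eventually (gt_mem_nhds (show f z (v z)
        - inner ℝ (outwardNormal Ω z) g < δ / 3 by linarith))
      rw [eventually_nhdsWithin_iff] at h2
      have ts' : Tendsto (fun k => α k * ‖x k - y k‖ ^ 2 / (2 * ρ)) atTop (𝓝 (0 / (2 * ρ))) :=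
        ts.div_const _
      rw [zero_div] at ts'
      filter_upwards [(ty.prodMk_nhds tv).eventually h2,
        ts'.eventually (gt_mem_nhds (show 0 < δ / 3 by positivity))] with k k1 k2
      refine (hvs _ (hy k) _ (hYv k)).resolve_right ?_
      rintro ⟨hb, hB⟩
      have k4 := k1 ⟨hb, mem_univ _⟩
      have k5 := H.mul_inner_normal_sub_le hρ (hα k) hb (hsph _ hb) (hx k)
      simp only [neumannB, hq, inner_sub_right, inner_smul_right] at hB
      rw [norm_sub_rev] at k5
      linarith
  -- conclusion
  set M := u z - v z with hM
  have hMpos : 0 < M := by rw [hM]; linarith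
  have hε : 0 < γ * (M / 8) := mul_pos H.pos (by positivity)
  obtain ⟨t₁, ht₁, hunif⟩ := H.abs_sub_le hε
  obtain ⟨t₂, ht₂, hstr⟩ := H.sub_le_of_blockBound hε
  have hpert : ∀ᶠ k in atTop, |F (x k) (u (x k)) (q k) (X k)
      - F (x k) (u (x k)) (q k + e k) (X k + A k)| ≤ γ * (M / 8) := by
    rcases hcase with ⟨-, h0⟩ | ⟨hzb, -, -⟩
    -- At an interior maximum uniform continuity of `F` in the jet may fail; taking `κ = 0` removes
    -- the perturbation altogether.
    · refine .of_forall fun k => ?_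
      have e0 : e k = 0 := by simp [he, h0]
      have A0 : A k = 0 := Sym.eq_of_norm_sub_le (by
        rw [sub_zero]; simp only [hA]; rw [Sym.norm_smul, h0]; simp)
      rw [e0, A0, add_zero, add_zero, sub_self, abs_zero]; exact hε.le
    · have tsum := te.add tA
      rw [add_zero] at tsum
      filter_upwards [tx.eventually (H.isOpen_nhd.mem_nhds (H.frontier_subset hzb)),
        tsum.eventually (gt_mem_nhds ht₁)] with k k1 k2
      refine hunif _ ⟨k1, hx k⟩ _ _ _ _ _ ?_
      rwa [sub_add_cancel_left, sub_add_cancel_left, norm_neg, Sym.norm_neg]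
  have hsmall : ∀ᶠ k in atTop, 2 * α k * ‖x k - y k‖ ^ 2 + ‖x k - y k‖ * (‖q k‖ + 1) < t₂ := by
    have td : Tendsto (fun k => ‖x k - y k‖) atTop (𝓝 0) := by
      have := (tx.sub ty).norm
      simpa using this
    have tb : Tendsto (fun k => 3 * (α k * ‖x k - y k‖ ^ 2) + ‖x k - y k‖ * (‖g‖ + 1)) atTop
        (𝓝 (3 * 0 + 0 * (‖g‖ + 1))) := (ts.const_mul 3).add (td.mul_const _)
    simp only [mul_zero, zero_mul, add_zero] at tb
    filter_upwards [tb.eventually (gt_mem_nhds ht₂)] with k hk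
    refine lt_of_le_of_lt ?_ hk
    have h1 : ‖q k‖ ≤ α k * ‖x k - y k‖ + ‖g‖ := by
      refine (norm_sub_le _ _).trans ?_
      rw [norm_smul, Real.norm_of_nonneg (hα k).le]
    have h2 : ‖x k - y k‖ * ‖q k‖ ≤ ‖x k - y k‖ * (α k * ‖x k - y k‖ + ‖g‖) := by gcongr
    nlinarith
  have tM := tu.sub tv
  have hbig := tM.eventually (lt_mem_nhds (show M / 2 < u z - v z by rw [← hM]; linarith))
  -- At such a `k`, `0 ≤ F(y, v, q, Y) ≤ F(x, v, q, X) + γM/8 ≤ F(x, u, q, X) - γM/2 + γM/8 ≤ γM/8 +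
  -- γM/8 - γM/2 < 0`.
  obtain ⟨k, ⟨⟨⟨h1, h2⟩, h3⟩, h4⟩, h5⟩ :=
    ((((hFu.and hFv).and hpert).and hsmall).and hbig).exists
  have h6 := hstr (2 * α k) (by have := hα k; positivity) _ (hx k) _ (hy k) (v (y k)) (q k) _ _
    (hXY k) h4
  have h7 := H.strictMono _ (hx k) (u (x k)) (v (y k)) (q k) (X k) (by linarith)
  have h8 := (abs_le.1 h3).2
  have h9 : γ * (M / 2) < γ * (u (x k) - v (y k)) := mul_lt_mul_of_pos_left h5 H.pos
  have h10 : 0 < γ * M := mul_pos H.pos hMpos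
  linarith

/-- Comparison for strict sub- and supersolutions. -/
lemma comparison_strict (H : Admissible Ω F f γ ω U) {u v : E N → ℝ} {δ : ℝ} (hδ : 0 < δ)
    (hu : UpperSemicontinuousOn u (closure Ω)) (hv : LowerSemicontinuousOn v (closure Ω))
    (hus : ∀ x ∈ closure Ω, ∀ q ∈ closedSuperjet (closure Ω) u x, F x (u x) q.1 q.2 ≤ 0 ∨
      (x ∈ frontier Ω ∧ neumannB Ω f x (u x) q.1 q.2 ≤ -δ))
    (hvs : ∀ x ∈ closure Ω, ∀ q ∈ closedSubjet (closure Ω) v x, 0 ≤ F x (v x) q.1 q.2 ∨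
      (x ∈ frontier Ω ∧ δ ≤ neumannB Ω f x (v x) q.1 q.2)) :
    ∀ x ∈ closure Ω, u x ≤ v x := by
  intro x₀ hx₀
  by_contra! hlt
  have hne : closure Ω ≠ ∅ := nonempty_iff_ne_empty.1 ⟨x₀, hx₀⟩
  -- If some maximum point lies on the boundary, the quartic makes it the only one, so `g` can be
  -- fixed beforehand; otherwise all of them are interior and no correction is needed.
  by_cases hb : ∃ z ∈ frontier Ω, ∀ w ∈ closure Ω, u w - v w ≤ u z - v z
  · obtain ⟨z₀, hz₀, hmax⟩ := hb
    have hz₀' := frontier_subset_closure hz₀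
    refine hne (H.comparison_aux hδ hu hv hus hvs (g := f z₀ (u z₀) • outwardNormal Ω z₀)
      (z₀ := z₀) zero_le_one fun z hz hzm => ?_)
    have h1 := hzm z₀ hz₀'
    have h2 := hmax z hz
    have h3 := hmax x₀ hx₀
    simp only [sub_self, norm_zero] at h1
    have h4 : z = z₀ := by
      by_contra hne'
      have : 0 < ‖z - z₀‖ := norm_pos_iff.2 (sub_ne_zero.2 hne')
      have : 0 < ‖z - z₀‖ ^ 4 := by positivity
      linarith
    subst h4
    exact ⟨by linarith, .inr ⟨hz₀, rfl, rfl⟩⟩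
  · push Not at hb
    refine hne (H.comparison_aux hδ hu hv hus hvs (g := 0) (z₀ := 0) le_rfl fun z hz hzm => ?_)
    simp only [zero_mul, sub_zero] at hzm
    have h1 := hzm x₀ hx₀
    refine ⟨by linarith, .inl ⟨(H.mem_or_mem_frontier hz).resolve_right fun hzb => ?_, rfl⟩⟩
    obtain ⟨w, hw, hw'⟩ := hb z hzb
    exact absurd (hzm w hw) (not_le.2 hw')

/-- The comparison principle. -/
theorem comparison (H : Admissible Ω F f γ ω U) {u v : E N → ℝ}
    (hu : IsSubsolution Ω F (neumannB Ω f) u) (hv : IsSupersolution Ω F (neumannB Ω f) v) :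
    ∀ x ∈ closure Ω, u x ≤ v x := by
  intro x hx
  refine le_of_forall_pos_le_add fun ε hε => ?_
  obtain ⟨u', δ₁, hδ₁, hu's, hu'le, hu'⟩ := H.exists_strict hu (half_pos hε)
  obtain ⟨w, δ₂, hδ₂, hws, hwle, hw⟩ := H.reflect.exists_strict (isSubsolution_reflect hv)
    (half_pos hε)
  have hcomp := H.comparison_strict (u := u') (v := fun y => -w y) (δ := min δ₁ δ₂)
    (lt_min hδ₁ hδ₂) hu's
    (continuous_neg.comp_upperSemicontinuousOn_antitone hws fun _ _ h => neg_le_neg h)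
    (fun y hy q hq => (hu' y hy q hq).imp_right fun h =>
      ⟨h.1, h.2.trans (neg_le_neg (min_le_left _ _))⟩)
    (fun y hy q hq => by
      have h1 := hw y hy (-q) (by simpa using mem_closedSubjet_iff.1 hq)
      rw [neumannB_reflect] at h1
      simp only [reflectOp, Prod.fst_neg, Prod.snd_neg, neg_neg] at h1
      refine h1.imp (fun h => by linarith) fun h => ⟨h.1, ?_⟩
      have := min_le_right δ₁ δ₂
      linarith [h.2])
  have h1 := hcomp x hx
  have h2 := hu'le x hx
  have h3 := hwle x hx
  linarith

end Admissible

end Viscosity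

namespace Viscosity

variable {N : ℕ}

/-! ### Semicontinuous envelopes -/

/-- The upper semicontinuous envelope of `W` relative to `O`. -/
noncomputable def uscEnv (O : Set (E N)) (W : E N → ℝ) (x : E N) : ℝ :=
  sInf {c | ∀ᶠ y in 𝓝[O] x, W y ≤ c}

section Envelope

variable {O : Set (E N)} {W : E N → ℝ} {K : ℝ}

lemma mem_lowerBounds_uscEnv {x : E N} (hx : x ∈ O) :
    W x ∈ lowerBounds {c | ∀ᶠ y in 𝓝[O] x, W y ≤ c} :=
  fun _ hc => (hc : ∀ᶠ y in 𝓝[O] x, W y ≤ _).self_of_nhdsWithin hx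

lemma uscEnv_le {x : E N} (hx : x ∈ O) {c : ℝ} (hc : ∀ᶠ y in 𝓝[O] x, W y ≤ c) :
    uscEnv O W x ≤ c := csInf_le ⟨_, mem_lowerBounds_uscEnv hx⟩ hc

lemma le_uscEnv (hK : ∀ y ∈ O, W y ≤ K) {x : E N} (hx : x ∈ O) : W x ≤ uscEnv O W x :=
  le_csInf ⟨K, eventually_nhdsWithin_of_forall hK⟩ (mem_lowerBounds_uscEnv hx)

lemma upperSemicontinuousOn_uscEnv (hK : ∀ y ∈ O, W y ≤ K) :
    UpperSemicontinuousOn (uscEnv O W) O := by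
  intro x _ c hc
  obtain ⟨c', hc', hlt⟩ := exists_lt_of_csInf_lt ⟨K, eventually_nhdsWithin_of_forall hK⟩ hc
  have h : ∀ᶠ y in 𝓝[O] x, W y ≤ c' := hc'
  filter_upwards [eventually_eventually_nhdsWithin.2 h, self_mem_nhdsWithin] with y hy hyO
  exact (uscEnv_le hyO hy).trans_lt hlt

lemma frequently_lt_of_lt_uscEnv {x : E N} (hx : x ∈ O) {c : ℝ} (hc : c < uscEnv O W x) :
    ∃ᶠ y in 𝓝[O] x, c < W y := by
  intro h
  refine absurd (uscEnv_le hx (h.mono fun y hy => not_lt.1 hy)) (not_le.2 hc)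

end Envelope

/-! ### Subsolutions through superjets -/

/-- The pointwise subsolution condition on a jet. -/
def SubAt (Ω : Set (E N)) (F B : E N → ℝ → E N → Sym N → ℝ) (x : E N) (r : ℝ) (q : E N × Sym N) :
    Prop :=
  (x ∈ Ω → F x r q.1 q.2 ≤ 0) ∧ (x ∈ frontier Ω → min (F x r q.1 q.2) (B x r q.1 q.2) ≤ 0)

lemma superjet_congr {O : Set (E N)} {u w : E N → ℝ} (h : EqOn u w O) {x : E N} (hx : x ∈ O) :
    superjet O u x = superjet O w x := by
  refine Subset.antisymm (fun a ha => ?_) fun a ha => ?_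
  · exact superjet_of_eventually_le ha (eventually_nhdsWithin_of_forall fun y hy => (h hy).ge)
      (h hx).symm
  · exact superjet_of_eventually_le ha (eventually_nhdsWithin_of_forall fun y hy => (h hy).le) (h hx)

lemma closedSuperjet_subset_of_eqOn {O : Set (E N)} {u w : E N → ℝ} (h : EqOn u w O) {x : E N}
    (hx : x ∈ O) : closedSuperjet O u x ⊆ closedSuperjet O w x := by
  rintro a ⟨z, j, h1, h2, h3, h4⟩
  refine ⟨z, j, fun k => ⟨(h1 k).1, superjet_congr h (h1 k).1 ▸ (h1 k).2⟩, h2, ?_, h4⟩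
  rw [← h hx]
  exact h3.congr fun k => h (h1 k).1

lemma IsSubsolution.congr {Ω : Set (E N)} {F B : E N → ℝ → E N → Sym N → ℝ} {u w : E N → ℝ}
    (hu : IsSubsolution Ω F B u) (h : EqOn u w (closure Ω)) : IsSubsolution Ω F B w := by
  obtain ⟨h1, h2, h3⟩ := hu
  refine ⟨fun x hx => ?_, fun x hx q hq => ?_, fun x hx q hq => ?_⟩
  · intro c hc
    rw [← h hx] at hc
    filter_upwards [h1 x hx c hc, self_mem_nhdsWithin] with y hy hyO
    rwa [← h hyO]
  · have hx' := subset_closure hx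
    rw [← h hx']
    exact h2 x hx q (closedSuperjet_subset_of_eqOn h.symm hx' hq)
  · have hx' := frontier_subset_closure hx
    rw [← h hx']
    exact h3 x hx q (closedSuperjet_subset_of_eqOn h.symm hx' hq)

lemma IsSubsolution.subAt {Ω : Set (E N)} {F B : E N → ℝ → E N → Sym N → ℝ} {u : E N → ℝ}
    (hu : IsSubsolution Ω F B u) {x : E N} (hx : x ∈ closure Ω) {q : E N × Sym N}
    (hq : q ∈ superjet (closure Ω) u x) : SubAt Ω F B x (u x) q :=
  ⟨fun h => hu.2.1 x h q (superjet_subset_closedSuperjet hx hq),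
    fun h => hu.2.2 x h q (superjet_subset_closedSuperjet hx hq)⟩

namespace Admissible

variable {Ω : Set (E N)} {F : E N → ℝ → E N → Sym N → ℝ} {f : E N → ℝ → ℝ}
  {γ : ℝ} {ω : ℝ → ℝ≥0∞} {U : Set (E N)}

lemma continuousOn_neumannB (H : Admissible Ω F f γ ω U) :
    ContinuousOn (fun z : E N × ℝ × E N × Sym N => neumannB Ω f z.1 z.2.1 z.2.2.1 z.2.2.2)
      (frontier Ω ×ˢ univ) := by
  have h1 : ContinuousOn (fun z : E N × ℝ × E N × Sym N => outwardNormal Ω z.1)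
      (frontier Ω ×ˢ univ) :=
    H.dom.continuousOn_outwardNormal.comp continuousOn_fst fun w hw => hw.1
  have h2 : ContinuousOn (fun z : E N × ℝ × E N × Sym N => inner ℝ (outwardNormal Ω z.1) z.2.2.1)
      (frontier Ω ×ˢ univ) := h1.inner (by fun_prop)
  have h3 : ContinuousOn (fun z : E N × ℝ × E N × Sym N => f z.1 z.2.1) (frontier Ω ×ˢ univ) :=
    H.bdry_cont.comp (f := fun z : E N × ℝ × E N × Sym N => (z.1, z.2.1)) (by fun_prop)
      fun w hw => ⟨hw.1, mem_univ _⟩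
  exact h2.add h3

/-- The subsolution condition is closed. -/
lemma subAt_of_tendsto (H : Admissible Ω F f γ ω U) {z : ℕ → E N} {r : ℕ → ℝ}
    {j : ℕ → E N × Sym N} {x : E N} {s : ℝ} {q : E N × Sym N} (hz : ∀ k, z k ∈ closure Ω)
    (h : ∀ k, SubAt Ω F (neumannB Ω f) (z k) (r k) (j k)) (tz : Tendsto z atTop (𝓝 x))
    (tr : Tendsto r atTop (𝓝 s)) (tj : Tendsto j atTop (𝓝 q)) :
    SubAt Ω F (neumannB Ω f) x s q := by
  have hx : x ∈ closure Ω := isClosed_closure.mem_of_tendsto tz (.of_forall hz)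
  have t : Tendsto (fun k => (z k, r k, (j k).1, (j k).2)) atTop (𝓝 (x, s, q.1, q.2)) :=
    tz.prodMk_nhds (tr.prodMk_nhds tj)
  have tF : Tendsto (fun k => F (z k) (r k) (j k).1 (j k).2) atTop (𝓝 (F x s q.1 q.2)) :=
    (H.cont (x, s, q.1, q.2) ⟨hx, mem_univ _⟩).tendsto.comp
      (tendsto_nhdsWithin_iff.2 ⟨t, .of_forall fun k => ⟨hz k, mem_univ _⟩⟩)
  refine ⟨fun hxi => ?_, fun hxb => ?_⟩
  · refine le_of_tendsto tF ?_
    filter_upwards [tz.eventually (H.dom.1.mem_nhds hxi)] with k hk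
    exact (h k).1 hk
  · by_contra! hcon
    obtain ⟨hF, hB⟩ := lt_min_iff.1 hcon
    have h1 := H.continuousOn_neumannB (x, s, q.1, q.2) ⟨hxb, mem_univ _⟩
    have h2 := h1.eventually (lt_mem_nhds hB)
    rw [eventually_nhdsWithin_iff] at h2
    obtain ⟨k, hk1, hk2⟩ := ((tF.eventually (lt_mem_nhds hF)).and (t.eventually h2)).exists
    -- A frontier point may be approached from inside, where only `F ≤ 0` is known; this is why the
    -- boundary condition has to be the minimum of `F` and `B`.
    rcases H.mem_or_mem_frontier (hz k) with hi | hb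
    · exact absurd ((h k).1 hi) (not_le.2 hk1)
    · exact absurd ((h k).2 hb) (not_le.2 (lt_min hk1 (hk2 ⟨hb, mem_univ _⟩)))

/-- The pointwise condition passes to limits, so it need only be tested on superjets before closure.
-/
lemma isSubsolution_of_superjet (H : Admissible Ω F f γ ω U) {u : E N → ℝ}
    (hu : UpperSemicontinuousOn u (closure Ω))
    (h : ∀ x ∈ closure Ω, ∀ q ∈ superjet (closure Ω) u x, SubAt Ω F (neumannB Ω f) x (u x) q) :
    IsSubsolution Ω F (neumannB Ω f) u := by
  have key : ∀ x, ∀ q ∈ closedSuperjet (closure Ω) u x, SubAt Ω F (neumannB Ω f) x (u x) q := by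
    rintro x q ⟨z, j, h1, h2, h3, h4⟩
    exact H.subAt_of_tendsto (fun k => (h1 k).1) (fun k => h _ (h1 k).1 _ (h1 k).2) h2 h3 h4
  exact ⟨hu, fun x hx q hq => (key x q hq).1 hx, fun x hx q hq => (key x q hq).2 hx⟩

/-- Transfers classical inequalities to a function touched from below by a smooth one. Inside, the
slopes agree and the Hessians are ordered, so ellipticity applies. On the boundary only inward
directions are available, but the resulting inequality between normal slopes has the sign that `B`
requires. -/
lemma subAt_of_mem_jets (H : Admissible Ω F f γ ω U) {w : E N → ℝ} {x : E N} {a b : E N × Sym N}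
    (hx : x ∈ closure Ω)
    (ha : a ∈ superjet (closure Ω) w x) (hb : b ∈ subjet (closure Ω) w x)
    (h1 : x ∈ Ω → F x (w x) b.1 b.2 ≤ 0)
    (h2 : x ∈ frontier Ω → neumannB Ω f x (w x) b.1 b.2 ≤ 0) :
    SubAt Ω F (neumannB Ω f) x (w x) a := by
  refine ⟨fun hxi => ?_, fun hxb => ?_⟩
  · have hd : ∀ d : E N, ∀ᶠ t : ℝ in 𝓝[>] 0, x + t • d ∈ closure Ω := by
      intro d
      have hc : Tendsto (fun t : ℝ => x + t • d) (𝓝[>] 0) (𝓝 x) := by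
        have : Continuous fun t : ℝ => x + t • d := by fun_prop
        simpa using (this.tendsto 0).mono_left nhdsWithin_le_nhds
      filter_upwards [hc.eventually (H.dom.1.mem_nhds hxi)] with t ht
      exact subset_closure ht
    have e : b.1 = a.1 := by
      refine ext_inner_right ℝ fun d => ?_
      have k1 := inner_le_of_mem_jets ha hb (hd d)
      have k2 := inner_le_of_mem_jets ha hb (hd (-d))
      simp only [inner_neg_right] at k2
      linarith
    have hle : SymLE b.2 a.2 := fun d => quad_le_of_mem_jets ha hb (hd d) (by rw [e])
    rw [← e]
    exact (H.proper x hx _ _ _ _ _ le_rfl hle).trans (h1 hxi)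
  · refine min_le_iff.2 (.inr ?_)
    have := H.dom.inner_normal_le_of_mem_jets hxb ha hb
    have h3 := h2 hxb
    simp only [neumannB] at h3 ⊢
    linarith

/-! ### Barriers -/

/-- The function `-A'φ - C` works: `A'` bounds `|f(·, 0)|`, so the normal slope handles `B`, and `C`
is large enough for strict monotonicity in `r` to give `F ≤ 0`. -/
lemma exists_continuous_subsolution (H : Admissible Ω F f γ ω U) :
    ∃ u, Continuous u ∧ IsSubsolution Ω F (neumannB Ω f) u := by
  obtain ⟨φ, J, hφ, hJ, hexp, -, hn⟩ := H.dom.exists_barrier H.isOpen_nhd H.frontier_subset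
  have hf0 : ContinuousOn (fun x => f x 0) (frontier Ω) :=
    H.bdry_cont.comp (f := fun x : E N => (x, (0 : ℝ))) (by fun_prop) fun w hw => ⟨hw, mem_univ _⟩
  obtain ⟨A, hA⟩ := H.dom.isCompact_frontier.exists_bound_of_continuousOn hf0
  set A' := |A| with hA'
  obtain ⟨K, hK⟩ := H.dom.2.1.exists_bound_of_continuousOn hφ.continuousOn
  have hF0 : ContinuousOn (fun x => F x 0 ((-A') • J x).1 ((-A') • J x).2) (closure Ω) :=
    H.cont.comp (f := fun x : E N => (x, (0 : ℝ), ((-A') • J x).1, ((-A') • J x).2))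
      (Continuous.continuousOn (by fun_prop)) fun w hw => ⟨hw, mem_univ _⟩
  obtain ⟨K', hK'⟩ := H.dom.2.1.exists_bound_of_continuousOn hF0
  have hγ := H.pos
  set C := A' * |K| + |K'| / γ with hC
  set u : E N → ℝ := fun x => -A' * φ x + -C with hu
  have huc : Continuous u := by fun_prop
  have hule : ∀ x ∈ closure Ω, u x ≤ -(|K'| / γ) := by
    intro x hx
    have h1 := (hK x hx).trans (le_abs_self K)
    rw [Real.norm_eq_abs] at h1
    have h2 : A' * -φ x ≤ A' * |K| := by
      gcongr
      exact (neg_le_abs _).trans h1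
    simp only [hu, hC]
    linarith
  refine ⟨u, huc, H.isSubsolution_of_superjet huc.continuousOn.upperSemicontinuousOn
    fun x hx q hq => ?_⟩
  have hb : HasExpansionAt u ((-A') • J x) x := by
    have := ((hexp x).const_smul (-A')).add (hasExpansionAt_const (-C) x)
    rwa [add_zero] at this
  have hneg : 0 ≤ |K'| / γ := by positivity
  refine H.subAt_of_mem_jets hx hq (hb.mem_subjet _) (fun _ => ?_) fun hxb => ?_
  · have h1 := H.strictMono x hx 0 (u x) ((-A') • J x).1 ((-A') • J x).2
      (by linarith [hule x hx])
    have h2 := (hK' x hx).trans (le_abs_self K')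
    rw [Real.norm_eq_abs] at h2
    have h3 := (le_abs_self _).trans h2
    have h4 : γ * (|K'| / γ) ≤ γ * (0 - u x) := by
      gcongr
      linarith [hule x hx]
    rw [mul_div_cancel₀ _ hγ.ne'] at h4
    linarith
  · have h1 := H.bdry_mono x hxb (show u x ≤ 0 by linarith [hule x hx])
    have h2 := (hA x hxb).trans (le_abs_self A)
    rw [Real.norm_eq_abs] at h2
    have h3 := (le_abs_self _).trans h2
    have h4 : A' * 1 ≤ A' * inner ℝ (outwardNormal Ω x) (J x).1 := by
      gcongr
      exact hn x hxb
    simp only [neumannB, Prod.smul_fst, inner_smul_right]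
    linarith

/-! ### Perron's method -/

/-- Approximation of a superjet of the envelope by superjets of members of the family. -/
lemma exists_subAt_near (H : Admissible Ω F f γ ω U) {S : Set (E N → ℝ)}
    (hS : ∀ w ∈ S, IsSubsolution Ω F (neumannB Ω f) w) {W : E N → ℝ} {K : ℝ}
    (hK : ∀ y ∈ closure Ω, W y ≤ K) (hW : ∀ w ∈ S, ∀ y ∈ closure Ω, w y ≤ W y)
    (hsup : ∀ y ∈ closure Ω, ∀ c < W y, ∃ w ∈ S, c < w y) {x₀ : E N} (hx₀ : x₀ ∈ closure Ω)
    {q : E N × Sym N} (hq : q ∈ superjet (closure Ω) (uscEnv (closure Ω) W) x₀) {η : ℝ}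
    (hη : 0 < η) :
    ∃ x ∈ closure Ω, ∃ r : ℝ, ∃ q' : E N × Sym N, dist x x₀ < η ∧
      dist r (uscEnv (closure Ω) W x₀) < η ∧ dist q' q < η ∧
      SubAt Ω F (neumannB Ω f) x r q' := by
  set O := closure Ω with hO
  set V := uscEnv O W with hV
  set δ : ℝ := η / (8 * (‖(1 : Sym N)‖ + 1)) with hδ
  have n1 : 0 ≤ ‖(1 : Sym N)‖ := Sym.norm_nonneg _
  have hδ0 : 0 < δ := by positivity
  have hδ1 : |4 * δ| * ‖(1 : Sym N)‖ < η := by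
    rw [abs_of_pos (by positivity)]
    have : 8 * δ * (‖(1 : Sym N)‖ + 1) = η := by rw [hδ]; field_simp
    nlinarith
  -- The extra `2δ‖y - x₀‖²` in `T` absorbs the jet error `δ‖y - x₀‖²` and leaves a strict maximum
  -- with margin `δ‖y - x₀‖²`.
  set Z : Sym N := q.2 + (4 * δ) • (1 : Sym N) with hZ
  set T : E N → ℝ := fun y => inner ℝ q.1 (y - x₀) + (1 / 2) * quad Z (y - x₀) with hT
  have hTc : Continuous T := by
    have : Continuous fun y : E N => quad Z (y - x₀) :=
      continuous_quad.comp (continuous_const.prodMk (by fun_prop))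
    fun_prop
  have hT0 : T x₀ = 0 := by simp [hT]
  have hZc : Continuous fun y : E N => (Z : E N →L[ℝ] E N) (y - x₀) := by fun_prop
  obtain ⟨s, hs, hsmall⟩ := Metric.eventually_nhds_iff_ball.1
    (((hTc.tendsto x₀).eventually (Metric.ball_mem_nhds (T x₀) (half_pos hη))).and
      (((hZc.tendsto x₀).eventually (Metric.ball_mem_nhds _ hη)).and
        (Metric.ball_mem_nhds x₀ hη)))
  obtain ⟨s', hs', hjet⟩ := Metric.mem_nhdsWithin_iff.1 (hq δ hδ0)
  set σ := min s s' / 2 with hσ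
  have hσ0 : 0 < σ := by positivity
  have hσs : σ < s := by
    have := min_le_left s s'
    have : 0 < min s s' := lt_min hs hs'
    linarith
  have hσs' : σ < s' := by
    have := min_le_right s s'
    have : 0 < min s s' := lt_min hs hs'
    linarith
  -- The loss is at most `μ` in choosing `w` and at most `μ` in `T y`; since `2μ ≤ δσ²`, the maximum
  -- of `w - T` stays inside the ball.
  set μ := min (η / 4) (δ * σ ^ 2 / 2) with hμ
  have hμ0 : 0 < μ := by positivity
  have hVle : ∀ y ∈ O, y ∈ Metric.closedBall x₀ σ → V y - T y ≤ V x₀ - δ * ‖y - x₀‖ ^ 2 := by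
    intro y hy hyb
    have := hjet ⟨Metric.closedBall_subset_ball hσs' hyb, hy⟩
    simp only [mem_ofPred_eq] at this
    simp only [hT, hZ, quad_add, quad_smul, quad_one]
    linarith
  have hTx : ∀ᶠ y in 𝓝[O] x₀, |T y| < μ ∧ y ∈ Metric.closedBall x₀ σ ∧ y ∈ O := by
    have h1 := (hTc.tendsto x₀).eventually (Metric.ball_mem_nhds (T x₀) hμ0)
    filter_upwards [mem_nhdsWithin_of_mem_nhds h1,
      mem_nhdsWithin_of_mem_nhds (Metric.closedBall_mem_nhds x₀ hσ0), self_mem_nhdsWithin]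
      with y h1 h2 h3
    refine ⟨?_, h2, h3⟩
    simpa [hT0, Real.norm_eq_abs] using h1
  obtain ⟨y, hyW, hyT, hyb, hyO⟩ := ((frequently_lt_of_lt_uscEnv hx₀
    (show V x₀ - μ < V x₀ by linarith)).and_eventually hTx).exists
  obtain ⟨w, hwS, hwy⟩ := hsup y hyO _ hyW
  have hwsub := hS w hwS
  have hcomp : IsCompact (O ∩ Metric.closedBall x₀ σ) := H.dom.2.1.inter_right Metric.isClosed_closedBall
  obtain ⟨x, hx, hxmax⟩ := UpperSemicontinuousOn.exists_isMaxOn (s := O ∩ Metric.closedBall x₀ σ)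
    ⟨y, hyO, hyb⟩ hcomp ((hwsub.1.mono inter_subset_left).add
      (hTc.neg.continuousOn.upperSemicontinuousOn))
  have hxmax' : ∀ z ∈ O, z ∈ Metric.closedBall x₀ σ → w z - T z ≤ w x - T x := by
    intro z hz hzb
    have := hxmax (show z ∈ O ∩ Metric.closedBall x₀ σ from ⟨hz, hzb⟩)
    simp only [mem_ofPred_eq, Pi.neg_apply] at this
    linarith
  have hwV : w x ≤ V x := (hW w hwS x hx.1).trans (le_uscEnv hK hx.1)
  have h1 := hxmax' y hyO hyb
  have h2 := hVle x hx.1 hx.2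
  have h3 := abs_lt.1 hyT
  have hμ1 : μ ≤ η / 4 := min_le_left _ _
  have hμ2 : μ ≤ δ * σ ^ 2 / 2 := min_le_right _ _
  have hxσ : ‖x - x₀‖ < σ := by
    have h4 : δ * ‖x - x₀‖ ^ 2 < δ * σ ^ 2 := by linarith
    exact lt_of_pow_lt_pow_left₀ 2 hσ0.le (lt_of_mul_lt_mul_left h4 hδ0.le)
  have hxs : x ∈ Metric.ball x₀ s := by
    rw [Metric.mem_ball, dist_eq_norm]; linarith
  obtain ⟨hx1, hx2, hx3⟩ := hsmall x hxs
  rw [hT0, dist_zero_right, Real.norm_eq_abs] at hx1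
  have hx1' := abs_lt.1 hx1
  have hsq : 0 ≤ δ * ‖x - x₀‖ ^ 2 := by positivity
  refine ⟨x, hx.1, w x, (q.1 + (Z : E N →L[ℝ] E N) (x - x₀), Z), hx3, ?_, ?_, ?_⟩
  · rw [Real.dist_eq, abs_lt]
    constructor <;> linarith
  · rw [Prod.dist_eq, max_lt_iff]
    constructor
    · simpa [dist_eq_norm] using hx2
    · rw [dist_eq_norm, hZ, add_sub_cancel_left]
      exact (Sym.norm_smul _ _).trans_lt hδ1
  · refine hwsub.subAt hx.1 ?_
    have hexp := hasExpansionAt_quad q.1 Z x₀ x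
    refine superjet_of_eventually_le
      (((hexp.add (hasExpansionAt_const (w x - T x) x))).mem_superjet O |> fun h => by
        rwa [add_zero] at h) ?_ (by simp only [hT]; ring)
    have hball : Metric.closedBall x₀ σ ∈ 𝓝 x :=
      mem_of_superset (Metric.isOpen_ball.mem_nhds (by rwa [Metric.mem_ball, dist_eq_norm]))
        Metric.ball_subset_closedBall
    filter_upwards [mem_nhdsWithin_of_mem_nhds hball, self_mem_nhdsWithin] with z hz hzO
    have := hxmax' z hzO hz
    simp only [hT] at this ⊢
    linarith

/-- The envelope of the supremum of a family of subsolutions is a subsolution. -/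
lemma isSubsolution_uscEnv (H : Admissible Ω F f γ ω U) {S : Set (E N → ℝ)}
    (hS : ∀ w ∈ S, IsSubsolution Ω F (neumannB Ω f) w) {W : E N → ℝ} {K : ℝ}
    (hK : ∀ y ∈ closure Ω, W y ≤ K) (hW : ∀ w ∈ S, ∀ y ∈ closure Ω, w y ≤ W y)
    (hsup : ∀ y ∈ closure Ω, ∀ c < W y, ∃ w ∈ S, c < w y) :
    IsSubsolution Ω F (neumannB Ω f) (uscEnv (closure Ω) W) := by
  refine H.isSubsolution_of_superjet (upperSemicontinuousOn_uscEnv hK) fun x hx q hq => ?_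
  choose z hz r j d1 d2 d3 hsub using fun k : ℕ =>
    H.exists_subAt_near hS hK hW hsup hx hq (Nat.one_div_pos_of_nat (α := ℝ) (n := k))
  have t0 := tendsto_one_div_add_atTop_nhds_zero_nat (𝕜 := ℝ)
  exact H.subAt_of_tendsto hz hsub
    (tendsto_iff_dist_tendsto_zero.2 (squeeze_zero (fun _ => dist_nonneg) (fun k => (d1 k).le) t0))
    (tendsto_iff_dist_tendsto_zero.2 (squeeze_zero (fun _ => dist_nonneg) (fun k => (d2 k).le) t0))
    (tendsto_iff_dist_tendsto_zero.2 (squeeze_zero (fun _ => dist_nonneg) (fun k => (d3 k).le) t0))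

end Admissible

end Viscosity

/-! ### Perron's method: the bump construction and the existence of a solution -/

namespace Viscosity

variable {N : ℕ}

namespace Admissible

variable {Ω : Set (E N)} {F : E N → ℝ → E N → Sym N → ℝ} {f : E N → ℝ → ℝ}
  {γ : ℝ} {ω : ℝ → ℝ≥0∞} {U : Set (E N)}

/-- Strict local solvability persists near a point. -/
lemma eventually_strict (H : Admissible Ω F f γ ω U) {x₀ : E N} (hx₀ : x₀ ∈ closure Ω)
    {b : E N × ℝ → ℝ} {p : E N × ℝ → E N} {X : E N × ℝ → Sym N} {t₀ : ℝ} (hb : Continuous b)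
    (hp : Continuous p) (hX : Continuous X)
    (h1 : F x₀ (b (x₀, t₀)) (p (x₀, t₀)) (X (x₀, t₀)) < 0)
    (h2 : x₀ ∈ frontier Ω →
      neumannB Ω f x₀ (b (x₀, t₀)) (p (x₀, t₀)) (X (x₀, t₀)) < 0) :
    ∀ᶠ z in 𝓝 (x₀, t₀), (z.1 ∈ closure Ω → F z.1 (b z) (p z) (X z) < 0) ∧
      (z.1 ∈ frontier Ω → neumannB Ω f z.1 (b z) (p z) (X z) < 0) := by
  have t : Tendsto (fun z : E N × ℝ => (z.1, b z, p z, X z)) (𝓝 (x₀, t₀))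
      (𝓝 (x₀, b (x₀, t₀), p (x₀, t₀), X (x₀, t₀))) :=
    (continuous_fst.prodMk (hb.prodMk (hp.prodMk hX))).tendsto _
  have e1 := eventually_nhdsWithin_iff.1
    ((H.cont (x₀, b (x₀, t₀), p (x₀, t₀), X (x₀, t₀)) ⟨hx₀, mem_univ _⟩).eventually
      (gt_mem_nhds h1))
  have e2 : ∀ᶠ z in 𝓝 (x₀, t₀),
      z.1 ∈ frontier Ω → neumannB Ω f z.1 (b z) (p z) (X z) < 0 := by
    by_cases hf : x₀ ∈ frontier Ω
    · have e := eventually_nhdsWithin_iff.1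
        ((H.continuousOn_neumannB (x₀, b (x₀, t₀), p (x₀, t₀), X (x₀, t₀))
          ⟨hf, mem_univ _⟩).eventually (gt_mem_nhds (h2 hf)))
      filter_upwards [t.eventually e] with z hz hzf
      exact hz ⟨hzf, mem_univ _⟩
    · have : ∀ᶠ z : E N × ℝ in 𝓝 (x₀, t₀), z.1 ∈ (frontier Ω)ᶜ :=
        continuousAt_fst.eventually (isClosed_frontier.isOpen_compl.mem_nhds hf)
      filter_upwards [this] with z hz hzf
      exact absurd hzf hz
  filter_upwards [t.eventually e1, e2] with z hz hz2
  exact ⟨fun h => hz ⟨h, mem_univ _⟩, hz2⟩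

/-- Replacing a subsolution by its maximum with a smooth strict local subsolution. -/
lemma isSubsolution_bump (H : Admissible Ω F f γ ω U) {w b : E N → ℝ} {J : E N → E N × Sym N}
    {x₀ : E N} {s : ℝ} (hw : IsSubsolution Ω F (neumannB Ω f) w) (hbc : Continuous b)
    (hexp : ∀ x, HasExpansionAt b (J x) x)
    (hF : ∀ x ∈ closure Ω, dist x x₀ < s → F x (b x) (J x).1 (J x).2 < 0)
    (hB : ∀ x ∈ frontier Ω, dist x x₀ < s → neumannB Ω f x (b x) (J x).1 (J x).2 < 0)
    (hs : 0 < s) (hlt : ∀ x ∈ closure Ω, dist x x₀ < s → s / 2 ≤ dist x x₀ → b x < w x) :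
    ∃ V, IsSubsolution Ω F (neumannB Ω f) V ∧ ∀ x ∈ closure Ω, dist x x₀ < s → b x ≤ V x := by
  classical
  set V : E N → ℝ := fun x => if dist x x₀ < s then max (w x) (b x) else w x with hV
  have hwV : ∀ x, w x ≤ V x := by
    intro x
    simp only [hV]
    split_ifs
    exacts [le_max_left _ _, le_rfl]
  have hin : ∀ x, dist x x₀ < s → V x = max (w x) (b x) := fun x hx => if_pos hx
  -- On the outer annulus `b < w`, so the maximum glues to `w` and semicontinuity is not lost at
  -- radius `s`.
  have hout : ∀ x ∈ closure Ω, s / 2 ≤ dist x x₀ → V x = w x := by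
    intro x hx hd
    by_cases h : dist x x₀ < s
    · rw [hin x h, max_eq_left (hlt x hx h hd).le]
    · exact if_neg h
  have hbV : ∀ x, dist x x₀ < s → b x ≤ V x := fun x hx => (hin x hx).symm ▸ le_max_right _ _
  refine ⟨V, H.isSubsolution_of_superjet (fun x hx c hc => ?_) fun x hx q hq => ?_,
    fun x _ => hbV x⟩
  · by_cases h : dist x x₀ < s
    · replace hc : V x < c := hc
      rw [hin x h, max_lt_iff] at hc
      filter_upwards [hw.1 x hx c hc.1,
        mem_nhdsWithin_of_mem_nhds (hbc.continuousAt.eventually (gt_mem_nhds hc.2)),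
        mem_nhdsWithin_of_mem_nhds (Metric.isOpen_ball.mem_nhds (Metric.mem_ball.2 h))]
        with y h1 h2 h3
      rw [hin y h3]
      exact max_lt h1 h2
    · have h' : s / 2 < dist x x₀ := by linarith [not_lt.1 h]
      replace hc : V x < c := hc
      rw [hout x hx h'.le] at hc
      have hd : ∀ᶠ y in 𝓝[closure Ω] x, s / 2 < dist y x₀ :=
        mem_nhdsWithin_of_mem_nhds ((Continuous.continuousAt (f := fun y : E N => dist y x₀)
          (by fun_prop)).eventually (lt_mem_nhds h'))
      filter_upwards [hw.1 x hx c hc, hd, self_mem_nhdsWithin] with y h1 h2 h3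
      rwa [hout y h3 h2.le]
  · by_cases hxw : V x = w x
    · rw [hxw]
      exact hw.subAt hx (superjet_of_eventually_le hq (.of_forall hwV) hxw.symm)
    · have h : dist x x₀ < s := by
        by_contra h
        exact hxw (if_neg h)
      have hxb : V x = b x := by
        rw [hin x h] at hxw ⊢
        rcases max_choice (w x) (b x) with h' | h'
        exacts [absurd h' hxw, h']
      have hsub : J x ∈ subjet (closure Ω) V x := by
        rw [mem_subjet_iff]
        refine superjet_of_eventually_le (mem_subjet_iff.1 ((hexp x).mem_subjet (closure Ω))) ?_
          (by simp only [hxb])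
        filter_upwards [mem_nhdsWithin_of_mem_nhds
          (Metric.isOpen_ball.mem_nhds (Metric.mem_ball.2 h))] with y hy
        exact neg_le_neg (hbV y hy)
      refine H.subAt_of_mem_jets hx hq hsub (fun _ => ?_) fun hf => ?_
      · rw [hxb]; exact (hF x hx h).le
      · rw [hxb]; exact (hB x hf h).le

/-- The lower envelope of a maximal subsolution is a supersolution. -/
lemma isSubsolution_reflect_of_maximal (H : Admissible Ω F f γ ω U) {w : E N → ℝ} {K : ℝ}
    (hw : IsSubsolution Ω F (neumannB Ω f) w) (hK : ∀ y ∈ closure Ω, -w y ≤ K)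
    (hmax : ∀ v, IsSubsolution Ω F (neumannB Ω f) v → ∀ y ∈ closure Ω, v y ≤ w y) :
    IsSubsolution Ω (reflectOp F) (neumannB Ω (reflectBdry f))
      (uscEnv (closure Ω) fun x => -w x) := by
  set M := uscEnv (closure Ω) fun x => -w x with hM
  refine H.reflect.isSubsolution_of_superjet (upperSemicontinuousOn_uscEnv hK) fun x₀ hx₀ q hq => ?_
  -- Otherwise the quadratic given by the jet, opened by `δ` and raised by `τ`, is a strict
  -- classical subsolution near `x₀`. It lies below `w` on an annulus but above `w` at points near
  -- `x₀`, and the bumped function contradicts maximality.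
  have hgoal : ¬ (F x₀ (-M x₀) (-q.1) (-q.2) < 0 ∧
      (x₀ ∈ frontier Ω → neumannB Ω f x₀ (-M x₀) (-q.1) (-q.2) < 0)) := by
    rintro ⟨hF, hB⟩
    -- choice of the opening `δ`
    obtain ⟨δ, hδ, hFδ, hBδ⟩ : ∃ δ : ℝ, 0 < δ ∧
        F x₀ (-M x₀) (-q.1) (-q.2 - (4 * δ) • (1 : Sym N)) < 0 ∧
        (x₀ ∈ frontier Ω →
          neumannB Ω f x₀ (-M x₀) (-q.1) (-q.2 - (4 * δ) • (1 : Sym N)) < 0) := by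
      have hcX : Continuous fun z : E N × ℝ => -q.2 - (4 * z.2) • (1 : Sym N) := by fun_prop
      have h0 : -q.2 - (4 * (0 : ℝ)) • (1 : Sym N) = -q.2 := by
        rw [mul_zero, show (0 : ℝ) • (1 : Sym N) = 0 from Subtype.ext
          (zero_smul ℝ ((1 : Sym N) : E N →L[ℝ] E N)), sub_zero]
      have e := H.eventually_strict (t₀ := 0) hx₀ (b := fun _ => -M x₀) (p := fun _ => -q.1)
        continuous_const continuous_const hcX (by rwa [h0]) (by rwa [h0])
      have e' : ∀ᶠ δ : ℝ in 𝓝[>] 0, _ :=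
        (((Continuous.prodMk continuous_const continuous_id).tendsto' (0 : ℝ) (x₀, (0 : ℝ))
          rfl).mono_left nhdsWithin_le_nhds).eventually e
      obtain ⟨δ, ⟨h1, h2⟩, h3⟩ := (e'.and self_mem_nhdsWithin).exists
      exact ⟨δ, h3, h1 hx₀, h2⟩
    set Z : Sym N := -q.2 - (4 * δ) • (1 : Sym N) with hZ
    set T : E N → ℝ := fun y => inner ℝ (-q.1) (y - x₀) + (1 / 2) * quad Z (y - x₀) with hT
    have hTc : Continuous T := by
      have : Continuous fun y : E N => quad Z (y - x₀) :=
        continuous_quad.comp (continuous_const.prodMk (by fun_prop))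
      fun_prop
    have hT0 : T x₀ = 0 := by simp [hT]
    have hpc : Continuous fun z : E N × ℝ => -q.1 + (Z : E N →L[ℝ] E N) (z.1 - x₀) := by fun_prop
    have hbc : Continuous fun z : E N × ℝ => T z.1 + (-M x₀ + z.2) := by fun_prop
    have e := H.eventually_strict (t₀ := 0) hx₀ hbc hpc (X := fun _ => Z) continuous_const
      (by simpa [hT0] using hFδ) (by simpa [hT0] using hBδ)
    obtain ⟨r, hr, hball⟩ := Metric.eventually_nhds_iff.1 e
    obtain ⟨s', hs', hjet⟩ := Metric.mem_nhdsWithin_iff.1 (hq δ hδ)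
    set s := min r s' with hs
    have hs0 : 0 < s := lt_min hr hs'
    -- On the annulus the opening leaves a margin of at least `δ(s/2)²` below `w`, and `τ` consumes
    -- at most half of it.
    set τ := min (r / 2) (δ * (s / 2) ^ 2 / 2) with hτ
    have hτ0 : 0 < τ := by positivity
    have hτ1 : τ ≤ r / 2 := min_le_left _ _
    have hτ2 : τ ≤ δ * (s / 2) ^ 2 / 2 := min_le_right _ _
    set b : E N → ℝ := fun y => T y + (-M x₀ + τ) with hb
    have hstrict : ∀ x, dist x x₀ < s → dist (x, τ) (x₀, (0 : ℝ)) < r := by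
      intro x hx
      rw [Prod.dist_eq, max_lt_iff, Real.dist_0_eq_abs, abs_of_pos hτ0]
      exact ⟨hx.trans_le (min_le_left _ _), by linarith⟩
    have hMw : ∀ y ∈ closure Ω, -M y ≤ w y := fun y hy => by
      have := le_uscEnv hK hy
      linarith
    obtain ⟨V, hVsub, hVb⟩ := H.isSubsolution_bump (x₀ := x₀) (s := s) (b := b)
      (J := fun x => (-q.1 + (Z : E N →L[ℝ] E N) (x - x₀), Z)) hw
      (by fun_prop)
      (fun x => by
        have := (hasExpansionAt_quad (-q.1) Z x₀ x).add (hasExpansionAt_const (-M x₀ + τ) x)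
        rwa [add_zero] at this)
      (fun x hx hxs => (hball (hstrict x hxs)).1 hx)
      (fun x hx hxs => (hball (hstrict x hxs)).2 hx) hs0
      (fun x hx hxs hxs2 => by
        have h1 := hjet ⟨Metric.mem_ball.2 (hxs.trans_le (min_le_right _ _)), hx⟩
        simp only [mem_ofPred_eq] at h1
        have h2 := hMw x hx
        rw [dist_eq_norm] at hxs2
        have h3 : δ * (s / 2) ^ 2 ≤ δ * ‖x - x₀‖ ^ 2 := by gcongr
        have h4 : 0 < δ * (s / 2) ^ 2 := by positivity
        simp only [hb, hT, hZ, quad_sub, quad_neg, quad_smul, quad_one, inner_neg_left]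
        linarith)
    -- Arbitrarily near `x₀` there are points with `w < -M x₀ + τ/2`, whereas `b` exceeds that value
    -- close to `x₀`.
    have hfreq := frequently_lt_of_lt_uscEnv (W := fun x => -w x) hx₀
      (show M x₀ - τ / 2 < M x₀ by linarith)
    have hev : ∀ᶠ y in 𝓝[closure Ω] x₀, -(τ / 2) < T y ∧ dist y x₀ < s ∧ y ∈ closure Ω := by
      filter_upwards [mem_nhdsWithin_of_mem_nhds (hTc.continuousAt.eventually
        (lt_mem_nhds (show -(τ / 2) < T x₀ by rw [hT0]; linarith))),
        mem_nhdsWithin_of_mem_nhds (Metric.ball_mem_nhds x₀ hs0), self_mem_nhdsWithin]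
        with y h1 h2 h3
      exact ⟨h1, h2, h3⟩
    obtain ⟨y, hy1, hy2, hy3, hyO⟩ := (hfreq.and_eventually hev).exists
    have h1 := hVb y hyO hy3
    have h2 := hmax V hVsub y hyO
    simp only [hb] at h1
    linarith
  refine ⟨fun hi => ?_, fun hfr => ?_⟩
  · by_contra! hcon
    refine hgoal ⟨neg_pos.1 hcon, fun hfr => ?_⟩
    exact absurd hfr (H.notMem_frontier hi)
  · by_contra! hcon
    rw [lt_min_iff, neumannB_reflect] at hcon
    exact hgoal ⟨neg_pos.1 hcon.1, fun _ => neg_pos.1 hcon.2⟩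

/-- A reflected subsolution serves as a supersolution, and comparison with it bounds all
subsolutions from above. The envelope of their supremum is the largest subsolution, and its lower
envelope is a supersolution; comparison leaves no gap between them. -/
lemma exists_solution (H : Admissible Ω F f γ ω U) :
    ∃ w, IsSolution Ω F (neumannB Ω f) w := by
  obtain ⟨a, hac, ha⟩ := H.exists_continuous_subsolution
  obtain ⟨b', hbc, hb'⟩ := H.reflect.exists_continuous_subsolution
  have hb := isSupersolution_reflect hb'
  obtain ⟨A, hA⟩ := H.dom.2.1.exists_bound_of_continuousOn hac.continuousOn
  obtain ⟨K, hK⟩ := H.dom.2.1.exists_bound_of_continuousOn hbc.continuousOn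
  set S : Set (E N → ℝ) := {w | IsSubsolution Ω F (neumannB Ω f) w} with hS
  set W : E N → ℝ := fun x => sSup ((fun w => w x) '' S) with hWdef
  have hbd : ∀ w ∈ S, ∀ x ∈ closure Ω, w x ≤ K := fun w hw x hx =>
    (H.comparison hw hb x hx).trans ((neg_le_abs _).trans (hK x hx))
  have hne : ∀ x, ((fun w : E N → ℝ => w x) '' S).Nonempty := fun x => ⟨a x, a, ha, rfl⟩
  have hWK : ∀ x ∈ closure Ω, W x ≤ K := fun x hx =>
    csSup_le (hne x) (by rintro _ ⟨w, hw, rfl⟩; exact hbd w hw x hx)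
  have hW : ∀ w ∈ S, ∀ x ∈ closure Ω, w x ≤ W x := fun w hw x hx =>
    le_csSup ⟨K, by rintro _ ⟨w, hw, rfl⟩; exact hbd w hw x hx⟩ ⟨w, hw, rfl⟩
  have hsup : ∀ x ∈ closure Ω, ∀ c < W x, ∃ w ∈ S, c < w x := by
    intro x _ c hc
    obtain ⟨_, ⟨w, hw, rfl⟩, h⟩ := exists_lt_of_lt_csSup (hne x) hc
    exact ⟨w, hw, h⟩
  set w := uscEnv (closure Ω) W with hw
  have hwsub : IsSubsolution Ω F (neumannB Ω f) w :=
    H.isSubsolution_uscEnv (fun _ h => h) hWK hW hsup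
  have hmax : ∀ v, IsSubsolution Ω F (neumannB Ω f) v → ∀ y ∈ closure Ω, v y ≤ w y :=
    fun v hv y hy => (hW v hv y hy).trans (le_uscEnv hWK hy)
  have hwA : ∀ y ∈ closure Ω, -w y ≤ A := fun y hy => by
    have h1 := hmax a ha y hy
    have h2 := (neg_le_abs _).trans (hA y hy)
    linarith
  have hM := H.isSubsolution_reflect_of_maximal hwsub hwA hmax
  have hcomp := H.comparison hwsub (isSupersolution_reflect hM)
  -- Comparison gives `w ≤ -uscEnv (-w)`, and the reverse inequality is automatic; so `w` itself
  -- satisfies the supersolution conditions.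
  have heq : EqOn (uscEnv (closure Ω) fun x => -w x) (fun x => -w x) (closure Ω) := fun x hx => by
    have h1 := hcomp x hx
    have h2 := le_uscEnv hwA hx
    exact le_antisymm (by linarith) h2
  have hsuper := isSupersolution_reflect (hM.congr heq)
  simp only [neg_neg] at hsuper
  exact ⟨w, hwsub, hsuper⟩

end Admissible

end Viscosity

/-! ### Comparison, existence and uniqueness assembled -/

theorem theorem7p5 (N : ℕ) (Ω : Set (Viscosity.E N))
    (hΩ : Viscosity.IsCompactC1Domain Ω)
    (hsphere : Viscosity.UniformExteriorSphere Ω)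
    (F : Viscosity.E N → ℝ → Viscosity.E N → Viscosity.Sym N → ℝ)
    (hFcont : ContinuousOn
      (fun z : Viscosity.E N × ℝ × Viscosity.E N × Viscosity.Sym N =>
        F z.1 z.2.1 z.2.2.1 z.2.2.2)
      (closure Ω ×ˢ Set.univ))
    (hFproper : Viscosity.IsProper (closure Ω) F)
    (γ : ℝ) (hγ : 0 < γ)
    (hFmono : ∀ x ∈ closure Ω, ∀ (r s : ℝ) (p : Viscosity.E N) (X : Viscosity.Sym N),
      s ≤ r → γ * (r - s) ≤ F x r p X - F x s p X)
    (ω : ℝ → ℝ≥0∞) (hω : Tendsto ω (𝓝[>] 0) (𝓝 0))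
    (U : Set (Viscosity.E N)) (hU : IsOpen U) (hUΩ : frontier Ω ⊆ U)
    (hFunif : ∀ x ∈ U ∩ closure Ω, ∀ (r : ℝ) (p q : Viscosity.E N) (X Y : Viscosity.Sym N),
      ENNReal.ofReal |F x r p X - F x r q Y| ≤ ω (‖p - q‖ + ‖X - Y‖))
    (hFstruct : ∀ α : ℝ, 0 < α → ∀ x ∈ closure Ω, ∀ y ∈ closure Ω,
      ∀ (r : ℝ) (p : Viscosity.E N) (X Y : Viscosity.Sym N),
      Viscosity.BlockBound α X Y →
      ENNReal.ofReal (F y r p Y - F x r p X) ≤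
        ω (α * ‖x - y‖ ^ 2 + ‖x - y‖ * (‖p‖ + 1)))
    (f : Viscosity.E N → ℝ → ℝ)
    (hfcont : ContinuousOn (fun z : Viscosity.E N × ℝ => f z.1 z.2) (frontier Ω ×ˢ Set.univ))
    (hfmono : ∀ x ∈ frontier Ω, Monotone (f x)) :
    (∀ u v : Viscosity.E N → ℝ,
      Viscosity.IsSubsolution Ω F (Viscosity.neumannB Ω f) u →
      Viscosity.IsSupersolution Ω F (Viscosity.neumannB Ω f) v →
      ∀ x ∈ closure Ω, u x ≤ v x) ∧
    (∃ w : Viscosity.E N → ℝ, Viscosity.IsSolution Ω F (Viscosity.neumannB Ω f) w ∧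
      ∀ w' : Viscosity.E N → ℝ, Viscosity.IsSolution Ω F (Viscosity.neumannB Ω f) w' →
        Set.EqOn w' w (closure Ω)) := by
  have H : Viscosity.Admissible Ω F f γ ω U :=
    ⟨hΩ, hsphere, hFcont, hFproper, hγ, hFmono, hω, hU, hUΩ, hFunif, hFstruct, hfcont, hfmono⟩
  obtain ⟨w, hw⟩ := H.exists_solution
  exact ⟨fun u v hu hv => H.comparison hu hv, w, hw, fun w' hw' x hx =>
    le_antisymm (H.comparison hw'.1 hw.2 x hx) (H.comparison hw.1 hw'.2 x hx)⟩
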